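/- Let $L,\rho_1,\rho_2,k_1,k_2>0$, $0<\alpha<1$, $\eta\ge 0$, and put $\mu(\xi)=|\xi|^{(2\alpha-1)/2}$ $(\xi\in\mathbb R)$, $\mathfrak C=\pi^{-1}\sin(\alpha\pi)$. Functions take values in $\mathbb K\in\{\mathbb R,\mathbb C\}$. Let $\mathbb L^2=L^2(-L,0)\times L^2(0,L)$, $$\mathbb H^1_0=\{(u,v)\in H^1(-L,0)\times H^1(0,L):\ u(-L)=v(L)=0,\ u(0)=v(0)\},$$ and let $\mathcal H=\mathbb H^1_0\times\mathbb L^2\times L^2(\mathbb R;\mathbb L^2)$, with elements $\mathbb U=(u,v,U,V,\varphi_1,\varphi_2)$, carry the norm $$\|\mathbb U\|_{\mathcal H}^2=\rho_1\|U\|^2+\rho_2\|V\|^2+k_1\|u_x\|^2+k_2\|v_x\|^2+\mathfrak C\|\varphi_1\|^2_{L^2(\mathbb R;L^2(-L,0))}+\mathfrak C\|\varphi_2\|^2_{L^2(\mathbb R;L^2(0,L))}$$ and the corresponding inner product. Let $\mathcal A$ be the operator $$\mathcal A\mathbb U=\Big(U,\;V,\;\tfrac1{\rho_1}\big[k_1u_{xx}-\mathfrak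 C\!\int_{\mathbb R}\mu\varphi_1\,d\xi\big],\;\tfrac1{\rho_2}\big[k_2v_{xx}-\mathfrak C\!\int_{\mathbb R}\mu\varphi_2\,d\xi\big],\;-(|\xi|^2+\eta)\varphi_1+\mu U,\;-(|\xi|^2+\eta)\varphi_2+\mu V\Big)$$ whose domain $D(\mathcal A)$ consists of all $\mathbb U\in\mathcal H$ such that $(U,V)\in\mathbb H^1_0$, $u\in H^2(-L,0)$, $v\in H^2(0,L)$, $k_1u_x(0)=k_2v_x(0)$, and $|\xi|\varphi_1$, $-(|\xi|^2+\eta)\varphi_1+\mu U\in L^2(\mathbb R;L^2(-L,0))$, $|\xi|\varphi_2$, $-(|\xi|^2+\eta)\varphi_2+\mu V\in L^2(\mathbb R;L^2(0,L))$. The augmented system is the Cauchy problem $$\mathbb U'(t)=\mathcal A\mathbb U(t),\qquad \mathbb U(0)=\mathbb U_0. \tag{1}$$ Then the following hold. 1. $\mathcal H$ is a Hilbert space and $\mathcal A$ is the infinitesimal generator of a strongly continuous semigroup of contractions on $\mathcal H$. 2. For every $\mathbb U_0\in\mathcal H$ problem (1) has a unique mild solution, that is, a unique $\mathbb U\in C([0,\infty);\mathcal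 H)$ such that, for all $t\ge0$, $\int_0^t\mathbb U(s)\,ds\in D(\mathcal A)$ and $\mathbb U(t)=\mathbb U_0+\mathcal A\int_0^t\mathbb U(s)\,ds$. 3. For every $\mathbb U_0\in D(\mathcal A)$ problem (1) has a unique strong solution $\mathbb U\in C([0,\infty);D(\mathcal A))\cap C^1([0,\infty);\mathcal H)$, where $D(\mathcal A)$ carries the graph norm. 4. The energy $$E(t)=\tfrac12\Big[\rho_1\|U(t)\|^2+k_1\|u_x(t)\|^2+\rho_2\|V(t)\|^2+k_2\|v_x(t)\|^2+\mathfrak C\|\varphi_1(t)\|^2+\mathfrak C\|\varphi_2(t)\|^2\Big]$$ of every strong solution, and of every mild solution with initial data of the form $\mathbb U_0=(u_0,v_0,u_1,v_1,0,0)\in\mathcal H$, is differentiable on $[0,\infty)$ (from the right at $t=0$) and satisfies, for all $t\ge 0$, $$\frac{d}{dt}E(t)=-\mathfrak C\int_{\mathbb R}(|\xi|^2+\eta)\|\varphi_1(t,\xi)\|^2_{L^2(-L,0)}\,d\xi-\mathfrak C\int_{\mathbb R}(|\xi|^2+\eta)\|\varphi_2(t,\xi)\|^2_{L^2(0,L)}\,d\xi,$$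 where both integrals converge. -/

import Mathlib

open MeasureTheory Set Filter Topology
open scoped ContDiff NNReal ENNReal

noncomputable section

namespace FracWave

/-! ### Semigroups, generators and solutions of abstract Cauchy problems -/

section Abstract

variable {𝕜 E : Type*} [RCLike 𝕜] [NormedAddCommGroup E] [NormedSpace 𝕜 E]

/-- `S` is a strongly continuous semigroup of contractions on `E`. -/
structure IsContractionSemigroup (S : ℝ≥0 → E →L[𝕜] E) : Prop where
  map_zero : S 0 = ContinuousLinearMap.id 𝕜 E
  map_add : ∀ s t, S (s + t) = (S s).comp (S t)
  strong_cont : ∀ x, Tendsto (fun t => S t x) (𝓝[>] 0) (𝓝 x)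
  contraction : ∀ t, ‖S t‖ ≤ 1

/-- The unbounded operator `A` is the infinitesimal generator of `S`: its domain is exactly the set
of those `x` for which `(S h x - x) / h` converges as `h → 0+`, and `A x` is the limit. -/
def IsGenerator (A : E →ₗ.[𝕜] E) (S : ℝ≥0 → E →L[𝕜] E) : Prop :=
  ∀ x y : E, (x, y) ∈ A.graph ↔
    Tendsto (fun h : ℝ≥0 => (((h : ℝ) : 𝕜)⁻¹) • (S h x - x)) (𝓝[>] 0) (𝓝 y)

variable [NormedSpace ℝ E]

/-- `x ∈ C([0,∞); E)` is a mild solution of `x' = A x`, `x(0) = x₀`: for all `t ≥ 0` the integral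
`∫₀ᵗ x(s) ds` lies in `D(A)` and `x(t) = x₀ + A ∫₀ᵗ x(s) ds`.
Only the values of `x` on `[0,∞)` matter. -/
def IsMildSolution (A : E →ₗ.[𝕜] E) (x₀ : E) (x : ℝ → E) : Prop :=
  ContinuousOn x (Ici 0) ∧
    ∀ t, 0 ≤ t → ∃ h : (∫ s in (0 : ℝ)..t, x s) ∈ A.domain, x t = x₀ + A ⟨_, h⟩

/-- `x ∈ C([0,∞); D(A)) ∩ C¹([0,∞); E)` is a strong solution of `x' = A x`, `x(0) = x₀`.
Here `y = A x`, so that the continuity of `x` and `y` is the continuity of `x` in the graph norm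
of `D(A)`. Only the values of `x` on `[0,∞)` matter. -/
def IsStrongSolution (A : E →ₗ.[𝕜] E) (x₀ : E) (x : ℝ → E) : Prop :=
  x 0 = x₀ ∧ ∃ y : ℝ → E,
    (∀ t, 0 ≤ t → (x t, y t) ∈ A.graph) ∧
    ContinuousOn x (Ici 0) ∧ ContinuousOn y (Ici 0) ∧
    ∀ t, 0 ≤ t → HasDerivWithinAt x (y t) (Ici 0) t

end Abstract

/-! ### `L²`, weak derivatives and traces on an interval -/

section Interval

variable {𝕜 : Type*} [RCLike 𝕜] {a b : ℝ}

/-- `L²((a,b); 𝕜)`. -/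
abbrev L2 (𝕜 : Type*) [RCLike 𝕜] (a b : ℝ) : Type _ :=
  Lp 𝕜 2 (volume.restrict (Ioo a b))

/-- `g` is the weak derivative of `u` on `(a,b)`. -/
def IsWeakDeriv (u g : L2 𝕜 a b) : Prop :=
  ∀ φ : ℝ → ℝ, ContDiff ℝ ∞ φ → HasCompactSupport φ → tsupport φ ⊆ Ioo a b →
    ∫ x in Ioo a b, deriv φ x • u x = - ∫ x in Ioo a b, φ x • g x

/-- `u ∈ H¹(a,b)`: the weak derivative exists in `L²(a,b)`. -/
def MemH1 (u : L2 𝕜 a b) : Prop := ∃ g, IsWeakDeriv u g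

open Classical in
/-- The weak derivative of `u ∈ H¹(a,b)` (with value `0` if `u ∉ H¹(a,b)`). -/
def weakDeriv (u : L2 𝕜 a b) : L2 𝕜 a b := if h : MemH1 u then h.choose else 0

/-- `u ∈ H²(a,b)`. -/
def MemH2 (u : L2 𝕜 a b) : Prop := MemH1 u ∧ MemH1 (weakDeriv u)

/-- `f` is, on `[a,b]`, the continuous representative of the class `u`. Boundary values of an
`H¹` function are the values of its continuous representative at the end points. -/
def IsContRep (u : L2 𝕜 a b) (f : ℝ → 𝕜) : Prop :=
  ContinuousOn f (Icc a b) ∧ u =ᵐ[volume.restrict (Ioo a b)] f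

theorem integrable_L2 (u : L2 𝕜 a b) : Integrable u (volume.restrict (Ioo a b)) :=
  (Lp.memLp u).integrable (by norm_num)

theorem integrable_test {φ : ℝ → ℝ} (hφ : Continuous φ) (hc : HasCompactSupport φ)
    (u : L2 𝕜 a b) : Integrable (fun x => φ x • u x) (volume.restrict (Ioo a b)) := by
  obtain ⟨C, hC⟩ := hc.exists_bound_of_continuous hφ
  exact (integrable_L2 u).bdd_smul C hφ.aestronglyMeasurable (Eventually.of_forall hC)

theorem IsWeakDeriv.add {u v g h : L2 𝕜 a b} (hu : IsWeakDeriv u g) (hv : IsWeakDeriv v h) :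
    IsWeakDeriv (u + v) (g + h) := by
  intro φ hφ hc hs
  have hd : Continuous (deriv φ) := hφ.continuous_deriv (by simp)
  have h1 : ∫ x in Ioo a b, deriv φ x • (u + v : L2 𝕜 a b) x
      = ∫ x in Ioo a b, (deriv φ x • u x + deriv φ x • v x) := by
    refine integral_congr_ae ?_
    filter_upwards [Lp.coeFn_add u v] with x hx
    simp only [hx, Pi.add_apply, smul_add]
  have h2 : ∫ x in Ioo a b, φ x • (g + h : L2 𝕜 a b) x
      = ∫ x in Ioo a b, (φ x • g x + φ x • h x) := by
    refine integral_congr_ae ?_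
    filter_upwards [Lp.coeFn_add g h] with x hx
    simp only [hx, Pi.add_apply, smul_add]
  rw [h1, h2, integral_add (integrable_test hd hc.deriv u) (integrable_test hd hc.deriv v),
    integral_add (integrable_test hφ.continuous hc g) (integrable_test hφ.continuous hc h),
    hu φ hφ hc hs, hv φ hφ hc hs]
  ring

theorem IsWeakDeriv.smul {u g : L2 𝕜 a b} (c : 𝕜) (hu : IsWeakDeriv u g) :
    IsWeakDeriv (c • u) (c • g) := by
  intro φ hφ hc hs
  have key : ∀ (ψ : ℝ → ℝ) (w : L2 𝕜 a b), ∫ x in Ioo a b, ψ x • (c • w : L2 𝕜 a b) x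
      = c • ∫ x in Ioo a b, ψ x • w x := by
    intro ψ w
    rw [← integral_smul]
    refine integral_congr_ae ?_
    filter_upwards [Lp.coeFn_smul c w] with x hx
    simp only [hx, Pi.smul_apply, smul_comm c]
  rw [key, key, hu φ hφ hc hs, smul_neg]

theorem IsWeakDeriv.zero : IsWeakDeriv (0 : L2 𝕜 a b) 0 := by
  have h : ∀ w : L2 𝕜 a b, (0 : 𝕜) • w = 0 := fun w => zero_smul 𝕜 w
  intro φ _ _ _
  have key : ∀ (ψ : ℝ → ℝ), ∫ x in Ioo a b, ψ x • (0 : L2 𝕜 a b) x = 0 := by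
    intro ψ
    rw [← integral_zero ℝ 𝕜 (μ := volume.restrict (Ioo a b))]
    refine integral_congr_ae ?_
    filter_upwards [Lp.coeFn_zero 𝕜 2 (volume.restrict (Ioo a b))] with x hx
    simp only [hx, Pi.zero_apply, smul_zero]
  rw [key, key, neg_zero]

theorem L2_eq_of_test {u v : L2 𝕜 a b}
    (h : ∀ φ : ℝ → ℝ, ContDiff ℝ ∞ φ → HasCompactSupport φ → tsupport φ ⊆ Ioo a b →
      ∫ x in Ioo a b, φ x • u x = ∫ x in Ioo a b, φ x • v x) : u = v := by
  have := isOpen_Ioo.ae_eq_zero_of_integral_contDiff_smul_eq_zero (U := Ioo a b)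
    (f := fun x => u x - v x) (μ := volume.restrict (Ioo a b))
    (((integrable_L2 u).sub (integrable_L2 v)).locallyIntegrable.locallyIntegrableOn _) ?_
  · refine Lp.ext ?_
    filter_upwards [this, ae_restrict_mem measurableSet_Ioo] with x hx hm
    exact sub_eq_zero.1 (hx hm)
  · intro φ hφ hc hs
    simp only [smul_sub]
    rw [integral_sub (integrable_test hφ.continuous hc u) (integrable_test hφ.continuous hc v),
      h φ hφ hc hs, sub_self]

theorem IsWeakDeriv.unique {u g h : L2 𝕜 a b} (hg : IsWeakDeriv u g) (hh : IsWeakDeriv u h) :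
    g = h := by
  refine L2_eq_of_test fun φ hφ hc hs => ?_
  have := (hg φ hφ hc hs).symm.trans (hh φ hφ hc hs)
  exact neg_injective this

theorem MemH1.isWeakDeriv {u : L2 𝕜 a b} (h : MemH1 u) : IsWeakDeriv u (weakDeriv u) := by
  rw [weakDeriv, dif_pos h]
  exact h.choose_spec

theorem IsWeakDeriv.eq {u g : L2 𝕜 a b} (h : IsWeakDeriv u g) : weakDeriv u = g :=
  (MemH1.isWeakDeriv ⟨g, h⟩).unique h

theorem MemH1.add {u v : L2 𝕜 a b} (hu : MemH1 u) (hv : MemH1 v) : MemH1 (u + v) :=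
  ⟨_, hu.isWeakDeriv.add hv.isWeakDeriv⟩

theorem MemH1.smul {u : L2 𝕜 a b} (c : 𝕜) (hu : MemH1 u) : MemH1 (c • u) :=
  ⟨_, hu.isWeakDeriv.smul c⟩

theorem MemH1.zero : MemH1 (0 : L2 𝕜 a b) := ⟨_, IsWeakDeriv.zero⟩

theorem weakDeriv_add {u v : L2 𝕜 a b} (hu : MemH1 u) (hv : MemH1 v) :
    weakDeriv (u + v) = weakDeriv u + weakDeriv v :=
  (hu.isWeakDeriv.add hv.isWeakDeriv).eq

theorem weakDeriv_smul {u : L2 𝕜 a b} (c : 𝕜) (hu : MemH1 u) :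
    weakDeriv (c • u) = c • weakDeriv u :=
  (hu.isWeakDeriv.smul c).eq

theorem weakDeriv_zero : weakDeriv (0 : L2 𝕜 a b) = 0 := IsWeakDeriv.zero.eq

theorem MemH2.add {u v : L2 𝕜 a b} (hu : MemH2 u) (hv : MemH2 v) : MemH2 (u + v) :=
  ⟨hu.1.add hv.1, by rw [weakDeriv_add hu.1 hv.1]; exact hu.2.add hv.2⟩

theorem MemH2.smul {u : L2 𝕜 a b} (c : 𝕜) (hu : MemH2 u) : MemH2 (c • u) :=
  ⟨hu.1.smul c, by rw [weakDeriv_smul c hu.1]; exact hu.2.smul c⟩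

theorem MemH2.zero : MemH2 (0 : L2 𝕜 a b) :=
  ⟨MemH1.zero, by rw [weakDeriv_zero]; exact MemH1.zero⟩

theorem IsContRep.add {u v : L2 𝕜 a b} {f g : ℝ → 𝕜} (hu : IsContRep u f)
    (hv : IsContRep v g) : IsContRep (u + v) (fun x => f x + g x) :=
  ⟨hu.1.add hv.1, (Lp.coeFn_add u v).trans (hu.2.add hv.2)⟩

theorem IsContRep.smul {u : L2 𝕜 a b} {f : ℝ → 𝕜} (c : 𝕜) (hu : IsContRep u f) :
    IsContRep (c • u) (fun x => c * f x) :=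
  ⟨continuousOn_const.mul hu.1, (Lp.coeFn_smul c u).trans (hu.2.const_smul c)⟩

theorem IsContRep.zero : IsContRep (0 : L2 𝕜 a b) (fun _ => 0) :=
  ⟨continuousOn_const, Lp.coeFn_zero _ _ _⟩

theorem IsWeakDeriv.ae_const (hab : a < b) {u : L2 𝕜 a b} (hu : IsWeakDeriv u 0) :
    ∃ c : 𝕜, u =ᵐ[volume.restrict (Ioo a b)] fun _ => c := by
  let ψ : ContDiffBump ((a + b) / 2) :=
    ⟨(b - a) / 8, (b - a) / 4, by linarith, by linarith⟩
  set p : ℝ → ℝ := ψ.normed volume with hp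
  have p_smooth : ContDiff ℝ ∞ p := ψ.contDiff_normed
  have p_cs : HasCompactSupport p := ψ.hasCompactSupport_normed
  have p_ts : tsupport p = Metric.closedBall ((a + b) / 2) ((b - a) / 4) :=
    ψ.tsupport_normed_eq
  have p_int : ∫ x, p x = 1 := ψ.integral_normed
  have p_sub : tsupport p ⊆ Ioo a b := by
    rw [p_ts, Real.closedBall_eq_Icc]
    intro x hx
    constructor <;> linarith [hx.1, hx.2]
  have p_ne : (tsupport p).Nonempty := by
    rw [p_ts]; exact Metric.nonempty_closedBall.2 (by linarith)
  set c : 𝕜 := ∫ x in Ioo a b, p x • u x with hc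
  have hcm : MemLp (fun _ : ℝ => c) 2 (volume.restrict (Ioo a b)) := memLp_const c
  refine ⟨c, ?_⟩
  suffices h : u = hcm.toLp _ by
    rw [h]; exact hcm.coeFn_toLp
  refine L2_eq_of_test fun φ hφ hφc hφs => ?_
  set I : ℝ := ∫ x, φ x with hI
  set θ : ℝ → ℝ := fun x => φ x - I * p x with hθ
  have θ_smooth : ContDiff ℝ ∞ θ := hφ.sub (contDiff_const.mul p_smooth)
  have θ_cont : Continuous θ := θ_smooth.continuous
  have θ_int : ∫ x, θ x = 0 := by
    rw [hθ, integral_sub (hφ.continuous.integrable_of_hasCompactSupport hφc)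
      ((p_smooth.continuous.integrable_of_hasCompactSupport p_cs).const_mul I),
      integral_const_mul, p_int, mul_one, sub_self]
  set K : Set ℝ := tsupport φ ∪ tsupport p with hK
  have K_comp : IsCompact K := hφc.isCompact.union p_cs.isCompact
  have K_ne : K.Nonempty := p_ne.mono subset_union_right
  have K_sub : K ⊆ Ioo a b := union_subset hφs p_sub
  have θ_zero : ∀ x, x ∉ K → θ x = 0 := by
    intro x hx
    rw [hK, mem_union, not_or] at hx
    simp only [hθ, image_eq_zero_of_notMem_tsupport hx.1, image_eq_zero_of_notMem_tsupport hx.2,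
      mul_zero, sub_zero]
  obtain ⟨m, hm, hml⟩ := K_comp.exists_isLeast K_ne
  obtain ⟨M, hM, hMg⟩ := K_comp.exists_isGreatest K_ne
  have ham := (K_sub hm).1
  have hMb := (K_sub hM).2
  set χ : ℝ → ℝ := fun x => ∫ t in a..x, θ t with hχ
  have χ_deriv : ∀ x, HasDerivAt χ (θ x) x := fun x =>
    intervalIntegral.integral_hasDerivAt_right (θ_cont.intervalIntegrable _ _)
      (θ_cont.stronglyMeasurableAtFilter _ _) θ_cont.continuousAt
  have χ_d : deriv χ = θ := funext fun x => (χ_deriv x).deriv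
  have χ_smooth : ContDiff ℝ ∞ χ :=
    contDiff_infty_iff_deriv.2 ⟨fun x => (χ_deriv x).differentiableAt, by rwa [χ_d]⟩
  have χ_zero : ∀ x, x ∉ Icc m M → χ x = 0 := by
    intro x hx
    by_cases h1 : m ≤ x
    · have h2 : M < x := by
        by_contra h3
        exact hx ⟨h1, not_lt.1 h3⟩
      rw [hχ]
      change ∫ t in a..x, θ t = 0
      rw [intervalIntegral.integral_eq_integral_of_support_subset, θ_int]
      intro y hy
      have hyK : y ∈ K := by
        by_contra h
        exact hy (θ_zero y h)
      exact ⟨(K_sub hyK).1, (hMg hyK).trans h2.le⟩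
    · rw [not_le] at h1
      refine (intervalIntegral.integral_congr (g := fun _ => (0 : ℝ)) fun y hy => ?_).trans
        (by simp)
      refine θ_zero y fun hyK => ?_
      have := hml hyK
      rcases (mem_uIcc.1 hy) with h | h <;> linarith [h.2]
  have χ_ts : tsupport χ ⊆ Icc m M :=
    closure_minimal (fun x hx => by
      by_contra h
      exact hx (χ_zero x h)) isClosed_Icc
  have χ_cs : HasCompactSupport χ := isCompact_Icc.of_isClosed_subset (isClosed_tsupport χ) χ_ts
  have key := hu χ χ_smooth χ_cs (χ_ts.trans fun x hx => ⟨ham.trans_le hx.1, hx.2.trans_lt hMb⟩)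
  have hz : ∫ x in Ioo a b, χ x • (0 : L2 𝕜 a b) x = 0 := by
    rw [← integral_zero ℝ 𝕜 (μ := volume.restrict (Ioo a b))]
    refine integral_congr_ae ?_
    filter_upwards [Lp.coeFn_zero 𝕜 2 (volume.restrict (Ioo a b))] with x hx
    simp only [hx, Pi.zero_apply, smul_zero]
  rw [χ_d, hz, neg_zero] at key
  have split : ∫ x in Ioo a b, θ x • u x
      = (∫ x in Ioo a b, φ x • u x) - I • c := by
    rw [hc, ← integral_smul, ← integral_sub (integrable_test hφ.continuous hφc u)]
    · refine integral_congr_ae (Eventually.of_forall fun x => ?_)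
      simp only [hθ, sub_smul, mul_smul]
    · exact (integrable_test p_smooth.continuous p_cs u).smul I
  rw [split, sub_eq_zero] at key
  rw [key]
  have hφI : ∫ x in Ioo a b, φ x = I :=
    setIntegral_eq_integral_of_forall_compl_eq_zero fun x hx =>
      image_eq_zero_of_notMem_tsupport fun h => hx (hφs h)
  rw [← hφI, ← integral_smul_const]
  refine integral_congr_ae ?_
  filter_upwards [hcm.coeFn_toLp] with x hx
  rw [hx]

/-- A class with vanishing weak derivative whose continuous representative vanishes somewhere
in `[a,b]` is zero. -/
theorem eq_zero_of_weakDeriv_eq_zero (hab : a < b) {u : L2 𝕜 a b} (hu : MemH1 u)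
    (h0 : weakDeriv u = 0) {f : ℝ → 𝕜} (hf : IsContRep u f) {z : ℝ} (hz : z ∈ Icc a b)
    (hfz : f z = 0) : u = 0 := by
  have h1 := hu.isWeakDeriv
  rw [h0] at h1
  obtain ⟨c, hc⟩ := h1.ae_const hab
  have hfc : f =ᵐ[volume.restrict (Ioo a b)] fun _ => c := hf.2.symm.trans hc
  have h2 : EqOn f (fun _ => c) (Ioo a b) :=
    Measure.eqOn_open_of_ae_eq hfc isOpen_Ioo (hf.1.mono Ioo_subset_Icc_self)
      continuousOn_const
  have h3 : EqOn f (fun _ => c) (Icc a b) :=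
    h2.of_subset_closure hf.1 continuousOn_const Ioo_subset_Icc_self
      (by rw [closure_Ioo hab.ne])
  have h4 : c = 0 := by rw [← hfz]; exact (h3 hz).symm
  refine Lp.ext (hc.trans ?_)
  rw [h4]
  exact (Lp.coeFn_zero _ _ _).symm

end Interval

/-! ### The transmission problem: parameters, energy space, operator -/

/-- Data of the transmission problem: half-length `L`, densities `ρ₁, ρ₂`, elastic constants
`k₁, k₂`, order `α ∈ (0,1)` and exponential weight `η ≥ 0` of the fractional derivative. -/
structure Params where
  L : ℝ
  ρ₁ : ℝ
  ρ₂ : ℝ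
  k₁ : ℝ
  k₂ : ℝ
  α : ℝ
  η : ℝ
  L_pos : 0 < L
  ρ₁_pos : 0 < ρ₁
  ρ₂_pos : 0 < ρ₂
  k₁_pos : 0 < k₁
  k₂_pos : 0 < k₂
  α_pos : 0 < α
  α_lt_one : α < 1
  η_nonneg : 0 ≤ η

/-- `μ(ξ) = |ξ|^((2α-1)/2)`. -/
def Params.μ (P : Params) (ξ : ℝ) : ℝ := |ξ| ^ ((2 * P.α - 1) / 2)

/-- The constant `𝔠 = π⁻¹ sin(απ)`. -/
def Params.c (P : Params) : ℝ := Real.pi⁻¹ * Real.sin (P.α * Real.pi)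

theorem Params.c_pos (P : Params) : 0 < P.c :=
  mul_pos (inv_pos.2 Real.pi_pos) (Real.sin_pos_of_pos_of_lt_pi
    (mul_pos P.α_pos Real.pi_pos) (by nlinarith [P.α_lt_one, Real.pi_pos]))

/-- `L²(ℝ; L²(a,b))`. -/
abbrev Mem (𝕜 : Type*) [RCLike 𝕜] (a b : ℝ) : Type _ := Lp (L2 𝕜 a b) 2 (volume : Measure ℝ)

/-- The space `ℍ¹₀` of pairs `(u, v) ∈ H¹(-L,0) × H¹(0,L)` with `u(-L) = v(L) = 0` and
`u(0) = v(0)`. -/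
def H10 (𝕜 : Type*) [RCLike 𝕜] (P : Params) : Submodule 𝕜 (L2 𝕜 (-P.L) 0 × L2 𝕜 0 P.L) where
  carrier := {w | MemH1 w.1 ∧ MemH1 w.2 ∧ ∃ f g : ℝ → 𝕜, IsContRep w.1 f ∧ IsContRep w.2 g ∧
    f (-P.L) = 0 ∧ g P.L = 0 ∧ f 0 = g 0}
  add_mem' := by
    rintro w w' ⟨h1, h2, f, g, hf, hg, a1, a2, a3⟩ ⟨h1', h2', f', g', hf', hg', b1, b2, b3⟩
    exact ⟨h1.add h1', h2.add h2', _, _, hf.add hf', hg.add hg', by simp [a1, b1],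
      by simp [a2, b2], by simp [a3, b3]⟩
  zero_mem' := ⟨MemH1.zero, MemH1.zero, _, _, IsContRep.zero, IsContRep.zero, rfl, rfl, rfl⟩
  smul_mem' := by
    rintro c w ⟨h1, h2, f, g, hf, hg, a1, a2, a3⟩
    exact ⟨h1.smul c, h2.smul c, _, _, hf.smul c, hg.smul c, by simp [a1], by simp [a2],
      by simp [a3]⟩

/-- The underlying vector space of the energy space
`ℋ = ℍ¹₀ × 𝕃² × L²(ℝ; 𝕃²)`, with elements `((u,v), U, V, φ₁, φ₂)`. -/
def State (𝕜 : Type*) [RCLike 𝕜] (P : Params) : Type _ :=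
  H10 𝕜 P × L2 𝕜 (-P.L) 0 × L2 𝕜 0 P.L × Mem 𝕜 (-P.L) 0 × Mem 𝕜 0 P.L

namespace State

variable {𝕜 : Type*} [RCLike 𝕜] {P : Params}

instance : AddCommGroup (State 𝕜 P) :=
  inferInstanceAs (AddCommGroup
    (H10 𝕜 P × L2 𝕜 (-P.L) 0 × L2 𝕜 0 P.L × Mem 𝕜 (-P.L) 0 × Mem 𝕜 0 P.L))

instance : Module 𝕜 (State 𝕜 P) :=
  inferInstanceAs (Module 𝕜
    (H10 𝕜 P × L2 𝕜 (-P.L) 0 × L2 𝕜 0 P.L × Mem 𝕜 (-P.L) 0 × Mem 𝕜 0 P.L))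

/-- The element `(u, v, U, V, φ₁, φ₂)` of `ℋ`. -/
def mk (u : L2 𝕜 (-P.L) 0) (v : L2 𝕜 0 P.L) (huv : (u, v) ∈ H10 𝕜 P)
    (U : L2 𝕜 (-P.L) 0) (V : L2 𝕜 0 P.L) (φ₁ : Mem 𝕜 (-P.L) 0) (φ₂ : Mem 𝕜 0 P.L) :
    State 𝕜 P := (⟨(u, v), huv⟩, U, V, φ₁, φ₂)

def u (x : State 𝕜 P) : L2 𝕜 (-P.L) 0 := x.1.1.1
def v (x : State 𝕜 P) : L2 𝕜 0 P.L := x.1.1.2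
def U (x : State 𝕜 P) : L2 𝕜 (-P.L) 0 := x.2.1
def V (x : State 𝕜 P) : L2 𝕜 0 P.L := x.2.2.1
def φ₁ (x : State 𝕜 P) : Mem 𝕜 (-P.L) 0 := x.2.2.2.1
def φ₂ (x : State 𝕜 P) : Mem 𝕜 0 P.L := x.2.2.2.2

theorem mem (x : State 𝕜 P) : (x.u, x.v) ∈ H10 𝕜 P := x.1.2
theorem memH1_u (x : State 𝕜 P) : MemH1 x.u := x.mem.1
theorem memH1_v (x : State 𝕜 P) : MemH1 x.v := x.mem.2.1

theorem ext {x y : State 𝕜 P} (h1 : x.u = y.u) (h2 : x.v = y.v) (h3 : x.U = y.U)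
    (h4 : x.V = y.V) (h5 : x.φ₁ = y.φ₁) (h6 : x.φ₂ = y.φ₂) : x = y :=
  Prod.ext (Subtype.ext (Prod.ext h1 h2)) (Prod.ext h3 (Prod.ext h4 (Prod.ext h5 h6)))

@[simp] theorem add_u (x y : State 𝕜 P) : (x + y).u = x.u + y.u := rfl
@[simp] theorem add_v (x y : State 𝕜 P) : (x + y).v = x.v + y.v := rfl
@[simp] theorem add_U (x y : State 𝕜 P) : (x + y).U = x.U + y.U := rfl
@[simp] theorem add_V (x y : State 𝕜 P) : (x + y).V = x.V + y.V := rfl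
@[simp] theorem add_φ₁ (x y : State 𝕜 P) : (x + y).φ₁ = x.φ₁ + y.φ₁ := rfl
@[simp] theorem add_φ₂ (x y : State 𝕜 P) : (x + y).φ₂ = x.φ₂ + y.φ₂ := rfl
@[simp] theorem smul_u (c : 𝕜) (x : State 𝕜 P) : (c • x).u = c • x.u := rfl
@[simp] theorem smul_v (c : 𝕜) (x : State 𝕜 P) : (c • x).v = c • x.v := rfl
@[simp] theorem smul_U (c : 𝕜) (x : State 𝕜 P) : (c • x).U = c • x.U := rfl
@[simp] theorem smul_V (c : 𝕜) (x : State 𝕜 P) : (c • x).V = c • x.V := rfl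
@[simp] theorem smul_φ₁ (c : 𝕜) (x : State 𝕜 P) : (c • x).φ₁ = c • x.φ₁ := rfl
@[simp] theorem smul_φ₂ (c : 𝕜) (x : State 𝕜 P) : (c • x).φ₂ = c • x.φ₂ := rfl
@[simp] theorem zero_u : (0 : State 𝕜 P).u = 0 := rfl
@[simp] theorem zero_v : (0 : State 𝕜 P).v = 0 := rfl
@[simp] theorem zero_U : (0 : State 𝕜 P).U = 0 := rfl
@[simp] theorem zero_V : (0 : State 𝕜 P).V = 0 := rfl
@[simp] theorem zero_φ₁ : (0 : State 𝕜 P).φ₁ = 0 := rfl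
@[simp] theorem zero_φ₂ : (0 : State 𝕜 P).φ₂ = 0 := rfl

@[simp] theorem deriv_add_u (x y : State 𝕜 P) :
    weakDeriv (x.u + y.u) = weakDeriv x.u + weakDeriv y.u := weakDeriv_add x.memH1_u y.memH1_u
@[simp] theorem deriv_add_v (x y : State 𝕜 P) :
    weakDeriv (x.v + y.v) = weakDeriv x.v + weakDeriv y.v := weakDeriv_add x.memH1_v y.memH1_v
@[simp] theorem deriv_smul_u (c : 𝕜) (x : State 𝕜 P) :
    weakDeriv (c • x.u) = c • weakDeriv x.u := weakDeriv_smul c x.memH1_u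
@[simp] theorem deriv_smul_v (c : 𝕜) (x : State 𝕜 P) :
    weakDeriv (c • x.v) = c • weakDeriv x.v := weakDeriv_smul c x.memH1_v

/-- The energy inner product on `ℋ`. -/
@[reducible]
def core (𝕜 : Type*) [RCLike 𝕜] (P : Params) : InnerProductSpace.Core 𝕜 (State 𝕜 P) where
  inner x y :=
    (P.ρ₁ : 𝕜) * inner 𝕜 x.U y.U + (P.ρ₂ : 𝕜) * inner 𝕜 x.V y.V
      + (P.k₁ : 𝕜) * inner 𝕜 (weakDeriv x.u) (weakDeriv y.u)
      + (P.k₂ : 𝕜) * inner 𝕜 (weakDeriv x.v) (weakDeriv y.v)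
      + (P.c : 𝕜) * inner 𝕜 x.φ₁ y.φ₁ + (P.c : 𝕜) * inner 𝕜 x.φ₂ y.φ₂
  conj_inner_symm x y := by
    simp only [map_add, map_mul, RCLike.conj_ofReal, inner_conj_symm]
  re_inner_nonneg x := by
    have h1 := P.ρ₁_pos
    have h2 := P.ρ₂_pos
    have h3 := P.k₁_pos
    have h4 := P.k₂_pos
    have h5 := P.c_pos
    simp only [map_add, RCLike.re_ofReal_mul, inner_self_eq_norm_sq]
    positivity
  add_left x y z := by
    simp only [add_u, add_v, add_U, add_V, add_φ₁, add_φ₂, deriv_add_u, deriv_add_v,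
      inner_add_left]
    ring
  smul_left x y r := by
    simp only [smul_u, smul_v, smul_U, smul_V, smul_φ₁, smul_φ₂, deriv_smul_u, deriv_smul_v,
      inner_smul_left]
    ring
  definite x hx := by
    have hre := congrArg RCLike.re hx
    simp only [map_add, RCLike.re_ofReal_mul, inner_self_eq_norm_sq, map_zero] at hre
    have a1 := mul_nonneg P.ρ₁_pos.le (sq_nonneg ‖x.U‖)
    have a2 := mul_nonneg P.ρ₂_pos.le (sq_nonneg ‖x.V‖)
    have a3 := mul_nonneg P.k₁_pos.le (sq_nonneg ‖weakDeriv x.u‖)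
    have a4 := mul_nonneg P.k₂_pos.le (sq_nonneg ‖weakDeriv x.v‖)
    have a5 := mul_nonneg P.c_pos.le (sq_nonneg ‖x.φ₁‖)
    have a6 := mul_nonneg P.c_pos.le (sq_nonneg ‖x.φ₂‖)
    have key : ∀ {r n : ℝ}, 0 < r → r * n ^ 2 = 0 → n = 0 := by
      intro r n hr h
      rcases mul_eq_zero.1 h with h | h
      · exact absurd h hr.ne'
      · exact pow_eq_zero_iff two_ne_zero |>.1 h
    have b1 := norm_eq_zero.1 (key P.ρ₁_pos (by linarith : P.ρ₁ * ‖x.U‖ ^ 2 = 0))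
    have b2 := norm_eq_zero.1 (key P.ρ₂_pos (by linarith : P.ρ₂ * ‖x.V‖ ^ 2 = 0))
    have b3 := norm_eq_zero.1 (key P.k₁_pos (by linarith : P.k₁ * ‖weakDeriv x.u‖ ^ 2 = 0))
    have b4 := norm_eq_zero.1 (key P.k₂_pos (by linarith : P.k₂ * ‖weakDeriv x.v‖ ^ 2 = 0))
    have b5 := norm_eq_zero.1 (key P.c_pos (by linarith : P.c * ‖x.φ₁‖ ^ 2 = 0))
    have b6 := norm_eq_zero.1 (key P.c_pos (by linarith : P.c * ‖x.φ₂‖ ^ 2 = 0))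
    obtain ⟨h1, h2, f, g, hf, hg, hf0, hg0, -⟩ := x.mem
    have hL := P.L_pos
    refine ext ?_ ?_ b1 b2 b5 b6
    · exact eq_zero_of_weakDeriv_eq_zero (by linarith) h1 b3 hf
        (left_mem_Icc.2 (by linarith)) hf0
    · exact eq_zero_of_weakDeriv_eq_zero hL h2 b4 hg (right_mem_Icc.2 hL.le) hg0

instance : NormedAddCommGroup (State 𝕜 P) :=
  @InnerProductSpace.Core.toNormedAddCommGroup 𝕜 (State 𝕜 P) _ _ _ (core 𝕜 P)

instance : InnerProductSpace 𝕜 (State 𝕜 P) :=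
  InnerProductSpace.ofCore (core 𝕜 P).toCore

instance : NormedSpace ℝ (State 𝕜 P) := NormedSpace.restrictScalars ℝ 𝕜 (State 𝕜 P)

/-- The energy of a state. -/
def energy (x : State 𝕜 P) : ℝ :=
  (1 / 2) * (P.ρ₁ * ‖x.U‖ ^ 2 + P.k₁ * ‖weakDeriv x.u‖ ^ 2
    + P.ρ₂ * ‖x.V‖ ^ 2 + P.k₂ * ‖weakDeriv x.v‖ ^ 2
    + P.c * ‖x.φ₁‖ ^ 2 + P.c * ‖x.φ₂‖ ^ 2)

theorem norm_sq_eq (x : State 𝕜 P) : ‖x‖ ^ 2 = 2 * x.energy := by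
  rw [← inner_self_eq_norm_sq (𝕜 := 𝕜) x]
  have h : inner 𝕜 x x = (P.ρ₁ : 𝕜) * inner 𝕜 x.U x.U + (P.ρ₂ : 𝕜) * inner 𝕜 x.V x.V
      + (P.k₁ : 𝕜) * inner 𝕜 (weakDeriv x.u) (weakDeriv x.u)
      + (P.k₂ : 𝕜) * inner 𝕜 (weakDeriv x.v) (weakDeriv x.v)
      + (P.c : 𝕜) * inner 𝕜 x.φ₁ x.φ₁ + (P.c : 𝕜) * inner 𝕜 x.φ₂ x.φ₂ := rfl
  rw [h]
  simp only [map_add, RCLike.re_ofReal_mul, inner_self_eq_norm_sq, energy]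
  ring

end State

section Operator

variable {𝕜 : Type*} [RCLike 𝕜] {a b : ℝ}

/-- The right-hand side `ξ ↦ -(|ξ|² + η) φ(ξ) + μ(ξ) U` of the diffusion equation. -/
def memRHS (P : Params) (φ : Mem 𝕜 a b) (U : L2 𝕜 a b) (ξ : ℝ) : L2 𝕜 a b :=
  -((|ξ| ^ 2 + P.η) • φ ξ) + P.μ ξ • U

/-- The damping term `∫_ℝ μ(ξ) φ(ξ) dξ ∈ L²(a,b)`. -/
def memInt (P : Params) (φ : Mem 𝕜 a b) : L2 𝕜 a b := ∫ ξ, P.μ ξ • φ ξ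

theorem memRHS_add (P : Params) (φ ψ : Mem 𝕜 a b) (U V : L2 𝕜 a b) :
    memRHS P (φ + ψ) (U + V) =ᵐ[volume] memRHS P φ U + memRHS P ψ V := by
  filter_upwards [Lp.coeFn_add φ ψ] with ξ h
  simp only [memRHS, h, Pi.add_apply, smul_add]
  abel

theorem memRHS_smul (P : Params) (c : 𝕜) (φ : Mem 𝕜 a b) (U : L2 𝕜 a b) :
    memRHS P (c • φ) (c • U) =ᵐ[volume] c • memRHS P φ U := by
  filter_upwards [Lp.coeFn_smul c φ] with ξ h
  simp only [memRHS, h, Pi.smul_apply, smul_add, smul_neg, smul_comm c]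

theorem memRHS_zero (P : Params) : memRHS P (0 : Mem 𝕜 a b) 0 =ᵐ[volume] 0 := by
  filter_upwards [Lp.coeFn_zero (L2 𝕜 a b) 2 (volume : Measure ℝ)] with ξ h
  simp only [memRHS, h, Pi.zero_apply, smul_zero, neg_zero, add_zero]

theorem integrable_weight (P : Params) :
    Integrable (fun ξ : ℝ => (P.μ ξ / (1 + |ξ|)) ^ 2) := by
  set g : ℝ → ℝ := fun ξ => (P.μ ξ / (1 + |ξ|)) ^ 2 with hg
  have meas : Measurable g := by
    have : Measurable P.μ := by
      unfold Params.μ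
      fun_prop
    rw [hg]
    fun_prop
  have hsq : ∀ ξ : ℝ, P.μ ξ ^ 2 = |ξ| ^ (2 * P.α - 1) := by
    intro ξ
    rw [Params.μ, ← Real.rpow_natCast, ← Real.rpow_mul (abs_nonneg ξ)]
    congr 1
    push_cast
    ring
  have hα := P.α_pos
  have hα1 := P.α_lt_one
  have i1 : IntegrableOn g (Ioc 0 1) := by
    have : IntegrableOn (fun x : ℝ => x ^ (2 * P.α - 1)) (Ioc 0 1) := by
      have := intervalIntegral.intervalIntegrable_rpow' (a := 0) (b := 1)
        (r := 2 * P.α - 1) (by linarith)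
      exact (intervalIntegrable_iff_integrableOn_Ioc_of_le zero_le_one).1 this
    refine Integrable.mono' this meas.aestronglyMeasurable ?_
    filter_upwards [ae_restrict_mem measurableSet_Ioc] with x hx
    rw [Real.norm_of_nonneg (sq_nonneg _), div_pow, hsq, abs_of_pos hx.1]
    refine div_le_self (Real.rpow_nonneg hx.1.le _) ?_
    nlinarith [hx.1]
  have i2 : IntegrableOn g (Ioi 1) := by
    have : IntegrableOn (fun x : ℝ => x ^ (2 * P.α - 3)) (Ioi 1) :=
      integrableOn_Ioi_rpow_of_lt (by linarith) one_pos
    refine Integrable.mono' this meas.aestronglyMeasurable ?_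
    filter_upwards [ae_restrict_mem measurableSet_Ioi] with x hx
    have hx0 : (0 : ℝ) < x := one_pos.trans hx
    rw [Real.norm_of_nonneg (sq_nonneg _), div_pow, hsq, abs_of_pos hx0,
      div_le_iff₀ (by positivity)]
    have e : x ^ (2 * P.α - 1) = x ^ (2 * P.α - 3) * x ^ 2 := by
      rw [← Real.rpow_natCast x 2, ← Real.rpow_add hx0]
      congr 1
      push_cast
      ring
    rw [e]
    refine mul_le_mul_of_nonneg_left ?_ (Real.rpow_nonneg hx0.le _)
    nlinarith
  have i3 : IntegrableOn g (Ioi 0) := by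
    rw [← Ioc_union_Ioi_eq_Ioi zero_le_one]
    exact i1.union i2
  have i4 : IntegrableOn g (Iio 0) := by
    have := IntegrableOn.comp_neg_Iio (c := (0 : ℝ)) (f := g) (by simpa using i3)
    simpa [hg, Params.μ] using this
  have i5 : IntegrableOn g (Iic 0) := by
    rwa [integrableOn_Iic_iff_integrableOn_Iio]
  rw [← integrableOn_univ, ← Iic_union_Ioi (a := (0 : ℝ))]
  exact i5.union i3

/-- The integral defining the damping term converges absolutely in `L²(a,b)` as soon as
`φ` and `|ξ| φ` lie in `L²(ℝ; L²(a,b))`. -/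
theorem integrable_memInt (P : Params) {φ : Mem 𝕜 a b}
    (h : MemLp (fun ξ => |ξ| • φ ξ) 2 (volume : Measure ℝ)) :
    Integrable (fun ξ => P.μ ξ • φ ξ) := by
  have meas : Measurable (fun ξ => P.μ ξ / (1 + |ξ|)) := by
    unfold Params.μ
    fun_prop
  have h1 : MemLp (fun ξ => P.μ ξ / (1 + |ξ|)) 2 (volume : Measure ℝ) :=
    (memLp_two_iff_integrable_sq meas.aestronglyMeasurable).2 (integrable_weight P)
  have h2 : MemLp (fun ξ => φ ξ + |ξ| • φ ξ) 2 (volume : Measure ℝ) := (Lp.memLp φ).add h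
  have h3 : MemLp ((fun ξ => P.μ ξ / (1 + |ξ|)) • (fun ξ => φ ξ + |ξ| • φ ξ)) 1
      (volume : Measure ℝ) := h2.smul h1
  refine (memLp_one_iff_integrable.1 h3).congr (Eventually.of_forall fun ξ => ?_)
  have h0 : (1 + |ξ|) ≠ 0 := by positivity
  simp only [Pi.smul_apply']
  rw [show φ ξ + |ξ| • φ ξ = (1 + |ξ|) • φ ξ by rw [add_smul, one_smul], smul_smul,
    div_mul_cancel₀ _ h0]

theorem memInt_add (P : Params) {φ ψ : Mem 𝕜 a b}
    (hφ : MemLp (fun ξ => |ξ| • φ ξ) 2 (volume : Measure ℝ))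
    (hψ : MemLp (fun ξ => |ξ| • ψ ξ) 2 (volume : Measure ℝ)) :
    memInt P (φ + ψ) = memInt P φ + memInt P ψ := by
  rw [memInt, memInt, memInt, ← integral_add (integrable_memInt P hφ) (integrable_memInt P hψ)]
  refine integral_congr_ae ?_
  filter_upwards [Lp.coeFn_add φ ψ] with ξ h
  simp only [h, Pi.add_apply, smul_add]

theorem memInt_smul (P : Params) (c : 𝕜) (φ : Mem 𝕜 a b) :
    memInt P (c • φ) = c • memInt P φ := by
  rw [memInt, memInt, ← integral_smul]
  refine integral_congr_ae ?_
  filter_upwards [Lp.coeFn_smul c φ] with ξ h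
  simp only [h, Pi.smul_apply, smul_comm c]

variable (𝕜) in
/-- The domain `D(𝒜)`. -/
def domA (P : Params) : Submodule 𝕜 (State 𝕜 P) where
  carrier := {x |
    (x.U, x.V) ∈ H10 𝕜 P ∧ MemH2 x.u ∧ MemH2 x.v ∧
    (∃ f g : ℝ → 𝕜, IsContRep (weakDeriv x.u) f ∧ IsContRep (weakDeriv x.v) g ∧
      (P.k₁ : 𝕜) * f 0 = (P.k₂ : 𝕜) * g 0) ∧
    MemLp (fun ξ => |ξ| • x.φ₁ ξ) 2 (volume : Measure ℝ) ∧
    MemLp (memRHS P x.φ₁ x.U) 2 (volume : Measure ℝ) ∧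
    MemLp (fun ξ => |ξ| • x.φ₂ ξ) 2 (volume : Measure ℝ) ∧
    MemLp (memRHS P x.φ₂ x.V) 2 (volume : Measure ℝ)}
  add_mem' := by
    have aux : ∀ {a b : ℝ} {φ ψ : Mem 𝕜 a b},
        MemLp (fun ξ => |ξ| • φ ξ) 2 (volume : Measure ℝ) →
        MemLp (fun ξ => |ξ| • ψ ξ) 2 (volume : Measure ℝ) →
        MemLp (fun ξ => |ξ| • (φ + ψ : Mem 𝕜 a b) ξ) 2 (volume : Measure ℝ) := by
      intro a b φ ψ hφ hψ
      refine (hφ.add hψ).ae_eq ?_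
      filter_upwards [Lp.coeFn_add φ ψ] with ξ h
      simp only [h, Pi.add_apply, smul_add]
    rintro x y ⟨h1, h2, h3, ⟨f, g, hf, hg, hfg⟩, h5, h6, h7, h8⟩
      ⟨h1', h2', h3', ⟨f', g', hf', hg', hfg'⟩, h5', h6', h7', h8'⟩
    refine ⟨(H10 𝕜 P).add_mem h1 h1', h2.add h2', h3.add h3',
      ⟨fun ξ => f ξ + f' ξ, fun ξ => g ξ + g' ξ, ?_, ?_, ?_⟩,
      aux h5 h5', (h6.add h6').ae_eq (memRHS_add P _ _ _ _).symm,
      aux h7 h7', (h8.add h8').ae_eq (memRHS_add P _ _ _ _).symm⟩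
    · rw [State.add_u, State.deriv_add_u]; exact hf.add hf'
    · rw [State.add_v, State.deriv_add_v]; exact hg.add hg'
    · simp only [mul_add, hfg, hfg']
  zero_mem' := by
    have aux : ∀ {a b : ℝ},
        MemLp (fun ξ => |ξ| • (0 : Mem 𝕜 a b) ξ) 2 (volume : Measure ℝ) := by
      intro a b
      refine (MemLp.zero (ε := L2 𝕜 a b)).ae_eq ?_
      filter_upwards [Lp.coeFn_zero (L2 𝕜 a b) 2 (volume : Measure ℝ)] with ξ h
      simp only [h, Pi.zero_apply, smul_zero]
    refine ⟨(H10 𝕜 P).zero_mem, MemH2.zero, MemH2.zero, ⟨fun _ => 0, fun _ => 0, ?_, ?_, ?_⟩,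
      aux, MemLp.zero.ae_eq (memRHS_zero P).symm, aux, MemLp.zero.ae_eq (memRHS_zero P).symm⟩
    · rw [State.zero_u, weakDeriv_zero]; exact IsContRep.zero
    · rw [State.zero_v, weakDeriv_zero]; exact IsContRep.zero
    · simp
  smul_mem' := by
    have aux : ∀ {a b : ℝ} (c : 𝕜) {φ : Mem 𝕜 a b},
        MemLp (fun ξ => |ξ| • φ ξ) 2 (volume : Measure ℝ) →
        MemLp (fun ξ => |ξ| • (c • φ : Mem 𝕜 a b) ξ) 2 (volume : Measure ℝ) := by
      intro a b c φ hφ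
      refine (hφ.const_smul c).ae_eq ?_
      filter_upwards [Lp.coeFn_smul c φ] with ξ h
      simp only [h, Pi.smul_apply, smul_comm c]
    rintro c x ⟨h1, h2, h3, ⟨f, g, hf, hg, hfg⟩, h5, h6, h7, h8⟩
    refine ⟨(H10 𝕜 P).smul_mem c h1, h2.smul c, h3.smul c, ⟨fun ξ => c * f ξ,
      fun ξ => c * g ξ, ?_, ?_, ?_⟩,
      aux c h5, (h6.const_smul c).ae_eq (memRHS_smul P c _ _).symm,
      aux c h7, (h8.const_smul c).ae_eq (memRHS_smul P c _ _).symm⟩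
    · rw [State.smul_u, State.deriv_smul_u]; exact hf.smul c
    · rw [State.smul_v, State.deriv_smul_v]; exact hg.smul c
    · linear_combination c * hfg

/-- The value `𝒜 x` for `x ∈ D(𝒜)`. -/
def applyA {P : Params} (x : domA 𝕜 P) : State 𝕜 P :=
  State.mk x.1.U x.1.V x.2.1
    ((P.ρ₁ : 𝕜)⁻¹ • ((P.k₁ : 𝕜) • weakDeriv (weakDeriv x.1.u) - (P.c : 𝕜) • memInt P x.1.φ₁))
    ((P.ρ₂ : 𝕜)⁻¹ • ((P.k₂ : 𝕜) • weakDeriv (weakDeriv x.1.v) - (P.c : 𝕜) • memInt P x.1.φ₂))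
    (x.2.2.2.2.2.2.1.toLp (memRHS P x.1.φ₁ x.1.U))
    (x.2.2.2.2.2.2.2.2.toLp (memRHS P x.1.φ₂ x.1.V))

section applyA

variable {P : Params}

theorem applyA_u (x : domA 𝕜 P) : (applyA x).u = x.1.U := rfl
theorem applyA_v (x : domA 𝕜 P) : (applyA x).v = x.1.V := rfl
theorem applyA_U (x : domA 𝕜 P) : (applyA x).U = (P.ρ₁ : 𝕜)⁻¹ •
    ((P.k₁ : 𝕜) • weakDeriv (weakDeriv x.1.u) - (P.c : 𝕜) • memInt P x.1.φ₁) := rfl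
theorem applyA_V (x : domA 𝕜 P) : (applyA x).V = (P.ρ₂ : 𝕜)⁻¹ •
    ((P.k₂ : 𝕜) • weakDeriv (weakDeriv x.1.v) - (P.c : 𝕜) • memInt P x.1.φ₂) := rfl
theorem applyA_φ₁ (x : domA 𝕜 P) : (applyA x).φ₁ =ᵐ[volume] memRHS P x.1.φ₁ x.1.U :=
  MemLp.coeFn_toLp (p := 2) x.2.2.2.2.2.2.1
theorem applyA_φ₂ (x : domA 𝕜 P) : (applyA x).φ₂ =ᵐ[volume] memRHS P x.1.φ₂ x.1.V :=
  MemLp.coeFn_toLp (p := 2) x.2.2.2.2.2.2.2.2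

theorem applyA_add (x y : domA 𝕜 P) : applyA (x + y) = applyA x + applyA y := by
  refine State.ext ?_ ?_ ?_ ?_ ?_ ?_
  · rw [State.add_u, applyA_u, applyA_u, applyA_u, Submodule.coe_add, State.add_U]
  · rw [State.add_v, applyA_v, applyA_v, applyA_v, Submodule.coe_add, State.add_V]
  · rw [State.add_U, applyA_U, applyA_U, applyA_U, Submodule.coe_add, State.add_u, State.add_φ₁,
      State.deriv_add_u, weakDeriv_add x.2.2.1.2 y.2.2.1.2,
      memInt_add P x.2.2.2.2.2.1 y.2.2.2.2.2.1]
    module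
  · rw [State.add_V, applyA_V, applyA_V, applyA_V, Submodule.coe_add, State.add_v, State.add_φ₂,
      State.deriv_add_v, weakDeriv_add x.2.2.2.1.2 y.2.2.2.1.2,
      memInt_add P x.2.2.2.2.2.2.2.1 y.2.2.2.2.2.2.2.1]
    module
  · refine Lp.ext ?_
    rw [State.add_φ₁]
    have h := memRHS_add P x.1.φ₁ y.1.φ₁ x.1.U y.1.U
    filter_upwards [applyA_φ₁ (x + y), applyA_φ₁ x, applyA_φ₁ y, h,
      Lp.coeFn_add (applyA x).φ₁ (applyA y).φ₁] with ξ h1 h2 h3 h4 h5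
    rw [h1, h5, Pi.add_apply, h2, h3, Submodule.coe_add, State.add_φ₁, State.add_U, h4,
      Pi.add_apply]
  · refine Lp.ext ?_
    rw [State.add_φ₂]
    have h := memRHS_add P x.1.φ₂ y.1.φ₂ x.1.V y.1.V
    filter_upwards [applyA_φ₂ (x + y), applyA_φ₂ x, applyA_φ₂ y, h,
      Lp.coeFn_add (applyA x).φ₂ (applyA y).φ₂] with ξ h1 h2 h3 h4 h5
    rw [h1, h5, Pi.add_apply, h2, h3, Submodule.coe_add, State.add_φ₂, State.add_V, h4,
      Pi.add_apply]

theorem applyA_smul (c : 𝕜) (x : domA 𝕜 P) : applyA (c • x) = c • applyA x := by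
  refine State.ext ?_ ?_ ?_ ?_ ?_ ?_
  · rw [State.smul_u, applyA_u, applyA_u, Submodule.coe_smul, State.smul_U]
  · rw [State.smul_v, applyA_v, applyA_v, Submodule.coe_smul, State.smul_V]
  · rw [State.smul_U, applyA_U, applyA_U, Submodule.coe_smul, State.smul_u, State.smul_φ₁,
      State.deriv_smul_u, weakDeriv_smul c x.2.2.1.2, memInt_smul]
    module
  · rw [State.smul_V, applyA_V, applyA_V, Submodule.coe_smul, State.smul_v, State.smul_φ₂,
      State.deriv_smul_v, weakDeriv_smul c x.2.2.2.1.2, memInt_smul]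
    module
  · refine Lp.ext ?_
    rw [State.smul_φ₁]
    have h := memRHS_smul P c x.1.φ₁ x.1.U
    filter_upwards [applyA_φ₁ (c • x), applyA_φ₁ x, h,
      Lp.coeFn_smul c (applyA x).φ₁] with ξ h1 h2 h4 h5
    rw [h1, h5, Pi.smul_apply, h2, Submodule.coe_smul, State.smul_φ₁, State.smul_U, h4,
      Pi.smul_apply]
  · refine Lp.ext ?_
    rw [State.smul_φ₂]
    have h := memRHS_smul P c x.1.φ₂ x.1.V
    filter_upwards [applyA_φ₂ (c • x), applyA_φ₂ x, h,
      Lp.coeFn_smul c (applyA x).φ₂] with ξ h1 h2 h4 h5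
    rw [h1, h5, Pi.smul_apply, h2, Submodule.coe_smul, State.smul_φ₂, State.smul_V, h4,
      Pi.smul_apply]

end applyA

variable (𝕜) in
/-- The operator `𝒜 : D(𝒜) ⊆ ℋ → ℋ`,
`𝒜 (u, v, U, V, φ₁, φ₂) = (U, V, (k₁ u'' - 𝔠 ∫ μ φ₁) / ρ₁, (k₂ v'' - 𝔠 ∫ μ φ₂) / ρ₂,
-(|ξ|² + η) φ₁ + μ U, -(|ξ|² + η) φ₂ + μ V)`. -/
def opA (P : Params) : State 𝕜 P →ₗ.[𝕜] State 𝕜 P where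
  domain := domA 𝕜 P
  toFun := { toFun := applyA, map_add' := applyA_add, map_smul' := applyA_smul }

/-- The energy `E` of `x : [0,∞) → ℋ` satisfies, at time `t ≥ 0`,
`dE/dt = - 𝔠 ∫ (|ξ|² + η) ‖φ₁(t,ξ)‖² dξ - 𝔠 ∫ (|ξ|² + η) ‖φ₂(t,ξ)‖² dξ`, where both integrals
converge; at `t = 0` the derivative is one-sided. -/
def EnergyIdentityAt {P : Params} (x : ℝ → State 𝕜 P) (t : ℝ) : Prop :=
  Integrable (fun ξ : ℝ => (|ξ| ^ 2 + P.η) * ‖(x t).φ₁ ξ‖ ^ 2) ∧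
  Integrable (fun ξ : ℝ => (|ξ| ^ 2 + P.η) * ‖(x t).φ₂ ξ‖ ^ 2) ∧
  HasDerivWithinAt (fun s => (x s).energy)
    (-(P.c * ∫ ξ : ℝ, (|ξ| ^ 2 + P.η) * ‖(x t).φ₁ ξ‖ ^ 2)
      - P.c * ∫ ξ : ℝ, (|ξ| ^ 2 + P.η) * ‖(x t).φ₂ ξ‖ ^ 2) (Ici 0) t

end Operator

end FracWave

end

noncomputable section

namespace FracWave

/-! ### Dissipativity and exponentials of bounded operators. -/

section AbstractTheory

variable {𝕜 E : Type*} [RCLike 𝕜] [NormedAddCommGroup E] [InnerProductSpace 𝕜 E]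

/-! Everything about existence and uniqueness rests on one fact, `isMaxDissipative_opA`: `Re ⟪A x,
x⟫ ≤ 0` on `D(A)` and `l - A` is onto for every `l > 0`.

Abstractly, this gives the contraction semigroup by Yosida approximation (`exists_semigroup`). The
bounded operators `B_n = A J_n`, `J_n = l (l - A)⁻¹` with `l = n + 1`, generate contractions `exp (t
B_n)`. By `norm_yosida_sub_sq_le` these are Cauchy on `D(A)`, which is dense (`dense_domain`), hence
they converge everywhere. Maximality identifies the generator of the limit with `A`
(`exists_generated`). Uniqueness holds because a solution of `z' = A z`, `z(0) = 0` has
nonincreasing norm; for mild solutions this is applied to the primitive of the difference.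

For the concrete operator, dissipativity is integration by parts (`re_inner_applyA`): the interface
terms cancel by `U(0) = V(0)` and equality of the fluxes, the coupling between `μ U` and `∫ μ φ`
cancels, and only the memory dissipation is left. For surjectivity one eliminates `U = l u - f` and
`φ = (μ U + f) / (l + |ξ|² + η)`. Since `κ = ∫ μ² / (l + |ξ|² + η)` is finite for `0 < α < 1`, there
remains an elliptic transmission problem with nonnegative zeroth-order coefficients, solved weakly
by a coercivity argument (`exists_elliptic`).

For strong solutions the energy identity is the chain rule. A mild solution need not lie in `D(A)`,
but its averages over windows `[t, t + h]` are strong solutions, and their integrated identity is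
passed to the limit `h → 0`. This needs `√(|ξ|² + η) φ` to be continuous in time with values in
`L²`. Here zero initial memory enters: heuristically, Duhamel's formula gives `‖φ(t,ξ)‖ ≤ K μ /
(|ξ|² + η)`, so `(|ξ|² + η) ‖φ‖²` has, at high frequency, an integrable bound uniform for bounded
times (`IsMemorySolution.ae_bound`, `IsMemorySolution.exists_weighted`). The dissipation rate is
then continuous in time, and the integrated identity can be differentiated at every `t ≥ 0`. -/

/-- An operator on an inner product space is `m`-dissipative if `Re ⟪A x, x⟫ ≤ 0` on its domain and
`l - A` is surjective for every `l > 0`. -/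
structure IsMaxDissipative (A : E →ₗ.[𝕜] E) : Prop where
  dissipative : ∀ x y : E, (x, y) ∈ A.graph → RCLike.re (inner 𝕜 y x) ≤ 0
  surjective : ∀ l : ℝ, 0 < l → ∀ y : E, ∃ x z : E, (x, z) ∈ A.graph ∧ (l : 𝕜) • x - z = y

theorem le_add_mul_of_deriv_le {f f' : ℝ → ℝ} {C : ℝ}
    (hf : ∀ t, 0 ≤ t → HasDerivWithinAt f (f' t) (Ici 0) t) (hC : ∀ t, 0 ≤ t → f' t ≤ C)
    {t : ℝ} (ht : 0 ≤ t) : f t ≤ f 0 + C * t := by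
  have hB : ∀ x : ℝ, HasDerivAt (fun x => f 0 + C * x) C x := fun x => by
    simpa using ((hasDerivAt_id x).const_mul C).const_add (f 0)
  refine image_le_of_deriv_right_le_deriv_boundary (a := 0) (b := t) (f' := f')
    (B := fun x => f 0 + C * x) (B' := fun _ => C)
    (fun x hx => ((hf x hx.1).continuousWithinAt).mono Icc_subset_Ici_self)
    (fun x hx => (hf x hx.1).mono (Ici_subset_Ici.2 hx.1)) (by simp)
    (fun x _ => (hB x).continuousAt.continuousWithinAt)
    (fun x _ => (hB x).hasDerivWithinAt) (fun x hx => hC x hx.1) (right_mem_Icc.2 ht)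

theorem hasDerivWithinAt_norm_sq (𝕜 : Type*) {E : Type*} [RCLike 𝕜] [NormedAddCommGroup E]
    [InnerProductSpace 𝕜 E] [NormedSpace ℝ E] {x : ℝ → E} {x' : E} {s : Set ℝ} {t : ℝ}
    (h : HasDerivWithinAt x x' s t) :
    HasDerivWithinAt (fun r => ‖x r‖ ^ 2) (2 * RCLike.re (inner 𝕜 x' (x t))) s t := by
  have h1 := h.inner 𝕜 h
  have h2 := (RCLike.reCLM (K := 𝕜)).hasFDerivAt.comp_hasDerivWithinAt t h1
  have e : ∀ r, ‖x r‖ ^ 2 = RCLike.re (inner 𝕜 (x r) (x r)) := fun r =>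
    (inner_self_eq_norm_sq (𝕜 := 𝕜) (x r)).symm
  simp only [e]
  refine h2.congr_deriv ?_
  rw [RCLike.reCLM_apply, map_add, inner_re_symm]
  ring

theorem norm_sq_le_of_deriv (𝕜 : Type*) {E : Type*} [RCLike 𝕜] [NormedAddCommGroup E]
    [InnerProductSpace 𝕜 E] [NormedSpace ℝ E] {x x' : ℝ → E} {C : ℝ}
    (hx : ∀ t, 0 ≤ t → HasDerivWithinAt x (x' t) (Ici 0) t)
    (hC : ∀ t, 0 ≤ t → RCLike.re (inner 𝕜 (x' t) (x t)) ≤ C) {t : ℝ} (ht : 0 ≤ t) :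
    ‖x t‖ ^ 2 ≤ ‖x 0‖ ^ 2 + 2 * C * t :=
  le_add_mul_of_deriv_le (fun t ht => hasDerivWithinAt_norm_sq 𝕜 (hx t ht))
    (fun t ht => by linarith [hC t ht]) ht

/-- A solution of `z' = A z`, `z(0) = 0` with `A` dissipative vanishes. -/
theorem eq_zero_of_dissipative (𝕜 : Type*) {E : Type*} [RCLike 𝕜] [NormedAddCommGroup E]
    [InnerProductSpace 𝕜 E] [NormedSpace ℝ E] {x x' : ℝ → E}
    (hx : ∀ t, 0 ≤ t → HasDerivWithinAt x (x' t) (Ici 0) t)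
    (hd : ∀ t, 0 ≤ t → RCLike.re (inner 𝕜 (x' t) (x t)) ≤ 0) (h0 : x 0 = 0) {t : ℝ}
    (ht : 0 ≤ t) : x t = 0 := by
  have := norm_sq_le_of_deriv 𝕜 hx hd ht
  rw [h0] at this
  simp only [norm_zero] at this
  exact norm_eq_zero.1 (pow_eq_zero_iff two_ne_zero |>.1 (le_antisymm (by simpa using this)
    (sq_nonneg _)))

section BoundedGenerator

/-- The uniformly continuous semigroup `exp (t B)`. -/
def expSemigroup (B : E →L[𝕜] E) (t : ℝ) : E →L[𝕜] E := NormedSpace.exp ((t : 𝕜) • B)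

theorem expSemigroup_zero (B : E →L[𝕜] E) : expSemigroup B 0 = 1 := by
  simp [expSemigroup]

variable [CompleteSpace E]

theorem expSemigroup_add (B : E →L[𝕜] E) (s t : ℝ) :
    expSemigroup B (s + t) = expSemigroup B s * expSemigroup B t := by
  let _ : NormedAlgebra ℚ 𝕜 := NormedAlgebra.restrictScalars ℚ ℝ 𝕜
  let _ : NormedAlgebra ℚ (E →L[𝕜] E) := NormedAlgebra.restrictScalars ℚ 𝕜 (E →L[𝕜] E)
  have hc : Commute ((s : 𝕜) • B) ((t : 𝕜) • B) :=
    ((Commute.refl B).smul_left _).smul_right _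
  rw [expSemigroup, RCLike.ofReal_add, add_smul, NormedSpace.exp_add_of_commute hc]
  rfl

/-- Both products are the derivative of `t ↦ exp (t B)`, and derivatives are unique. -/
theorem expSemigroup_comm (B : E →L[𝕜] E) (t : ℝ) (x : E) :
    B (expSemigroup B t x) = expSemigroup B t (B x) := by
  have h1 := hasDerivAt_exp_smul_const B (t : 𝕜)
  have h2 := hasDerivAt_exp_smul_const' B (t : 𝕜)
  exact DFunLike.congr_fun (h2.unique h1) x

variable [NormedSpace ℝ E] [IsScalarTower ℝ 𝕜 E]

theorem hasDerivAt_expSemigroup (B : E →L[𝕜] E) (x : E) (t : ℝ) :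
    HasDerivAt (fun t => expSemigroup B t x) (B (expSemigroup B t x)) t := by
  have h2 := hasDerivAt_exp_smul_const' B (t : 𝕜)
  have h3 : HasDerivAt (fun u : 𝕜 => NormedSpace.exp (u • B) x)
      (B (expSemigroup B t x)) (t : 𝕜) :=
    ((ContinuousLinearMap.apply 𝕜 E x).hasFDerivAt.comp_hasDerivAt _ h2)
  have h4 : HasDerivAt (fun r : ℝ => (r : 𝕜)) 1 t := by
    simpa using (RCLike.ofRealCLM (K := 𝕜)).hasDerivAt (x := t)
  exact (HasDerivAt.scomp t h3 h4).congr_deriv (one_smul _ _)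

theorem norm_expSemigroup_apply_le {B : E →L[𝕜] E}
    (hB : ∀ x, RCLike.re (inner 𝕜 (B x) x) ≤ 0) {t : ℝ} (ht : 0 ≤ t) (x : E) :
    ‖expSemigroup B t x‖ ≤ ‖x‖ := by
  have := norm_sq_le_of_deriv 𝕜 (x := fun t => expSemigroup B t x) (C := 0)
    (fun t _ => (hasDerivAt_expSemigroup B x t).hasDerivWithinAt) (fun t _ => hB _) ht
  simp only [expSemigroup_zero, mul_zero, zero_mul, add_zero] at this
  exact (sq_le_sq₀ (norm_nonneg _) (norm_nonneg _)).1 this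

end BoundedGenerator

end AbstractTheory

/-! ### Generation of a contraction semigroup by Yosida approximation. -/

section Generation

variable {𝕜 E : Type*} [RCLike 𝕜] [NormedAddCommGroup E] [InnerProductSpace 𝕜 E]

theorem tendsto_zero_of_dense {ι : Type*} {l : Filter ι} {F : ι → E →L[𝕜] E} {C : ℝ}
    (hF : ∀ i x, ‖F i x‖ ≤ C * ‖x‖) {D : Set E} (hD : Dense D)
    (h : ∀ x ∈ D, Tendsto (fun i => F i x) l (𝓝 0)) (x : E) :
    Tendsto (fun i => F i x) l (𝓝 0) := by
  rw [Metric.tendsto_nhds]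
  intro ε hε
  -- `C` carries no sign assumption; the maximum makes it safe to divide by.
  set K := max C 1
  have hK : 0 < K := lt_max_of_lt_right one_pos
  obtain ⟨z, hz, hxz⟩ := hD.exists_dist_lt x (show 0 < ε / (2 * K) by positivity)
  filter_upwards [Metric.tendsto_nhds.1 (h z hz) (ε / 2) (by positivity)] with i hi
  rw [dist_zero_right] at hi ⊢
  have h1 : ‖F i (x - z)‖ ≤ K * (ε / (2 * K)) := by
    refine (hF i _).trans (mul_le_mul (le_max_left _ _) ?_ (norm_nonneg _) hK.le)
    rw [← dist_eq_norm]
    exact hxz.le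
  have h2 : K * (ε / (2 * K)) = ε / 2 := by field_simp
  calc ‖F i x‖ = ‖F i (x - z) + F i z‖ := by rw [map_sub, sub_add_cancel]
    _ ≤ ‖F i (x - z)‖ + ‖F i z‖ := norm_add_le _ _
    _ < ε := by linarith

namespace IsMaxDissipative

variable {A : E →ₗ.[𝕜] E}

/-- Pair `l x - z` with `x`: the dissipative term has a good sign, so `l ‖x‖² ≤ ‖l x - z‖ ‖x‖`. -/
theorem mul_norm_le (hA : IsMaxDissipative A) (l : ℝ) {x z : E}
    (h : (x, z) ∈ A.graph) : l * ‖x‖ ≤ ‖(l : 𝕜) • x - z‖ := by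
  have h1 : RCLike.re (inner 𝕜 ((l : 𝕜) • x - z) x) = l * ‖x‖ ^ 2 - RCLike.re (inner 𝕜 z x) := by
    rw [inner_sub_left, inner_smul_left, map_sub, RCLike.conj_ofReal, RCLike.re_ofReal_mul,
      inner_self_eq_norm_sq]
  have h2 := hA.dissipative x z h
  have h3 := re_inner_le_norm (𝕜 := 𝕜) ((l : 𝕜) • x - z) x
  rcases eq_or_ne x 0 with rfl | hx
  · simp
  · have hx' : 0 < ‖x‖ := norm_pos_iff.2 hx
    refine le_of_mul_le_mul_right ?_ hx'
    nlinarith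

theorem resolvent_unique (hA : IsMaxDissipative A) {l : ℝ} (hl : 0 < l) {x z x' z' : E}
    (h : (x, z) ∈ A.graph) (h' : (x', z') ∈ A.graph)
    (e : (l : 𝕜) • x - z = (l : 𝕜) • x' - z') : x = x' := by
  have h1 := hA.mul_norm_le l (A.graph.sub_mem h h')
  have h2 : (l : 𝕜) • (x - x') - (z - z') = 0 := by
    rw [smul_sub, sub_sub_sub_comm, e, sub_self]
  simp only at h1
  rw [h2, norm_zero] at h1
  have h3 : ‖x - x'‖ ≤ 0 := by
    by_contra h4
    rw [not_le] at h4
    nlinarith [mul_pos hl h4]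
  exact sub_eq_zero.1 (norm_le_zero_iff.1 h3)

/-- The operators `J = l (l - A)⁻¹` and `B = A J` of the Yosida approximation. -/
theorem exists_yosida (hA : IsMaxDissipative A) {l : ℝ} (hl : 0 < l) :
    ∃ J B : E →L[𝕜] E, (∀ x, (J x, B x) ∈ A.graph) ∧
      (∀ x, J x = x + ((l⁻¹ : ℝ) : 𝕜) • B x) ∧ (∀ x, ‖J x‖ ≤ ‖x‖) ∧
      ∀ x y, (x, y) ∈ A.graph → B x = J y := by
  choose R Z hR using hA.surjective l hl
  have hl0 : (l : 𝕜) ≠ 0 := RCLike.ofReal_ne_zero.2 hl.ne'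
  -- Uniqueness of the preimage turns the chosen right inverse `R` into a linear map.
  have uniq : ∀ {x z y : E}, (x, z) ∈ A.graph → (l : 𝕜) • x - z = y → R y = x := fun h e =>
    hA.resolvent_unique hl (hR _).1 h ((hR _).2.trans e.symm)
  let R₀ : E →ₗ[𝕜] E :=
    { toFun := R
      map_add' := fun y y' => uniq (A.graph.add_mem (hR y).1 (hR y').1) (by
        change (l : 𝕜) • (R y + R y') - (Z y + Z y') = y + y'
        conv_rhs => rw [← (hR y).2, ← (hR y').2]
        module)
      map_smul' := fun c y => uniq (A.graph.smul_mem c (hR y).1) (by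
        change (l : 𝕜) • (c • R y) - c • Z y = c • y
        conv_rhs => rw [← (hR y).2]
        module) }
  have bound : ∀ y, ‖((l : 𝕜) • R₀) y‖ ≤ 1 * ‖y‖ := by
    intro y
    have := hA.mul_norm_le l (hR y).1
    rw [(hR y).2] at this
    rw [LinearMap.smul_apply, norm_smul, RCLike.norm_ofReal, abs_of_pos hl, one_mul]
    exact this
  let J : E →L[𝕜] E := LinearMap.mkContinuous ((l : 𝕜) • R₀) 1 bound
  have hJ : ∀ x, J x = (l : 𝕜) • R x := fun _ => rfl
  -- Since `A R y = l R y - y`, the operator `A J` equals `l (J - 1)`, which is visibly bounded.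
  let B : E →L[𝕜] E := (l : 𝕜) • (J - ContinuousLinearMap.id 𝕜 E)
  have hB : ∀ x, B x = (l : 𝕜) • (J x - x) := fun _ => rfl
  refine ⟨J, B, fun x => ?_, fun x => ?_, fun x => (bound x).trans_eq (one_mul _),
    fun x y h => ?_⟩
  · have h1 := A.graph.smul_mem (l : 𝕜) (hR x).1
    have h2 : B x = (l : 𝕜) • Z x := by
      rw [hB, hJ]
      congr 1
      nth_rw 2 [← (hR x).2]
      abel
    rw [h2]
    exact h1
  · rw [hB, smul_smul, RCLike.ofReal_inv, inv_mul_cancel₀ hl0, one_smul]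
    abel
  · have h1 : R ((l : 𝕜) • x - y) = x := uniq h rfl
    have h2 : J ((l : 𝕜) • x - y) = (l : 𝕜) • x := by rw [hJ, h1]
    rw [map_sub, map_smul] at h2
    rw [hB, smul_sub, ← h2]
    abel

/-- Half the derivative of `‖a - b‖²` is `Re ⟪B a - B' b, a - b⟫`, where `a`, `b` are the two
trajectories. Replacing `a - b` by `J a - J' b` makes this nonpositive by dissipativity of `A`; the
replacement costs `r B a - r' B' b`, which is small with `r + r'`. -/
theorem norm_yosida_sub_sq_le [CompleteSpace E] [NormedSpace ℝ E] [IsScalarTower ℝ 𝕜 E]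
    (hA : IsMaxDissipative A) {J B J' B' : E →L[𝕜] E} {r r' : ℝ} (hr : 0 ≤ r) (hr' : 0 ≤ r')
    (h1 : ∀ x, (J x, B x) ∈ A.graph) (h1' : ∀ x, (J' x, B' x) ∈ A.graph)
    (h2 : ∀ x, J x = x + (r : 𝕜) • B x) (h2' : ∀ x, J' x = x + (r' : 𝕜) • B' x)
    (hd : ∀ x, RCLike.re (inner 𝕜 (B x) x) ≤ 0) (hd' : ∀ x, RCLike.re (inner 𝕜 (B' x) x) ≤ 0)
    {x : E} {M : ℝ} (hM : ‖B x‖ ≤ M) (hM' : ‖B' x‖ ≤ M) {t : ℝ} (ht : 0 ≤ t) :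
    ‖expSemigroup B t x - expSemigroup B' t x‖ ^ 2 ≤ 4 * M ^ 2 * (r + r') * t := by
  have hM0 : 0 ≤ M := (norm_nonneg _).trans hM
  have := norm_sq_le_of_deriv 𝕜 (C := 2 * M * (r * M + r' * M))
    (x := fun t => expSemigroup B t x - expSemigroup B' t x)
    (fun t _ => ((hasDerivAt_expSemigroup B x t).sub
      (hasDerivAt_expSemigroup B' x t)).hasDerivWithinAt) (fun t ht => ?_) ht
  · refine this.trans_eq ?_
    simp only [expSemigroup_zero, sub_self, norm_zero]
    ring
  set a := expSemigroup B t x with ha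
  set b := expSemigroup B' t x with hb
  -- `B` commutes with its own exponential, so the bound at the initial point persists in time.
  have hp : ‖B a‖ ≤ M := by
    rw [ha, expSemigroup_comm]
    exact (norm_expSemigroup_apply_le hd ht _).trans hM
  have hq : ‖B' b‖ ≤ M := by
    rw [hb, expSemigroup_comm]
    exact (norm_expSemigroup_apply_le hd' ht _).trans hM'
  have e : a - b = (J a - J' b) - ((r : 𝕜) • B a - (r' : 𝕜) • B' b) := by
    rw [h2, h2']
    abel
  rw [e, inner_sub_right, map_sub]
  have i1 := hA.dissipative _ _ (A.graph.sub_mem (h1 a) (h1' b))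
  have i2 : -RCLike.re (inner 𝕜 (B a - B' b) ((r : 𝕜) • B a - (r' : 𝕜) • B' b)) ≤
      2 * M * (r * M + r' * M) := by
    refine (neg_le_abs _).trans ((RCLike.abs_re_le_norm _).trans
      ((norm_inner_le_norm _ _).trans ?_))
    refine mul_le_mul ((norm_sub_le _ _).trans (by linarith)) ((norm_sub_le _ _).trans ?_)
      (norm_nonneg _) (by positivity)
    rw [norm_smul, norm_smul, RCLike.norm_ofReal, RCLike.norm_ofReal, abs_of_nonneg hr,
      abs_of_nonneg hr']
    gcongr
  simp only at i1
  linarith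

/-- If `y = x - A x` is orthogonal to `D(A)`, pairing it with `x` gives `‖x‖² = Re ⟪A x, x⟫ ≤ 0`;
hence `x = 0` and `y = 0`. -/
theorem dense_domain [CompleteSpace E] (hA : IsMaxDissipative A) : Dense (A.domain : Set E) := by
  rw [Submodule.dense_iff_topologicalClosure_eq_top, Submodule.topologicalClosure_eq_top_iff,
    Submodule.eq_bot_iff]
  intro y hy
  obtain ⟨x, z, hxz, e⟩ := hA.surjective 1 one_pos y
  have hx : x ∈ A.domain := LinearPMap.mem_domain_of_mem_graph hxz
  have h1 := hA.dissipative _ _ hxz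
  have h2 := Submodule.inner_left_of_mem_orthogonal hx hy
  rw [← e, RCLike.ofReal_one, one_smul, inner_sub_left] at h2
  have h3 := congrArg RCLike.re h2
  rw [map_sub, inner_self_eq_norm_sq, map_zero] at h3
  have hx0 : x = 0 := norm_eq_zero.1 (pow_eq_zero_iff two_ne_zero |>.1
    (le_antisymm (by linarith) (sq_nonneg _)))
  subst hx0
  have hz : z = 0 := LinearPMap.graph_fst_eq_zero_snd A hxz rfl
  rw [← e, hz, smul_zero, sub_zero]

/-- The contraction semigroup generated by an `m`-dissipative operator, with its integral
formula on the domain. -/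
theorem exists_semigroup [CompleteSpace E] [NormedSpace ℝ E] [IsScalarTower ℝ 𝕜 E]
    (hA : IsMaxDissipative A) :
    ∃ S : ℝ≥0 → E →L[𝕜] E, S 0 = ContinuousLinearMap.id 𝕜 E ∧
      (∀ s t, S (s + t) = (S s).comp (S t)) ∧ (∀ t x, ‖S t x‖ ≤ ‖x‖) ∧
      (∀ x, Continuous fun t => S t x) ∧
      ∀ x y, (x, y) ∈ A.graph → ∀ t : ℝ≥0,
        S t x - x = ∫ s in (0 : ℝ)..t, S s.toNNReal y := by
  have hpos : ∀ n : ℕ, (0 : ℝ) < (n : ℝ) + 1 := fun n => n.cast_add_one_pos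
  choose J B hJB hJ hJ1 hBJ using fun n : ℕ => hA.exists_yosida (hpos n)
  have hr : ∀ n : ℕ, (0 : ℝ) ≤ ((n : ℝ) + 1)⁻¹ := fun n => (inv_pos.2 (hpos n)).le
  have hrt : Tendsto (fun n : ℕ => ((n : ℝ) + 1)⁻¹) atTop (𝓝 0) := by
    simpa only [one_div] using tendsto_one_div_add_atTop_nhds_zero_nat (𝕜 := ℝ)
  have hd : ∀ n x, RCLike.re (inner 𝕜 (B n x) x) ≤ 0 := by
    intro n x
    have h1 := hA.dissipative _ _ (hJB n x)
    rw [hJ n x, inner_add_right, inner_smul_right, map_add, RCLike.re_ofReal_mul,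
      inner_self_eq_norm_sq] at h1
    nlinarith [mul_nonneg (hr n) (sq_nonneg ‖B n x‖)]
  -- On the domain `B_n x = J_n A x`, which gives a bound independent of `n`.
  have hM : ∀ n x y, (x, y) ∈ A.graph → ‖B n x‖ ≤ ‖y‖ := by
    intro n x y h
    rw [hBJ n x y h]
    exact hJ1 n y
  have hdense := hA.dense_domain
  have dom : ∀ x ∈ (A.domain : Set E), ∃ y, (x, y) ∈ A.graph := fun x hx =>
    LinearPMap.mem_domain_iff.1 hx
  set T : ℕ → ℝ → E →L[𝕜] E := fun n t => expSemigroup (B n) t with hT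
  have hT1 : ∀ n t, 0 ≤ t → ∀ x, ‖T n t x‖ ≤ ‖x‖ := fun n t ht x =>
    norm_expSemigroup_apply_le (hd n) ht x
  have hcauchy : ∀ t : ℝ, 0 ≤ t → ∀ x, CauchySeq fun n => T n t x := by
    intro t ht x
    rw [cauchySeq_iff_tendsto_dist_atTop_0]
    have key := tendsto_zero_of_dense (l := (atTop : Filter (ℕ × ℕ))) (C := 2)
      (F := fun p : ℕ × ℕ => T p.1 t - T p.2 t) (fun p x => ?_) hdense (fun x hx => ?_) x
    · simpa only [dist_eq_norm, norm_zero, sub_apply] using key.norm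
    · have := norm_sub_le (T p.1 t x) (T p.2 t x)
      rw [sub_apply]
      linarith [hT1 p.1 t ht x, hT1 p.2 t ht x]
    · obtain ⟨y, hy⟩ := dom x hx
      have h1 : Tendsto (fun p : ℕ × ℕ => 4 * ‖y‖ ^ 2 *
          (((p.1 : ℝ) + 1)⁻¹ + ((p.2 : ℝ) + 1)⁻¹) * t) atTop (𝓝 0) := by
        rw [← prod_atTop_atTop_eq]
        have h3 : Tendsto (fun p : ℕ × ℕ => ((p.1 : ℝ) + 1)⁻¹) (atTop ×ˢ atTop) (𝓝 0) :=
          hrt.comp tendsto_fst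
        have h4 : Tendsto (fun p : ℕ × ℕ => ((p.2 : ℝ) + 1)⁻¹) (atTop ×ˢ atTop) (𝓝 0) :=
          hrt.comp tendsto_snd
        have := ((h3.add h4).const_mul (4 * ‖y‖ ^ 2)).mul_const t
        simpa only [add_zero, mul_zero, zero_mul] using this
      rw [tendsto_zero_iff_norm_tendsto_zero]
      have h2 := squeeze_zero (fun p => sq_nonneg _) (fun p : ℕ × ℕ =>
        hA.norm_yosida_sub_sq_le (hr p.1) (hr p.2) (hJB _) (hJB _) (hJ _) (hJ _) (hd _) (hd _)
        (hM p.1 x y hy) (hM p.2 x y hy) ht) h1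
      have h3 := h2.sqrt
      simpa [Real.sqrt_sq] using h3
  have hlim : ∀ (t : ℝ≥0) (x : E), ∃ y, Tendsto (fun n => T n t x) atTop (𝓝 y) := fun t x =>
    cauchySeq_tendsto_of_complete (hcauchy t t.2 x)
  choose S₀ hS₀ using hlim
  let S : ℝ≥0 → E →L[𝕜] E := fun t =>
    continuousLinearMapOfTendsto (fun n => T n t) (f := S₀ t) (tendsto_pi_nhds.2 (hS₀ t))
  have hS : ∀ (t : ℝ≥0) x, Tendsto (fun n => T n t x) atTop (𝓝 (S t x)) := hS₀
  have hS1 : ∀ t x, ‖S t x‖ ≤ ‖x‖ := fun t x =>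
    le_of_tendsto (hS t x).norm (Eventually.of_forall fun n => hT1 n t t.2 x)
  have hcont : ∀ x, Continuous fun t => S t x := by
    intro x
    -- By contractivity, orbits are uniform limits of orbits starting in `D(A)`, and those are
    -- Lipschitz with constant `‖A z‖`.
    refine continuous_of_uniform_approx_of_continuous fun u hu => ?_
    obtain ⟨ε, hε, hεu⟩ := Metric.mem_uniformity_dist.1 hu
    obtain ⟨z, hz, hxz⟩ := hdense.exists_dist_lt x hε
    obtain ⟨y, hy⟩ := dom z hz
    refine ⟨fun t : ℝ≥0 => S t z, ?_, fun t => hεu ?_⟩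
    · refine (LipschitzWith.of_dist_le_mul (K := ‖y‖₊) fun s t => ?_).continuous
      rw [dist_eq_norm]
      refine le_of_tendsto ((hS s z).sub (hS t z)).norm (Eventually.of_forall fun n => ?_)
      have := Convex.norm_image_sub_le_of_norm_hasDerivWithin_le (s := Ici (0 : ℝ)) (C := ‖y‖)
        (f := fun t => T n t z) (fun r _ => (hasDerivAt_expSemigroup (B n) z r).hasDerivWithinAt)
        (fun r hr => ?_) (convex_Ici 0) (x := (t : ℝ)) (y := (s : ℝ)) t.2 s.2
      · simpa [NNReal.dist_eq] using this
      · rw [expSemigroup_comm]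
        exact (hT1 n r hr _).trans (hM n z y hy)
    · rw [dist_eq_norm, ← map_sub]
      exact (hS1 t _).trans_lt (by rwa [← dist_eq_norm])
  refine ⟨S, ?_, fun s t => ?_, hS1, hcont, fun x y hxy t => ?_⟩
  · ext x
    refine tendsto_nhds_unique (hS 0 x) ?_
    simp [hT, expSemigroup_zero]
  · ext x
    refine tendsto_nhds_unique (hS (s + t) x) ?_
    have h1 : Tendsto (fun n => T n s (T n t x - S t x)) atTop (𝓝 0) := by
      refine squeeze_zero_norm (fun n => hT1 n s s.2 _) ?_
      simpa using ((hS t x).sub_const (S t x)).norm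
    have h2 := h1.add (hS s (S t x))
    rw [zero_add] at h2
    refine h2.congr fun n => ?_
    rw [← map_add, sub_add_cancel, hT]
    simp only [NNReal.coe_add, expSemigroup_add]
    rfl
  -- On the domain `J_n x - x = B_n x / (n + 1)` with `B_n x` bounded; density does the rest.
  · have hJy : Tendsto (fun n => J n y - y) atTop (𝓝 0) := by
      have := tendsto_zero_of_dense (l := atTop) (C := 2) (𝕜 := 𝕜)
        (F := fun n : ℕ => J n - ContinuousLinearMap.id 𝕜 E) (fun n x => ?_) hdense
        (fun x hx => ?_) y
      · simpa using this
      · have := norm_sub_le (J n x) x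
        simp only [sub_apply, ContinuousLinearMap.id_apply]
        linarith [hJ1 n x]
      · obtain ⟨z, hz⟩ := dom x hx
        refine squeeze_zero_norm (a := fun n : ℕ => ((n : ℝ) + 1)⁻¹ * ‖z‖) (fun n => ?_)
          (by simpa using hrt.mul_const ‖z‖)
        simp only [sub_apply, ContinuousLinearMap.id_apply]
        rw [hJ n x, add_sub_cancel_left, norm_smul, RCLike.norm_ofReal, abs_of_nonneg (hr n)]
        exact mul_le_mul_of_nonneg_left (hM n x z hz) (hr n)
    -- The integrand is the derivative of `T_n(s) x`, because `B_n T_n x = T_n B_n x = T_n J_n y`.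
    have hint : ∀ n, ∫ s in (0 : ℝ)..t, T n s (J n y) = T n t x - x := by
      intro n
      have hcn : Continuous fun s => T n s (J n y) := continuous_iff_continuousAt.2 fun s =>
        (hasDerivAt_expSemigroup (B n) (J n y) s).continuousAt
      have := intervalIntegral.integral_eq_sub_of_hasDerivAt (a := (0 : ℝ)) (b := t)
        (f := fun s => T n s x) (f' := fun s => T n s (J n y)) (fun s _ => ?_)
        (hcn.intervalIntegrable _ _)
      · rw [this]
        simp [hT, expSemigroup_zero]
      · have h1 := hasDerivAt_expSemigroup (B n) x s
        rwa [expSemigroup_comm, hBJ n x y hxy] at h1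
    refine tendsto_nhds_unique (((hS t x).sub_const x).congr fun n => (hint n).symm) ?_
    refine intervalIntegral.tendsto_integral_filter_of_dominated_convergence (fun _ => ‖y‖)
      (Eventually.of_forall fun n => ?_) (Eventually.of_forall fun n => ae_of_all _ fun s hs => ?_)
      intervalIntegrable_const (ae_of_all _ fun s hs => ?_)
    · exact (continuous_iff_continuousAt.2 fun s =>
        (hasDerivAt_expSemigroup (B n) (J n y) s).continuousAt).aestronglyMeasurable
    · rw [uIoc_of_le t.coe_nonneg] at hs
      exact (hT1 n s hs.1.le _).trans (hJ1 n y)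
    · rw [uIoc_of_le t.coe_nonneg] at hs
      have h1 : Tendsto (fun n => T n s (J n y - y)) atTop (𝓝 0) :=
        squeeze_zero_norm (fun n => hT1 n s hs.1.le _) (by simpa using hJy.norm)
      have h2 := hS s.toNNReal y
      rw [Real.coe_toNNReal s hs.1.le] at h2
      have h3 := h1.add h2
      rw [zero_add] at h3
      refine h3.congr fun n => ?_
      rw [← map_add, sub_add_cancel]

end IsMaxDissipative

end Generation

/-! ### Calculus on the half-line. -/

section Cauchy

/-- Freezing `x` at `x 0` for negative times gives a continuous function on the whole line, to which
the two-sided fundamental theorem of calculus applies. -/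
theorem continuous_comp_max_of_continuousOn {X : Type*} [TopologicalSpace X] {x : ℝ → X}
    (hx : ContinuousOn x (Ici 0)) : Continuous fun s : ℝ => x (max s 0) :=
  hx.comp_continuous (by fun_prop) fun s => le_max_right s 0

variable {E : Type*} [NormedAddCommGroup E]

theorem intervalIntegrable_of_continuousOn_Ici {x : ℝ → E} (hx : ContinuousOn x (Ici 0))
    {s t : ℝ} (hs : 0 ≤ s) (ht : 0 ≤ t) : IntervalIntegrable x volume s t :=
  (hx.mono fun _ hr => (le_min hs ht).trans hr.1).intervalIntegrable

variable [NormedSpace ℝ E]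

theorem integral_comp_max (x : ℝ → E) {s t : ℝ} (hs : 0 ≤ s) (ht : 0 ≤ t) :
    ∫ r in s..t, x (max r 0) = ∫ r in s..t, x r := by
  refine intervalIntegral.integral_congr fun r hr => ?_
  have : 0 ≤ r := (le_min hs ht).trans hr.1
  simp only [max_eq_left this]

variable [CompleteSpace E]

theorem hasDerivWithinAt_integral_Ici {x : ℝ → E} (hx : ContinuousOn x (Ici 0)) {t : ℝ}
    (ht : 0 ≤ t) : HasDerivWithinAt (fun t => ∫ s in (0 : ℝ)..t, x s) (x t) (Ici 0) t := by
  have h1 := continuous_comp_max_of_continuousOn hx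
  have h2 := (h1.integral_hasStrictDerivAt 0 t).hasDerivAt.hasDerivWithinAt (s := Ici 0)
  rw [max_eq_left ht] at h2
  exact h2.congr (fun s hs => (integral_comp_max x le_rfl hs).symm)
    (integral_comp_max x le_rfl ht).symm

end Cauchy

/-! ### The generator, and mild and strong solutions. -/

section Solutions

variable {𝕜 E : Type*} [RCLike 𝕜] [NormedAddCommGroup E] [InnerProductSpace 𝕜 E]
  {A : E →ₗ.[𝕜] E}

theorem exists_apply_eq_of_mem_graph {x y : E} (h : (x, y) ∈ A.graph) :
    ∃ hx : x ∈ A.domain, A ⟨x, hx⟩ = y := by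
  obtain ⟨z, hz, rfl⟩ := (LinearPMap.mem_graph_iff A).1 h
  simp only at hz
  subst hz
  exact ⟨z.2, rfl⟩

theorem tendsto_slope_coe [NormedSpace ℝ E] [IsScalarTower ℝ 𝕜 E] {f : ℝ → E} {y : E} {t : ℝ}
    (h : HasDerivAt f y t) :
    Tendsto (fun h : ℝ≥0 => (((h : ℝ) : 𝕜)⁻¹) • (f (t + h) - f t)) (𝓝[>] 0) (𝓝 y) := by
  have h1 := hasDerivAt_iff_tendsto_slope_zero.1 h
  have h2 : Tendsto (fun h : ℝ≥0 => (h : ℝ)) (𝓝[>] 0) (𝓝[≠] 0) := by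
    refine tendsto_nhdsWithin_iff.2 ⟨?_, ?_⟩
    · have : Tendsto (fun h : ℝ≥0 => (h : ℝ)) (𝓝 0) (𝓝 ((0 : ℝ≥0) : ℝ)) :=
        NNReal.continuous_coe.tendsto 0
      exact this.mono_left nhdsWithin_le_nhds
    · filter_upwards [self_mem_nhdsWithin] with h hh
      exact NNReal.coe_ne_zero.2 (ne_of_gt hh)
  refine (h1.comp h2).congr fun r => ?_
  simp only [Function.comp_apply]
  rw [← RCLike.ofReal_inv, ← RCLike.real_smul_eq_coe_smul]

variable [NormedSpace ℝ E]

theorem IsMildSolution.mem_graph {x₀ : E} {x : ℝ → E} (hx : IsMildSolution A x₀ x) {t : ℝ}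
    (ht : 0 ≤ t) : (∫ s in (0 : ℝ)..t, x s, x t - x₀) ∈ A.graph := by
  obtain ⟨h, e⟩ := hx.2 t ht
  rw [e, add_sub_cancel_left]
  exact LinearPMap.mem_graph A ⟨_, h⟩

namespace IsMaxDissipative

theorem strong_unique (hA : IsMaxDissipative A) {x₀ : E} {x y : ℝ → E}
    (hx : IsStrongSolution A x₀ x) (hy : IsStrongSolution A x₀ y) : EqOn y x (Ici 0) := by
  obtain ⟨hx0, x', hxg, -, -, hxd⟩ := hx
  obtain ⟨hy0, y', hyg, -, -, hyd⟩ := hy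
  intro t ht
  exact sub_eq_zero.1 (eq_zero_of_dissipative 𝕜 (x := fun t => y t - x t)
    (fun t ht => (hyd t ht).sub (hxd t ht))
    (fun t ht => hA.dissipative _ _ (A.graph.sub_mem (hyg t ht) (hxg t ht)))
    (by rw [hx0, hy0, sub_self]) ht)

variable [CompleteSpace E]

/-- The primitive `z` of `y - x` solves `z' = A z`, `z(0) = 0`, so it vanishes; then `y - x = A z =
0`. -/
theorem mild_unique (hA : IsMaxDissipative A) {x₀ : E} {x y : ℝ → E}
    (hx : IsMildSolution A x₀ x) (hy : IsMildSolution A x₀ y) : EqOn y x (Ici 0) := by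
  have hg : ∀ t, 0 ≤ t → (∫ s in (0 : ℝ)..t, (y s - x s), y t - x t) ∈ A.graph := by
    intro t ht
    have := A.graph.sub_mem (hy.mem_graph ht) (hx.mem_graph ht)
    rw [Prod.mk_sub_mk, sub_sub_sub_cancel_right, ← intervalIntegral.integral_sub
      (intervalIntegrable_of_continuousOn_Ici hy.1 le_rfl ht)
      (intervalIntegrable_of_continuousOn_Ici hx.1 le_rfl ht)] at this
    exact this
  intro t ht
  have h0 := eq_zero_of_dissipative 𝕜
    (fun t ht => hasDerivWithinAt_integral_Ici (hy.1.sub hx.1) ht)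
    (fun t ht => hA.dissipative _ _ (hg t ht)) intervalIntegral.integral_same ht
  exact sub_eq_zero.1 (LinearPMap.graph_fst_eq_zero_snd A (hg t ht) h0)

variable [IsScalarTower ℝ 𝕜 E]

/-- The integral formula shows that the generator extends `A`. It is itself dissipative because `S`
contracts, and a maximal operator has no proper dissipative extension. -/
theorem exists_generated (hA : IsMaxDissipative A) :
    ∃ S : ℝ≥0 → E →L[𝕜] E, IsContractionSemigroup S ∧ IsGenerator A S ∧
      (∀ x, Continuous fun t => S t x) ∧ ∀ x y, (x, y) ∈ A.graph → ∀ t : ℝ≥0,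
        S t x - x = ∫ s in (0 : ℝ)..t, S s.toNNReal y := by
  obtain ⟨S, S0, Sadd, Sle, Scont, Sint⟩ := hA.exists_semigroup
  have fwd : ∀ x y, (x, y) ∈ A.graph →
      Tendsto (fun h : ℝ≥0 => (((h : ℝ) : 𝕜)⁻¹) • (S h x - x)) (𝓝[>] 0) (𝓝 y) := by
    intro x y hxy
    have hc : Continuous fun s : ℝ => S s.toNNReal y := (Scont y).comp continuous_real_toNNReal
    have h1 := (hc.integral_hasStrictDerivAt 0 0).hasDerivAt
    rw [Real.toNNReal_zero, S0, ContinuousLinearMap.id_apply] at h1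
    refine (tendsto_slope_coe (𝕜 := 𝕜) h1).congr fun h => ?_
    rw [Sint x y hxy h]
    simp
  refine ⟨S, ⟨S0, Sadd, fun x => ?_, fun t => ?_⟩, fun x y => ⟨fwd x y, fun h => ?_⟩, Scont, Sint⟩
  · have := ((Scont x).tendsto 0).mono_left (nhdsWithin_le_nhds (s := Ioi 0))
    rwa [S0] at this
  · exact ContinuousLinearMap.opNorm_le_bound _ zero_le_one fun x => by
      rw [one_mul]
      exact Sle t x
  -- With `G` the generator, choose `z ∈ D(A)` such that `z - A z = x - G x`. Then `w = x - z`
  -- satisfies `G w = w`, and dissipativity of `G` forces `w = 0`.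
  · obtain ⟨z, z', hz, e⟩ := hA.surjective 1 one_pos (x - y)
    rw [RCLike.ofReal_one, one_smul] at e
    have h1 := h.sub (fwd z z' hz)
    have e' : y - z' = x - z := by
      have : y - z' - (x - z) = (z - z') - (x - y) := by abel
      rw [e, sub_self] at this
      exact sub_eq_zero.1 this
    rw [e'] at h1
    have h2 : Tendsto (fun h : ℝ≥0 => RCLike.re (inner 𝕜
        ((((h : ℝ) : 𝕜)⁻¹) • (S h (x - z) - (x - z))) (x - z))) (𝓝[>] 0)
        (𝓝 (RCLike.re (inner 𝕜 (x - z) (x - z)))) := by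
      refine (RCLike.continuous_re.tendsto _).comp (Tendsto.inner (h1.congr fun h => ?_)
        tendsto_const_nhds)
      rw [← smul_sub, map_sub]
      congr 1
      abel
    have h3 : RCLike.re (inner 𝕜 (x - z) (x - z)) ≤ 0 := by
      refine le_of_tendsto h2 (Eventually.of_forall fun h => ?_)
      rw [inner_smul_left, ← RCLike.ofReal_inv, RCLike.conj_ofReal, RCLike.re_ofReal_mul,
        inner_sub_left, map_sub, inner_self_eq_norm_sq]
      refine mul_nonpos_of_nonneg_of_nonpos (inv_nonneg.2 h.2) ?_
      have := re_inner_le_norm (𝕜 := 𝕜) (S h (x - z)) (x - z)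
      nlinarith [Sle h (x - z), norm_nonneg (x - z)]
    have h4 : x - z = 0 := by
      rw [inner_self_eq_norm_sq] at h3
      exact norm_eq_zero.1 (pow_eq_zero_iff two_ne_zero |>.1 (le_antisymm h3 (sq_nonneg _)))
    rw [h4, sub_eq_zero] at e'
    rw [sub_eq_zero.1 h4, e']
    exact hz

theorem exists_mild (hA : IsMaxDissipative A) (x₀ : E) : ∃ x : ℝ → E, IsMildSolution A x₀ x := by
  obtain ⟨S, hS, hgen, Scont, -⟩ := hA.exists_generated
  have hc : Continuous fun s : ℝ => S s.toNNReal x₀ := (Scont x₀).comp continuous_real_toNNReal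
  have hi : ∀ a b, IntervalIntegrable (fun s : ℝ => S s.toNNReal x₀) volume a b :=
    fun a b => hc.intervalIntegrable a b
  refine ⟨fun s => S s.toNNReal x₀, hc.continuousOn, fun t ht => ?_⟩
  have key : (∫ s in (0 : ℝ)..t, S s.toNNReal x₀, S t.toNNReal x₀ - x₀) ∈ A.graph := by
    refine (hgen _ _).2 ?_
    have d1 := tendsto_slope_coe (𝕜 := 𝕜) (hc.integral_hasStrictDerivAt 0 t).hasDerivAt
    have d0 := tendsto_slope_coe (𝕜 := 𝕜) (hc.integral_hasStrictDerivAt 0 0).hasDerivAt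
    rw [Real.toNNReal_zero, hS.map_zero, ContinuousLinearMap.id_apply] at d0
    refine (d1.sub d0).congr fun h => ?_
    -- Applying `S h` shifts the window; the difference quotient of the primitive becomes an average
    -- at `t` minus an average at `0`.
    have e1 : S h (∫ s in (0 : ℝ)..t, S s.toNNReal x₀) =
        ∫ s in (h : ℝ)..(t + h), S s.toNNReal x₀ := by
      rw [← ContinuousLinearMap.intervalIntegral_comp_comm _ (hi 0 t)]
      have := intervalIntegral.integral_comp_add_right (a := 0) (b := t)
        (fun s => S s.toNNReal x₀) (h : ℝ)
      rw [zero_add] at this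
      rw [← this]
      refine intervalIntegral.integral_congr fun s hs => ?_
      have hs0 : 0 ≤ s := by
        rw [uIcc_of_le ht] at hs
        exact hs.1
      rw [Real.toNNReal_add hs0 h.coe_nonneg, Real.toNNReal_coe, add_comm, hS.map_add]
      rfl
    rw [← smul_sub, e1, zero_add, intervalIntegral.integral_same, sub_zero,
      ← intervalIntegral.integral_interval_sub_left (hi 0 (t + h)) (hi 0 h)]
    congr 1
    abel
  obtain ⟨hd, e⟩ := exists_apply_eq_of_mem_graph key
  exact ⟨hd, by rw [e]; abel⟩

theorem exists_strong (hA : IsMaxDissipative A) {x₀ : E} (hx₀ : x₀ ∈ A.domain) :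
    ∃ x : ℝ → E, IsStrongSolution A x₀ x := by
  obtain ⟨S, hS, hgen, Scont, Sint⟩ := hA.exists_generated
  obtain ⟨y₀, hy₀⟩ := LinearPMap.mem_domain_iff.1 hx₀
  have hc : ∀ z, Continuous fun s : ℝ => S s.toNNReal z := fun z =>
    (Scont z).comp continuous_real_toNNReal
  refine ⟨fun t => S t.toNNReal x₀, ?_, fun t => S t.toNNReal y₀, fun t ht => ?_,
    (hc _).continuousOn, (hc _).continuousOn, fun t ht => ?_⟩
  · simp [hS.map_zero]
  · refine (hgen _ _).2 ?_
    refine (((S t.toNNReal).continuous.tendsto _).comp ((hgen _ _).1 hy₀)).congr fun h => ?_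
    -- Commutation moves the difference quotient onto `x₀`, whence `A S(t) x₀ = S(t) A x₀`.
    have e : S h (S t.toNNReal x₀) = S t.toNNReal (S h x₀) := by
      rw [← ContinuousLinearMap.comp_apply, ← ContinuousLinearMap.comp_apply, ← hS.map_add,
        ← hS.map_add, add_comm]
    simp only [Function.comp_apply]
    rw [map_smul, map_sub, e]
  · have h1 := (hasDerivWithinAt_integral_Ici (hc y₀).continuousOn ht).const_add x₀
    have h2 : ∀ s : ℝ, 0 ≤ s → S s.toNNReal x₀ = x₀ + ∫ r in (0 : ℝ)..s, S r.toNNReal y₀ := by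
      intro s hs
      have := Sint x₀ y₀ hy₀ s.toNNReal
      rw [Real.coe_toNNReal s hs] at this
      rw [← this]
      abel
    exact h1.congr (fun s hs => h2 s hs) (h2 t ht)

end IsMaxDissipative

end Solutions

/-! ### One-dimensional Sobolev calculus. -/

section SobolevInterval

variable {𝕜 : Type*} [RCLike 𝕜] {a b : ℝ}

/-- The product rule for primitives of integrable functions, in integrated form. -/
theorem integral_primitive_mul_add {f g : ℝ → 𝕜} (hab : a ≤ b)
    (hf : IntervalIntegrable f volume a b) (hg : IntervalIntegrable g volume a b) :
    (∫ x in a..b, (∫ y in a..x, f y) * g x) + ∫ x in a..b, f x * ∫ y in a..x, g y =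
      (∫ x in a..b, f x) * ∫ x in a..b, g x := by
  rw [intervalIntegrable_iff_integrableOn_Ioc_of_le hab] at hf hg
  simp only [intervalIntegral.integral_of_le hab]
  set μ := (volume : Measure ℝ).restrict (Ioc a b) with hμ
  have prim : ∀ h : ℝ → 𝕜, ∀ x ∈ Ioc a b,
      ∫ y in a..x, h y = ∫ y, (Iic x).indicator h y ∂μ := by
    intro h x hx
    rw [intervalIntegral.integral_of_le hx.1.le, integral_indicator measurableSet_Iic, hμ,
      Measure.restrict_restrict measurableSet_Iic]
    congr 2
    ext y
    simp only [mem_Ioc, mem_inter_iff, mem_Iic]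
    constructor
    · exact fun h => ⟨h.2, h.1, h.2.trans hx.2⟩
    · exact fun h => ⟨h.2.1, h.1⟩
  have e1 : ∫ x, (∫ y in a..x, f y) * g x ∂μ
      = ∫ x, (∫ y, (Iic x).indicator f y ∂μ) * g x ∂μ :=
    setIntegral_congr_fun measurableSet_Ioc fun x hx => by simp only [prim f x hx]
  have e2 : ∫ x, f x * (∫ y in a..x, g y) ∂μ
      = ∫ x, f x * (∫ y, (Iic x).indicator g y ∂μ) ∂μ :=
    setIntegral_congr_fun measurableSet_Ioc fun x hx => by simp only [prim g x hx]
  rw [e1, e2, ← integral_prod_mul (μ := μ) (ν := μ)]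
  have hF : Integrable (fun z : ℝ × ℝ => f z.1 * g z.2) (μ.prod μ) := hf.mul_prod hg
  -- Fubini on the square split along the diagonal: each triangle yields one of the two summands.
  set s : Set (ℝ × ℝ) := {z | z.1 ≤ z.2} with hs
  have hsm : MeasurableSet s := measurableSet_le measurable_fst measurable_snd
  rw [← integral_add_compl hsm hF, ← integral_indicator hsm, ← integral_indicator hsm.compl,
    integral_prod_symm _ (hF.indicator hsm), integral_prod _ (hF.indicator hsm.compl)]
  congr 1
  · refine integral_congr_ae (Eventually.of_forall fun y => ?_)
    simp only
    rw [← integral_mul_const]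
    refine integral_congr_ae (Eventually.of_forall fun x => ?_)
    by_cases h : x ≤ y <;> simp [s, h]
  · refine integral_congr_ae (Eventually.of_forall fun x => ?_)
    simp only
    rw [← integral_const_mul]
    -- The diagonal belongs to `s` only, while `Iic x` contains its end point; the discrepancy is a
    -- null set.
    have hne : ∀ᵐ y ∂μ, y ≠ x := by
      rw [hμ]
      exact ae_restrict_of_ae (by simp [ae_iff])
    refine integral_congr_ae ?_
    filter_upwards [hne] with y hy
    by_cases h : y ≤ x
    · have h' : ¬ x ≤ y := fun h' => hy (le_antisymm h h')
      simp [s, h, h']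
    · have h' : x ≤ y := (not_le.1 h).le
      simp [s, h, h']

theorem intervalIntegrable_L2 (hab : a ≤ b) (u : L2 𝕜 a b) : IntervalIntegrable u volume a b := by
  rw [intervalIntegrable_iff_integrableOn_Ioc_of_le hab, integrableOn_Ioc_iff_integrableOn_Ioo]
  exact integrable_L2 u

theorem setIntegral_Ioo_eq (hab : a ≤ b) (f : ℝ → 𝕜) :
    ∫ x in Ioo a b, f x = ∫ x in a..b, f x := by
  rw [intervalIntegral.integral_of_le hab, integral_Ioc_eq_integral_Ioo]

theorem continuousOn_primitive_L2 (hab : a ≤ b) (c : 𝕜) (g : L2 𝕜 a b) :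
    ContinuousOn (fun x => c + ∫ y in a..x, g y) (Icc a b) := by
  have := intervalIntegral.continuousOn_primitive_interval (f := g) (a := a) (b := b)
    (μ := volume) (by
      rw [uIcc_of_le hab, integrableOn_Icc_iff_integrableOn_Ioo]
      exact integrable_L2 g)
  rw [uIcc_of_le hab] at this
  exact continuousOn_const.add this

/-- Primitives of `L²` functions are `H¹` functions. -/
theorem exists_primitive (hab : a ≤ b) (c : 𝕜) (g : L2 𝕜 a b) :
    ∃ u : L2 𝕜 a b, IsContRep u (fun x => c + ∫ y in a..x, g y) ∧ IsWeakDeriv u g := by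
  have hc := continuousOn_primitive_L2 hab c g
  obtain ⟨C, hC⟩ := isCompact_Icc.exists_bound_of_continuousOn hc
  have hm : MemLp (fun x => c + ∫ y in a..x, g y) 2 (volume.restrict (Ioo a b)) :=
    MemLp.of_bound ((hc.mono Ioo_subset_Icc_self).aestronglyMeasurable measurableSet_Ioo) C
      ((ae_restrict_mem measurableSet_Ioo).mono fun x hx => hC x (Ioo_subset_Icc_self hx))
  refine ⟨hm.toLp _, ⟨hc, hm.coeFn_toLp⟩, fun φ hφ hφc hs => ?_⟩
  have φa : φ a = 0 := image_eq_zero_of_notMem_tsupport fun h => (hs h).1.false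
  have φb : φ b = 0 := image_eq_zero_of_notMem_tsupport fun h => (hs h).2.false
  have hd : Continuous (deriv φ) := hφ.continuous_deriv (by simp)
  have hd' : Continuous fun x => ((deriv φ x : ℝ) : 𝕜) := RCLike.continuous_ofReal.comp hd
  have φint : ∀ x, ∫ y in a..x, ((deriv φ y : ℝ) : 𝕜) = ((φ x : ℝ) : 𝕜) := by
    intro x
    have h1 := intervalIntegral.integral_eq_sub_of_hasDerivAt (a := a) (b := x) (f := φ)
      (f' := deriv φ) (fun y _ => (hφ.differentiable (by simp) y).hasDerivAt)
      (hd.intervalIntegrable _ _)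
    rw [φa, sub_zero] at h1
    rw [← h1]
    exact RCLike.intervalIntegral_ofReal
  -- Use the product rule with the factors `φ'` and `g`; `φ(b) = 0` kills the right-hand side.
  have key := integral_primitive_mul_add hab (hd'.intervalIntegrable (μ := volume) a b)
    (intervalIntegrable_L2 hab g)
  simp only [φint, φb, RCLike.ofReal_zero, zero_mul] at key
  have e1 : ∫ x in Ioo a b, deriv φ x • (hm.toLp _ : L2 𝕜 a b) x
      = ∫ x in Ioo a b, ((deriv φ x : ℝ) : 𝕜) * (c + ∫ y in a..x, g y) := by
    refine integral_congr_ae ?_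
    filter_upwards [hm.coeFn_toLp] with x hx
    rw [hx, RCLike.real_smul_eq_coe_mul]
  have e2 : ∫ x in Ioo a b, φ x • g x = ∫ x in Ioo a b, ((φ x : ℝ) : 𝕜) * g x := by
    simp only [RCLike.real_smul_eq_coe_mul]
  have i1 : IntervalIntegrable (fun x => ((deriv φ x : ℝ) : 𝕜) * ∫ y in a..x, g y)
      volume a b := by
    have := continuousOn_primitive_L2 hab (0 : 𝕜) g
    simp only [zero_add] at this
    refine ContinuousOn.intervalIntegrable ?_
    rw [uIcc_of_le hab]
    exact hd'.continuousOn.mul this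
  rw [e1, e2, setIntegral_Ioo_eq hab, setIntegral_Ioo_eq hab]
  simp only [mul_add]
  have i2 : IntervalIntegrable (fun x => ((deriv φ x : ℝ) : 𝕜) * c) volume a b :=
    (hd'.mul continuous_const).intervalIntegrable _ _
  rw [intervalIntegral.integral_add i2 i1,
    intervalIntegral.integral_mul_const, φint, φb, RCLike.ofReal_zero, zero_mul, zero_add]
  exact eq_neg_of_add_eq_zero_right key

theorem IsContRep.eqOn (hab : a < b) {u : L2 𝕜 a b} {f g : ℝ → 𝕜} (hf : IsContRep u f)
    (hg : IsContRep u g) : EqOn f g (Icc a b) := by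
  have h2 : EqOn f g (Ioo a b) :=
    Measure.eqOn_open_of_ae_eq (hf.2.symm.trans hg.2) isOpen_Ioo
      (hf.1.mono Ioo_subset_Icc_self) (hg.1.mono Ioo_subset_Icc_self)
  exact h2.of_subset_closure hf.1 hg.1 Ioo_subset_Icc_self (by rw [closure_Ioo hab.ne])

/-- Subtracting from `u` the primitive of its weak derivative leaves a class with zero weak
derivative, that is, a constant. -/
theorem MemH1.exists_contRep (hab : a < b) {u : L2 𝕜 a b} (hu : MemH1 u) :
    ∃ c : 𝕜, IsContRep u (fun x => c + ∫ y in a..x, weakDeriv u y) := by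
  obtain ⟨w, hw, hwd⟩ := exists_primitive hab.le (0 : 𝕜) (weakDeriv u)
  have h1 : IsWeakDeriv (u + (-1 : 𝕜) • w) 0 := by
    have := hu.isWeakDeriv.add (hwd.smul (-1))
    rwa [neg_one_smul 𝕜 (weakDeriv u), add_neg_cancel] at this
  obtain ⟨c, hc⟩ := h1.ae_const hab
  refine ⟨c, continuousOn_primitive_L2 hab.le c _, ?_⟩
  filter_upwards [hc, hw.2, Lp.coeFn_add u ((-1 : 𝕜) • w), Lp.coeFn_smul (-1 : 𝕜) w]
    with x h1 h2 h3 h4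
  rw [h3, Pi.add_apply, h4, Pi.smul_apply, h2, zero_add, neg_one_smul] at h1
  rw [← h1]
  abel

theorem IsContRep.eq_add_integral (hab : a < b) {u : L2 𝕜 a b} (hu : MemH1 u) {f : ℝ → 𝕜}
    (hf : IsContRep u f) {x : ℝ} (hx : x ∈ Icc a b) :
    f x = f a + ∫ y in a..x, weakDeriv u y := by
  obtain ⟨c, hc⟩ := hu.exists_contRep hab
  have h := hf.eqOn hab hc
  have ha := h (left_mem_Icc.2 hab.le)
  simp only [intervalIntegral.integral_same, add_zero] at ha
  rw [h hx, ha]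

/-- Integration by parts in `H¹(a,b)`. -/
theorem inner_weakDeriv_add (hab : a < b) {u w : L2 𝕜 a b} (hu : MemH1 u) (hw : MemH1 w)
    {f g : ℝ → 𝕜} (hf : IsContRep u f) (hg : IsContRep w g) :
    inner 𝕜 (weakDeriv w) u + inner 𝕜 w (weakDeriv u) =
      (starRingEnd 𝕜) (g b) * f b - (starRingEnd 𝕜) (g a) * f a := by
  have hfb := hf.eq_add_integral hab hu (right_mem_Icc.2 hab.le)
  have hgb := hg.eq_add_integral hab hw (right_mem_Icc.2 hab.le)
  have hi := intervalIntegrable_L2 hab.le (weakDeriv u)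
  have hj : IntervalIntegrable (fun x => (starRingEnd 𝕜) (weakDeriv w x)) volume a b := by
    have := intervalIntegrable_L2 hab.le (weakDeriv w)
    rw [intervalIntegrable_iff] at this ⊢
    exact (RCLike.conjCLE (K := 𝕜)).toContinuousLinearMap.integrable_comp this
  have hconj : ∀ x, ∫ y in a..x, (starRingEnd 𝕜) (weakDeriv w y)
      = (starRingEnd 𝕜) (∫ y in a..x, weakDeriv w y) := by
    intro x
    simp only [intervalIntegral, map_sub, integral_conj]
  -- The product rule for `conj w'` and `u'` treats primitives vanishing at `a`; the constants `f a`
  -- and `g a` are reinstated below.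
  have key := integral_primitive_mul_add hab.le hj hi
  simp only [hconj] at key
  have hcont : ContinuousOn (fun x => ∫ y in a..x, weakDeriv u y) (uIcc a b) := by
    have := continuousOn_primitive_L2 hab.le (0 : 𝕜) (weakDeriv u)
    simp only [zero_add] at this
    rwa [uIcc_of_le hab.le]
  have hcont' : ContinuousOn (fun x => (starRingEnd 𝕜) (∫ y in a..x, weakDeriv w y))
      (uIcc a b) := by
    have := continuousOn_primitive_L2 hab.le (0 : 𝕜) (weakDeriv w)
    simp only [zero_add] at this
    rw [uIcc_of_le hab.le]
    exact RCLike.continuous_conj.comp_continuousOn this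
  have e1 : inner 𝕜 (weakDeriv w) u = ∫ x in a..b, (f a * (starRingEnd 𝕜) (weakDeriv w x)
      + (starRingEnd 𝕜) (weakDeriv w x) * ∫ y in a..x, weakDeriv u y) := by
    rw [L2.inner_def, ← setIntegral_Ioo_eq hab.le]
    refine integral_congr_ae ?_
    filter_upwards [hf.2, ae_restrict_mem measurableSet_Ioo] with x hx hm
    rw [RCLike.inner_apply, hx, hf.eq_add_integral hab hu (Ioo_subset_Icc_self hm)]
    ring
  have e2 : inner 𝕜 w (weakDeriv u) = ∫ x in a..b, ((starRingEnd 𝕜) (g a) * weakDeriv u x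
      + (starRingEnd 𝕜) (∫ y in a..x, weakDeriv w y) * weakDeriv u x) := by
    rw [L2.inner_def, ← setIntegral_Ioo_eq hab.le]
    refine integral_congr_ae ?_
    filter_upwards [hg.2, ae_restrict_mem measurableSet_Ioo] with x hx hm
    rw [RCLike.inner_apply, hx, hg.eq_add_integral hab hw (Ioo_subset_Icc_self hm), map_add]
    ring
  rw [e1, e2, intervalIntegral.integral_add (hj.const_mul _) (hj.mul_continuousOn hcont),
    intervalIntegral.integral_add (hi.const_mul _) (hi.continuousOn_mul hcont'),
    intervalIntegral.integral_const_mul, intervalIntegral.integral_const_mul, hconj, hfb, hgb,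
    map_add]
  linear_combination key

/-- Cauchy–Schwarz, in the form of the comparison of `L¹` and `L²` norms on a finite measure space.
-/
theorem norm_integral_L2_le (hab : a ≤ b) (g : L2 𝕜 a b) {x : ℝ} (hx : x ∈ Icc a b) :
    ‖∫ y in a..x, g y‖ ≤ √(b - a) * ‖g‖ := by
  have h0 : ‖∫ y in a..x, g y‖ ≤ ∫ y in Ioo a b, ‖g y‖ := by
    rw [intervalIntegral.integral_of_le hx.1]
    refine (norm_integral_le_integral_norm _).trans ?_
    rw [← integral_Ioc_eq_integral_Ioo]
    refine setIntegral_mono_set ?_ (ae_of_all _ fun _ => norm_nonneg _)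
      (Ioc_subset_Ioc_right hx.2).eventuallyLE
    have := (intervalIntegrable_L2 hab g).norm
    rwa [intervalIntegrable_iff_integrableOn_Ioc_of_le hab] at this
  refine h0.trans ?_
  have h1 : ∫ y in Ioo a b, ‖g y‖ = (eLpNorm g 1 (volume.restrict (Ioo a b))).toReal := by
    rw [eLpNorm_one_eq_lintegral_enorm, integral_norm_eq_lintegral_enorm
      (Lp.aestronglyMeasurable g)]
  have h2 := eLpNorm_le_eLpNorm_mul_rpow_measure_univ (μ := volume.restrict (Ioo a b))
    (p := 1) (q := 2) (by norm_num) (Lp.aestronglyMeasurable g)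
  rw [h1, Lp.norm_def]
  refine (ENNReal.toReal_mono (ENNReal.mul_ne_top (Lp.eLpNorm_ne_top g) ?_) h2).trans_eq ?_
  · exact ENNReal.rpow_ne_top_of_nonneg (by norm_num) (measure_ne_top _ _)
  · rw [ENNReal.toReal_mul, mul_comm]
    congr 1
    rw [Measure.restrict_apply_univ, Real.volume_Ioo, ← ENNReal.toReal_rpow,
      ENNReal.toReal_ofReal (sub_nonneg.2 hab), Real.sqrt_eq_rpow]
    norm_num

/-- The Poincaré inequality. -/
theorem norm_le_of_contRep_eq_zero (hab : a < b) {u : L2 𝕜 a b} (hu : MemH1 u) {f : ℝ → 𝕜}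
    (hf : IsContRep u f) {z : ℝ} (hz : z ∈ Icc a b) (hfz : f z = 0) :
    ‖u‖ ≤ 2 * (b - a) * ‖weakDeriv u‖ := by
  set K := √(b - a) * ‖weakDeriv u‖ with hK
  have h1 : ∀ x ∈ Icc a b, ‖f x‖ ≤ 2 * K := by
    intro x hx
    have h2 := hf.eq_add_integral hab hu hx
    have h3 := hf.eq_add_integral hab hu hz
    rw [hfz] at h3
    -- Both integrals start at `a` and each is at most `K`; this is the source of the factor `2`.
    have h4 : f x = (∫ y in a..x, weakDeriv u y) - ∫ y in a..z, weakDeriv u y := by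
      rw [h2]
      linear_combination -h3
    rw [h4]
    refine (norm_sub_le _ _).trans ?_
    linarith [norm_integral_L2_le hab.le (weakDeriv u) hx,
      norm_integral_L2_le hab.le (weakDeriv u) hz]
  have h2 := Lp.norm_le_of_ae_bound (f := u) (C := 2 * K) (by positivity) (by
    filter_upwards [hf.2, ae_restrict_mem measurableSet_Ioo] with x hx hm
    rw [hx]
    exact h1 x (Ioo_subset_Icc_self hm))
  refine h2.trans_eq ?_
  have h3 : (measureUnivNNReal (volume.restrict (Ioo a b)) : ℝ) = b - a := by
    rw [measureUnivNNReal, ENNReal.coe_toNNReal_eq_toReal, Measure.restrict_apply_univ,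
      Real.volume_Ioo, ENNReal.toReal_ofReal (sub_nonneg.2 hab.le)]
  have h4 : √(b - a) * √(b - a) = b - a := Real.mul_self_sqrt (sub_nonneg.2 hab.le)
  rw [h3, ENNReal.toReal_ofNat, ← one_div, ← Real.sqrt_eq_rpow, hK]
  linear_combination (2 * ‖weakDeriv u‖) * h4

/-- A pair of `L²` functions with vanishing total integral is the derivative of a pair
in `ℍ¹₀`. -/
theorem exists_mem_H10 (P : Params) (g : L2 𝕜 (-P.L) 0) (h : L2 𝕜 0 P.L)
    (hgh : (∫ y in (-P.L)..0, g y) + ∫ y in (0 : ℝ)..P.L, h y = 0) :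
    ∃ (u : L2 𝕜 (-P.L) 0) (v : L2 𝕜 0 P.L), (u, v) ∈ H10 𝕜 P ∧ IsWeakDeriv u g ∧
      IsWeakDeriv v h ∧ IsContRep u (fun x => ∫ y in (-P.L)..x, g y) := by
  have hL := P.L_pos
  obtain ⟨u, hu, hud⟩ := exists_primitive (by linarith) (0 : 𝕜) g
  obtain ⟨v, hv, hvd⟩ := exists_primitive hL.le (∫ y in (-P.L)..0, g y) h
  simp only [zero_add] at hu
  exact ⟨u, v, ⟨⟨_, hud⟩, ⟨_, hvd⟩, _, _, hu, hv, by simp, hgh, by simp⟩, hud, hvd, hu⟩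

/-- The integrals telescope through the common value at `0`. Together with `exists_mem_H10` this
encodes all three boundary conditions as one linear constraint on the derivatives. -/
theorem integral_add_eq_zero_of_mem_H10 {P : Params} {u : L2 𝕜 (-P.L) 0} {v : L2 𝕜 0 P.L}
    (h : (u, v) ∈ H10 𝕜 P) :
    (∫ y in (-P.L)..0, weakDeriv u y) + ∫ y in (0 : ℝ)..P.L, weakDeriv v y = 0 := by
  have hL := P.L_pos
  obtain ⟨hu, hv, f, g, hf, hg, hf0, hg0, hfg⟩ := h
  have h1 := hf.eq_add_integral (by linarith) hu (right_mem_Icc.2 (by linarith))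
  have h2 := hg.eq_add_integral hL hv (right_mem_Icc.2 hL.le)
  rw [hf0, zero_add] at h1
  rw [hg0] at h2
  rw [← h1, hfg]
  exact h2.symm

end SobolevInterval

/-! ### The energy space: bounded components and completeness. -/

namespace State

variable {𝕜 : Type*} [RCLike 𝕜] {P : Params}

instance : IsScalarTower ℝ 𝕜 (State 𝕜 P) :=
  IsScalarTower.of_algebraMap_smul fun _ _ => rfl

theorem inner_eq (x y : State 𝕜 P) : inner 𝕜 x y =
    (P.ρ₁ : 𝕜) * inner 𝕜 x.U y.U + (P.ρ₂ : 𝕜) * inner 𝕜 x.V y.V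
      + (P.k₁ : 𝕜) * inner 𝕜 (weakDeriv x.u) (weakDeriv y.u)
      + (P.k₂ : 𝕜) * inner 𝕜 (weakDeriv x.v) (weakDeriv y.v)
      + (P.c : 𝕜) * inner 𝕜 x.φ₁ y.φ₁ + (P.c : 𝕜) * inner 𝕜 x.φ₂ y.φ₂ := rfl

theorem norm_sq (x : State 𝕜 P) : ‖x‖ ^ 2 =
    P.ρ₁ * ‖x.U‖ ^ 2 + P.ρ₂ * ‖x.V‖ ^ 2 + P.k₁ * ‖weakDeriv x.u‖ ^ 2
      + P.k₂ * ‖weakDeriv x.v‖ ^ 2 + P.c * ‖x.φ₁‖ ^ 2 + P.c * ‖x.φ₂‖ ^ 2 := by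
  rw [norm_sq_eq, energy]
  ring

section Components

variable {F : Type*} [NormedAddCommGroup F] [NormedSpace 𝕜 F]

/-- A linear map on the energy space that is controlled by the energy. -/
def ofSqLe (f : State 𝕜 P →ₗ[𝕜] F) (k : ℝ) (hk : 0 < k)
    (h : ∀ x, k * ‖f x‖ ^ 2 ≤ ‖x‖ ^ 2) : State 𝕜 P →L[𝕜] F :=
  f.mkContinuous (√k)⁻¹ fun x => by
    have hs : 0 < √k := Real.sqrt_pos.2 hk
    rw [inv_mul_eq_div, le_div_iff₀ hs, mul_comm]
    refine (sq_le_sq₀ (by positivity) (norm_nonneg _)).1 ?_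
    rw [mul_pow, Real.sq_sqrt hk.le]
    exact h x

end Components

theorem energy_nonneg_terms (x : State 𝕜 P) :
    0 ≤ P.ρ₁ * ‖x.U‖ ^ 2 ∧ 0 ≤ P.ρ₂ * ‖x.V‖ ^ 2 ∧ 0 ≤ P.k₁ * ‖weakDeriv x.u‖ ^ 2 ∧
      0 ≤ P.k₂ * ‖weakDeriv x.v‖ ^ 2 ∧ 0 ≤ P.c * ‖x.φ₁‖ ^ 2 ∧ 0 ≤ P.c * ‖x.φ₂‖ ^ 2 := by
  have h1 := P.ρ₁_pos
  have h2 := P.ρ₂_pos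
  have h3 := P.k₁_pos
  have h4 := P.k₂_pos
  have h5 := P.c_pos
  refine ⟨?_, ?_, ?_, ?_, ?_, ?_⟩ <;> positivity

variable (𝕜 P)

/-- The component `U` as a bounded operator. -/
def velU : State 𝕜 P →L[𝕜] L2 𝕜 (-P.L) 0 :=
  ofSqLe ⟨⟨State.U, add_U⟩, smul_U⟩ P.ρ₁ P.ρ₁_pos fun x => by
    obtain ⟨h1, h2, h3, h4, h5, h6⟩ := x.energy_nonneg_terms
    rw [norm_sq]
    change P.ρ₁ * ‖x.U‖ ^ 2 ≤ _
    linarith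

/-- The component `V` as a bounded operator. -/
def velV : State 𝕜 P →L[𝕜] L2 𝕜 0 P.L :=
  ofSqLe ⟨⟨State.V, add_V⟩, smul_V⟩ P.ρ₂ P.ρ₂_pos fun x => by
    obtain ⟨h1, h2, h3, h4, h5, h6⟩ := x.energy_nonneg_terms
    rw [norm_sq]
    change P.ρ₂ * ‖x.V‖ ^ 2 ≤ _
    linarith

/-- The derivative `u'` as a bounded operator. -/
def derivU : State 𝕜 P →L[𝕜] L2 𝕜 (-P.L) 0 :=
  ofSqLe ⟨⟨fun x => weakDeriv x.u, deriv_add_u⟩, deriv_smul_u⟩ P.k₁ P.k₁_pos fun x => by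
    obtain ⟨h1, h2, h3, h4, h5, h6⟩ := x.energy_nonneg_terms
    rw [norm_sq]
    change P.k₁ * ‖weakDeriv x.u‖ ^ 2 ≤ _
    linarith

/-- The derivative `v'` as a bounded operator. -/
def derivV : State 𝕜 P →L[𝕜] L2 𝕜 0 P.L :=
  ofSqLe ⟨⟨fun x => weakDeriv x.v, deriv_add_v⟩, deriv_smul_v⟩ P.k₂ P.k₂_pos fun x => by
    obtain ⟨h1, h2, h3, h4, h5, h6⟩ := x.energy_nonneg_terms
    rw [norm_sq]
    change P.k₂ * ‖weakDeriv x.v‖ ^ 2 ≤ _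
    linarith

/-- The component `φ₁` as a bounded operator. -/
def mem₁ : State 𝕜 P →L[𝕜] Mem 𝕜 (-P.L) 0 :=
  ofSqLe ⟨⟨State.φ₁, add_φ₁⟩, smul_φ₁⟩ P.c P.c_pos fun x => by
    obtain ⟨h1, h2, h3, h4, h5, h6⟩ := x.energy_nonneg_terms
    rw [norm_sq]
    change P.c * ‖x.φ₁‖ ^ 2 ≤ _
    linarith

/-- The component `φ₂` as a bounded operator. -/
def mem₂ : State 𝕜 P →L[𝕜] Mem 𝕜 0 P.L :=
  ofSqLe ⟨⟨State.φ₂, add_φ₂⟩, smul_φ₂⟩ P.c P.c_pos fun x => by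
    obtain ⟨h1, h2, h3, h4, h5, h6⟩ := x.energy_nonneg_terms
    rw [norm_sq]
    change P.c * ‖x.φ₂‖ ^ 2 ≤ _
    linarith

theorem norm_u_le (x : State 𝕜 P) : ‖x.u‖ ≤ 2 * P.L * ‖weakDeriv x.u‖ := by
  obtain ⟨h1, -, f, -, hf, -, hf0, -, -⟩ := x.mem
  have hL := P.L_pos
  have := norm_le_of_contRep_eq_zero (by linarith) h1 hf (left_mem_Icc.2 (by linarith)) hf0
  rwa [sub_neg_eq_add, zero_add] at this

theorem norm_v_le (x : State 𝕜 P) : ‖x.v‖ ≤ 2 * P.L * ‖weakDeriv x.v‖ := by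
  obtain ⟨-, h1, -, f, -, hf, -, hf0, -⟩ := x.mem
  have hL := P.L_pos
  have := norm_le_of_contRep_eq_zero hL h1 hf (right_mem_Icc.2 hL.le) hf0
  rwa [sub_zero] at this

/-- The component `u` as a bounded operator. -/
def posU : State 𝕜 P →L[𝕜] L2 𝕜 (-P.L) 0 :=
  LinearMap.mkContinuous ⟨⟨State.u, add_u⟩, smul_u⟩ (2 * P.L * ‖derivU 𝕜 P‖) fun x => by
    have hL := P.L_pos
    rw [mul_assoc]
    exact (norm_u_le 𝕜 P x).trans (mul_le_mul_of_nonneg_left ((derivU 𝕜 P).le_opNorm x)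
      (by positivity))

/-- The component `v` as a bounded operator. -/
def posV : State 𝕜 P →L[𝕜] L2 𝕜 0 P.L :=
  LinearMap.mkContinuous ⟨⟨State.v, add_v⟩, smul_v⟩ (2 * P.L * ‖derivV 𝕜 P‖) fun x => by
    have hL := P.L_pos
    rw [mul_assoc]
    exact (norm_v_le 𝕜 P x).trans (mul_le_mul_of_nonneg_left ((derivV 𝕜 P).le_opNorm x)
      (by positivity))

variable {𝕜 P}

theorem mem₁_apply (x : State 𝕜 P) : mem₁ 𝕜 P x = x.φ₁ := rfl
theorem mem₂_apply (x : State 𝕜 P) : mem₂ 𝕜 P x = x.φ₂ := rfl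

/-- Pairing with the constant `1` shows that the integral is continuous on `L²`, so the constraint
on the derivatives survives limits. -/
theorem integral_L2_eq_inner {a b : ℝ} (hab : a ≤ b) (g : L2 𝕜 a b) :
    ∫ y in a..b, g y =
      inner 𝕜 ((memLp_const (1 : 𝕜)).toLp (fun _ => 1) : L2 𝕜 a b) g := by
  rw [L2.inner_def, ← setIntegral_Ioo_eq hab]
  refine integral_congr_ae ?_
  filter_upwards [(memLp_const (μ := volume.restrict (Ioo a b)) (p := 2) (1 : 𝕜)).coeFn_toLp]
    with x hx
  rw [hx, RCLike.inner_apply, map_one, mul_one]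

/-- The energy space is complete. -/
instance : CompleteSpace (State 𝕜 P) := by
  have hL := P.L_pos
  refine Metric.complete_of_cauchySeq_tendsto fun x hx => ?_
  have conv : ∀ {F : Type _} [NormedAddCommGroup F] [NormedSpace 𝕜 F] [CompleteSpace F]
      (T : State 𝕜 P →L[𝕜] F), ∃ y, Tendsto (fun n => T (x n)) atTop (𝓝 y) := fun T =>
    cauchySeq_tendsto_of_complete (hx.map T.uniformContinuous)
  obtain ⟨U, hU⟩ := conv (velU 𝕜 P)
  obtain ⟨V, hV⟩ := conv (velV 𝕜 P)
  obtain ⟨g, hg⟩ := conv (derivU 𝕜 P)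
  obtain ⟨h, hh⟩ := conv (derivV 𝕜 P)
  obtain ⟨φ, hφ⟩ := conv (mem₁ 𝕜 P)
  obtain ⟨ψ, hψ⟩ := conv (mem₂ 𝕜 P)
  -- The limits of the derivatives keep total integral zero, hence are the derivatives of some pair
  -- in `ℍ¹₀`; no limit of traces is needed.
  have hgh : (∫ y in (-P.L)..0, g y) + ∫ y in (0 : ℝ)..P.L, h y = 0 := by
    rw [integral_L2_eq_inner (by linarith), integral_L2_eq_inner hL.le]
    refine tendsto_nhds_unique ((tendsto_const_nhds.inner hg).add (tendsto_const_nhds.inner hh))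
      (tendsto_const_nhds.congr fun n => ?_)
    rw [← integral_L2_eq_inner (by linarith), ← integral_L2_eq_inner hL.le]
    exact (integral_add_eq_zero_of_mem_H10 (x n).mem).symm
  obtain ⟨u, v, huv, hu, hv, -⟩ := exists_mem_H10 P g h hgh
  refine ⟨State.mk u v huv U V φ ψ, ?_⟩
  set y : State 𝕜 P := State.mk u v huv U V φ ψ with hy
  have t : ∀ {F : Type _} [NormedAddCommGroup F] [NormedSpace 𝕜 F]
      (T : State 𝕜 P →L[𝕜] F) (k : ℝ), Tendsto (fun n => T (x n)) atTop (𝓝 (T y)) →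
      Tendsto (fun n => k * ‖T (x n - y)‖ ^ 2) atTop (𝓝 0) := by
    intro F _ _ T k hT
    have := ((hT.sub_const (T y)).norm.pow 2).const_mul k
    simpa using this
  have hg' : Tendsto (fun n => derivU 𝕜 P (x n)) atTop (𝓝 (derivU 𝕜 P y)) := by
    rwa [show derivU 𝕜 P y = g from hu.eq]
  have hh' : Tendsto (fun n => derivV 𝕜 P (x n)) atTop (𝓝 (derivV 𝕜 P y)) := by
    rwa [show derivV 𝕜 P y = h from hv.eq]
  have key := (((((t (velU 𝕜 P) P.ρ₁ hU).add (t (velV 𝕜 P) P.ρ₂ hV)).add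
    (t (derivU 𝕜 P) P.k₁ hg')).add (t (derivV 𝕜 P) P.k₂ hh')).add
    (t (mem₁ 𝕜 P) P.c hφ)).add (t (mem₂ 𝕜 P) P.c hψ)
  simp only [add_zero] at key
  rw [tendsto_iff_norm_sub_tendsto_zero]
  have h2 : Tendsto (fun n => ‖x n - y‖ ^ 2) atTop (𝓝 0) :=
    key.congr fun n => (norm_sq (x n - y)).symm
  have h3 := h2.sqrt
  simpa [Real.sqrt_sq] using h3

end State

/-! ### The dissipation identity. -/

section Dissipation

variable {𝕜 : Type*} [RCLike 𝕜] {a b : ℝ}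

theorem integrable_weight_norm_sq (P : Params) {φ : Mem 𝕜 a b}
    (h : MemLp (fun ξ => |ξ| • φ ξ) 2 (volume : Measure ℝ)) :
    Integrable fun ξ : ℝ => (|ξ| ^ 2 + P.η) * ‖φ ξ‖ ^ 2 := by
  have h1 := h.norm.integrable_sq
  have h2 := (Lp.memLp φ).norm.integrable_sq
  refine (h1.add (h2.const_mul P.η)).congr (Eventually.of_forall fun ξ => ?_)
  simp only [Pi.add_apply, norm_smul, Real.norm_eq_abs, abs_abs]
  ring

/-- The source `μ U` tested against `φ` and the damping `∫ μ φ` tested against `U` have the same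
real part and cancel, leaving the diagonal term. -/
theorem re_inner_memRHS (P : Params) {φ : Mem 𝕜 a b} {U : L2 𝕜 a b}
    (hφ : MemLp (fun ξ => |ξ| • φ ξ) 2 (volume : Measure ℝ))
    (hR : MemLp (memRHS P φ U) 2 (volume : Measure ℝ)) :
    RCLike.re (inner 𝕜 (hR.toLp (memRHS P φ U) : Mem 𝕜 a b) φ)
      - RCLike.re (inner 𝕜 (memInt P φ) U) = -∫ ξ : ℝ, (|ξ| ^ 2 + P.η) * ‖φ ξ‖ ^ 2 := by
  have i1 : Integrable (fun ξ => inner 𝕜 ((hR.toLp (memRHS P φ U) : Mem 𝕜 a b) ξ) (φ ξ)) :=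
    L2.integrable_inner _ _
  have i2 := integrable_memInt P hφ
  have i3 : Integrable (fun ξ => inner 𝕜 U (P.μ ξ • φ ξ)) := i2.const_inner U
  rw [inner_re_symm (𝕜 := 𝕜) (memInt P φ) U, memInt, ← integral_inner i2, L2.inner_def,
    ← integral_re i1, ← integral_re i3, ← integral_sub i1.re i3.re, ← integral_neg]
  refine integral_congr_ae ?_
  filter_upwards [hR.coeFn_toLp] with ξ hξ
  rw [hξ, memRHS, inner_add_left, inner_neg_left, RCLike.real_smul_eq_coe_smul (K := 𝕜),
    RCLike.real_smul_eq_coe_smul (K := 𝕜), RCLike.real_smul_eq_coe_smul (K := 𝕜),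
    inner_smul_left, inner_smul_left, inner_smul_right]
  rw [RCLike.conj_ofReal, RCLike.conj_ofReal, map_add, map_neg, RCLike.re_ofReal_mul,
    RCLike.re_ofReal_mul, inner_self_eq_norm_sq]
  ring

/-- The dissipation identity for the operator `𝒜`. -/
theorem re_inner_applyA {P : Params} (x : domA 𝕜 P) :
    RCLike.re (inner 𝕜 (applyA x) x.1) =
      -(P.c * ∫ ξ : ℝ, (|ξ| ^ 2 + P.η) * ‖x.1.φ₁ ξ‖ ^ 2)
      - P.c * ∫ ξ : ℝ, (|ξ| ^ 2 + P.η) * ‖x.1.φ₂ ξ‖ ^ 2 := by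
  have hL := P.L_pos
  obtain ⟨x, hx⟩ := x
  obtain ⟨⟨hU, hV, p, q, hp, hq, hp0, hq0, hpq⟩, hu, hv, ⟨f, g, hf, hg, hfg⟩, h5, h6, h7, h8⟩ := id hx
  simp only
  have r1 := re_inner_memRHS P h5 h6
  have r2 := re_inner_memRHS P h7 h8
  have b1 := inner_weakDeriv_add (by linarith) hu.2 hU hf hp
  have b2 := inner_weakDeriv_add hL hv.2 hV hg hq
  rw [hp0, map_zero, zero_mul, sub_zero] at b1
  rw [hq0, map_zero, zero_mul, zero_sub] at b2
  -- The outer boundary terms vanish with `U(-L) = V(L) = 0`; those at the interface cancel by `U(0)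
  -- = V(0)` and `k₁ u'(0) = k₂ v'(0)`.
  have b : (P.k₁ : 𝕜) * (inner 𝕜 (weakDeriv x.U) (weakDeriv x.u)
      + inner 𝕜 x.U (weakDeriv (weakDeriv x.u)))
      + (P.k₂ : 𝕜) * (inner 𝕜 (weakDeriv x.V) (weakDeriv x.v)
      + inner 𝕜 x.V (weakDeriv (weakDeriv x.v))) = 0 := by
    rw [b1, b2, hpq]
    linear_combination (starRingEnd 𝕜) (q 0) * hfg
  have b' := congrArg RCLike.re b
  simp only [map_add, RCLike.re_ofReal_mul, map_zero] at b'
  rw [inner_re_symm (𝕜 := 𝕜) x.U, inner_re_symm (𝕜 := 𝕜) x.V] at b'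
  have hρ₁ : (P.ρ₁ : 𝕜) ≠ 0 := RCLike.ofReal_ne_zero.2 P.ρ₁_pos.ne'
  have hρ₂ : (P.ρ₂ : 𝕜) ≠ 0 := RCLike.ofReal_ne_zero.2 P.ρ₂_pos.ne'
  have e1 : (P.ρ₁ : 𝕜) * inner 𝕜 (applyA ⟨x, hx⟩).U x.U =
      (P.k₁ : 𝕜) * inner 𝕜 (weakDeriv (weakDeriv x.u)) x.U
        - (P.c : 𝕜) * inner 𝕜 (memInt P x.φ₁) x.U := by
    rw [applyA_U, inner_smul_left, inner_sub_left, inner_smul_left, inner_smul_left,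
      ← RCLike.ofReal_inv]
    simp only [RCLike.conj_ofReal]
    rw [RCLike.ofReal_inv, ← mul_assoc, mul_inv_cancel₀ hρ₁, one_mul]
  have e2 : (P.ρ₂ : 𝕜) * inner 𝕜 (applyA ⟨x, hx⟩).V x.V =
      (P.k₂ : 𝕜) * inner 𝕜 (weakDeriv (weakDeriv x.v)) x.V
        - (P.c : 𝕜) * inner 𝕜 (memInt P x.φ₂) x.V := by
    rw [applyA_V, inner_smul_left, inner_sub_left, inner_smul_left, inner_smul_left,
      ← RCLike.ofReal_inv]
    simp only [RCLike.conj_ofReal]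
    rw [RCLike.ofReal_inv, ← mul_assoc, mul_inv_cancel₀ hρ₂, one_mul]
  rw [State.inner_eq, e1, e2, applyA_u, applyA_v]
  simp only [map_add, map_sub, RCLike.re_ofReal_mul]
  have e3 : (applyA ⟨x, hx⟩).φ₁ = h6.toLp (memRHS P x.φ₁ x.U) := rfl
  have e4 : (applyA ⟨x, hx⟩).φ₂ = h8.toLp (memRHS P x.φ₂ x.V) := rfl
  rw [e3, e4]
  linear_combination b' + P.c * r1 + P.c * r2

end Dissipation

/-! ### The elliptic transmission problem. -/

section Elliptic

/-- The Lax–Milgram argument: coercivity bounds `T` below, so its range is closed; a vector `w`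
orthogonal to the range satisfies `⟪T w, w⟫ = 0`, hence `w = 0`. -/
theorem surjective_of_coercive {𝕜 E : Type*} [RCLike 𝕜] [NormedAddCommGroup E]
    [InnerProductSpace 𝕜 E] [CompleteSpace E] (T : E →L[𝕜] E)
    (hT : ∀ x, ‖x‖ ^ 2 ≤ RCLike.re (inner 𝕜 (T x) x)) : Function.Surjective T := by
  have hb : ∀ x, ‖x‖ ≤ ‖T x‖ := by
    intro x
    rcases eq_or_ne x 0 with rfl | hx
    · simp
    · have hx' : 0 < ‖x‖ := norm_pos_iff.2 hx
      refine le_of_mul_le_mul_right ?_ hx'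
      have := (hT x).trans (re_inner_le_norm _ _)
      nlinarith
  have ha : AntilipschitzWith 1 T :=
    T.antilipschitz_of_bound fun x => by simpa using hb x
  have hc : IsClosed (T.range : Set E) := ha.isClosed_range T.uniformContinuous
  have := hc.completeSpace_coe
  refine LinearMap.range_eq_top (f := (T : E →ₗ[𝕜] E)).1 ?_
  rw [← T.range.orthogonal_orthogonal, Submodule.eq_top_iff']
  intro v w hw
  have h0 : inner 𝕜 (T w) w = 0 := hw _ ⟨w, rfl⟩
  have h1 := hT w
  rw [h0, map_zero] at h1
  have hw0 : w = 0 := norm_eq_zero.1 (pow_eq_zero_iff two_ne_zero |>.1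
    (le_antisymm h1 (sq_nonneg _)))
  rw [hw0, inner_zero_left]

variable {𝕜 : Type*} [RCLike 𝕜] {a b : ℝ}

theorem inner_eq_integral_smul {w : L2 𝕜 a b} {ψ : ℝ → ℝ}
    (h : w =ᵐ[volume.restrict (Ioo a b)] fun x => ((ψ x : ℝ) : 𝕜)) (p : L2 𝕜 a b) :
    inner 𝕜 w p = ∫ x in Ioo a b, ψ x • p x := by
  rw [L2.inner_def]
  refine integral_congr_ae ?_
  filter_upwards [h] with x hx
  rw [hx, RCLike.inner_apply, RCLike.conj_ofReal, RCLike.real_smul_eq_coe_mul, mul_comm]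

/-- A test function is, as the primitive of its derivative, an `H¹` class with zero boundary values,
so the hypothesis covers it. -/
theorem isWeakDeriv_of_forall_inner (hab : a < b) {p G : L2 𝕜 a b}
    (h : ∀ w : L2 𝕜 a b, MemH1 w → (∃ g : ℝ → 𝕜, IsContRep w g ∧ g a = 0 ∧ g b = 0) →
      inner 𝕜 (weakDeriv w) p + inner 𝕜 w G = 0) : IsWeakDeriv p G := by
  intro φ hφ hφc hs
  have φa : φ a = 0 := image_eq_zero_of_notMem_tsupport fun h => (hs h).1.false
  have φb : φ b = 0 := image_eq_zero_of_notMem_tsupport fun h => (hs h).2.false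
  have hd : Continuous (deriv φ) := hφ.continuous_deriv (by simp)
  have hd' : Continuous fun x => ((deriv φ x : ℝ) : 𝕜) := RCLike.continuous_ofReal.comp hd
  obtain ⟨C, hC⟩ := hφc.deriv.exists_bound_of_continuous hd
  have hm : MemLp (fun x => ((deriv φ x : ℝ) : 𝕜)) 2 (volume.restrict (Ioo a b)) :=
    MemLp.of_bound hd'.aestronglyMeasurable C (Eventually.of_forall fun x => by
      rw [RCLike.norm_ofReal]
      exact hC x)
  obtain ⟨w, hw, hwd⟩ := exists_primitive hab.le (0 : 𝕜) (hm.toLp _ : L2 𝕜 a b)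
  have φint : ∀ x ∈ Icc a b, 0 + ∫ y in a..x, (hm.toLp _ : L2 𝕜 a b) y = ((φ x : ℝ) : 𝕜) := by
    intro x hx
    have h1 := intervalIntegral.integral_eq_sub_of_hasDerivAt (a := a) (b := x) (f := φ)
      (f' := deriv φ) (fun y _ => (hφ.differentiable (by simp) y).hasDerivAt)
      (hd.intervalIntegrable _ _)
    rw [φa, sub_zero] at h1
    rw [← h1, zero_add, ← setIntegral_Ioo_eq hx.1]
    have h2 : ∫ y in Ioo a x, (hm.toLp _ : L2 𝕜 a b) y
        = ∫ y in Ioo a x, ((deriv φ y : ℝ) : 𝕜) := by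
      refine integral_congr_ae ?_
      exact ae_mono (Measure.restrict_mono (Ioo_subset_Ioo_right hx.2) le_rfl) hm.coeFn_toLp
    rw [h2, setIntegral_Ioo_eq hx.1]
    exact RCLike.intervalIntegral_ofReal
  have key := h w ⟨_, hwd⟩ ⟨_, hw, by rw [φint a (left_mem_Icc.2 hab.le), φa, RCLike.ofReal_zero],
    by rw [φint b (right_mem_Icc.2 hab.le), φb, RCLike.ofReal_zero]⟩
  rw [hwd.eq, inner_eq_integral_smul hm.coeFn_toLp, inner_eq_integral_smul (ψ := φ)] at key
  · exact eq_neg_of_add_eq_zero_left key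
  · filter_upwards [hw.2, ae_restrict_mem measurableSet_Ioo] with x hx hmx
    rw [hx, φint x (Ioo_subset_Icc_self hmx)]

theorem integral_toLp_const {c : 𝕜} {x : ℝ} (hx : x ∈ Icc a b) :
    ∫ y in a..x, ((memLp_const c).toLp (fun _ => c) : L2 𝕜 a b) y = ((x - a : ℝ) : 𝕜) * c := by
  rw [← setIntegral_Ioo_eq hx.1]
  have h2 : ∫ y in Ioo a x, ((memLp_const c).toLp (fun _ => c) : L2 𝕜 a b) y
      = ∫ _ in Ioo a x, c := by
    refine integral_congr_ae ?_
    exact ae_mono (Measure.restrict_mono (Ioo_subset_Ioo_right hx.2) le_rfl)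
      (memLp_const c).coeFn_toLp
  rw [h2, setIntegral_Ioo_eq hx.1, intervalIntegral.integral_const, RCLike.real_smul_eq_coe_mul]

/-- The elliptic transmission problem `m₁ u - k₁ u'' = F₁`, `m₂ v - k₂ v'' = F₂`. -/
theorem exists_elliptic (P : Params) {m₁ m₂ : ℝ} (hm₁ : 0 ≤ m₁) (hm₂ : 0 ≤ m₂)
    (F₁ : L2 𝕜 (-P.L) 0) (F₂ : L2 𝕜 0 P.L) :
    ∃ (u : L2 𝕜 (-P.L) 0) (v : L2 𝕜 0 P.L), (u, v) ∈ H10 𝕜 P ∧ MemH2 u ∧ MemH2 v ∧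
      (∃ f g : ℝ → 𝕜, IsContRep (weakDeriv u) f ∧ IsContRep (weakDeriv v) g ∧
        (P.k₁ : 𝕜) * f 0 = (P.k₂ : 𝕜) * g 0) ∧
      (P.k₁ : 𝕜) • weakDeriv (weakDeriv u) = (m₁ : 𝕜) • u - F₁ ∧
      (P.k₂ : 𝕜) • weakDeriv (weakDeriv v) = (m₂ : 𝕜) • v - F₂ := by
  have hL := P.L_pos
  have hL' : -P.L < 0 := by linarith
  have hk₁ : (P.k₁ : 𝕜) ≠ 0 := RCLike.ofReal_ne_zero.2 P.k₁_pos.ne'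
  have hk₂ : (P.k₂ : 𝕜) ≠ 0 := RCLike.ofReal_ne_zero.2 P.k₂_pos.ne'
  set p := State.posU 𝕜 P
  set q := State.posV 𝕜 P
  -- The variational form is posed on the whole energy space: the identity supplies the gradient
  -- terms `k₁`, `k₂`, and the adjoint products supply the mass terms. The velocity and memory
  -- components are passive.
  let T : State 𝕜 P →L[𝕜] State 𝕜 P := ContinuousLinearMap.id 𝕜 _
    + (m₁ : 𝕜) • (p.adjoint.comp p) + (m₂ : 𝕜) • (q.adjoint.comp q)
  have hT : ∀ x y, inner 𝕜 y (T x) = inner 𝕜 y x + (m₁ : 𝕜) * inner 𝕜 y.u x.u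
      + (m₂ : 𝕜) * inner 𝕜 y.v x.v := by
    intro x y
    have : T x = x + (m₁ : 𝕜) • p.adjoint (p x) + (m₂ : 𝕜) • q.adjoint (q x) := rfl
    rw [this, inner_add_right, inner_add_right, inner_smul_right, inner_smul_right,
      ContinuousLinearMap.adjoint_inner_right, ContinuousLinearMap.adjoint_inner_right]
    rfl
  obtain ⟨x, hx⟩ := surjective_of_coercive T (fun x => by
    rw [inner_re_symm, hT, map_add, map_add, RCLike.re_ofReal_mul, RCLike.re_ofReal_mul,
      inner_self_eq_norm_sq, inner_self_eq_norm_sq, inner_self_eq_norm_sq]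
    nlinarith [mul_nonneg hm₁ (sq_nonneg ‖x.u‖), mul_nonneg hm₂ (sq_nonneg ‖x.v‖)])
    (p.adjoint F₁ + q.adjoint F₂)
  have weak : ∀ (w : L2 𝕜 (-P.L) 0) (z : L2 𝕜 0 P.L), (w, z) ∈ H10 𝕜 P →
      (P.k₁ : 𝕜) * inner 𝕜 (weakDeriv w) (weakDeriv x.u)
        + (P.k₂ : 𝕜) * inner 𝕜 (weakDeriv z) (weakDeriv x.v)
        + (m₁ : 𝕜) * inner 𝕜 w x.u + (m₂ : 𝕜) * inner 𝕜 z x.v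
        = inner 𝕜 w F₁ + inner 𝕜 z F₂ := by
    intro w z hwz
    set y : State 𝕜 P := State.mk w z hwz 0 0 0 0 with hy
    have h1 := hT x y
    rw [hx, inner_add_right, ContinuousLinearMap.adjoint_inner_right,
      ContinuousLinearMap.adjoint_inner_right, State.inner_eq] at h1
    have e1 : y.u = w := rfl
    have e2 : y.v = z := rfl
    have e3 : y.U = 0 := rfl
    have e4 : y.V = 0 := rfl
    have e5 : y.φ₁ = 0 := rfl
    have e6 : y.φ₂ = 0 := rfl
    have e7 : p y = w := rfl
    have e8 : q y = z := rfl
    rw [e1, e2, e3, e4, e5, e6, e7, e8] at h1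
    simp only [inner_zero_left, mul_zero, zero_add, add_zero] at h1
    exact h1.symm
  -- Test pairs vanishing at the interface can be extended by zero to the other side, which
  -- decouples the two equations.
  have hu : IsWeakDeriv (weakDeriv x.u) ((P.k₁ : 𝕜)⁻¹ • ((m₁ : 𝕜) • x.u - F₁)) := by
    refine isWeakDeriv_of_forall_inner hL' fun w hw ⟨g, hg, hg0, hg1⟩ => ?_
    have := weak w 0 ⟨hw, MemH1.zero, g, fun _ => 0, hg, IsContRep.zero, hg0, rfl, hg1⟩
    simp only [weakDeriv_zero, inner_zero_left, mul_zero, add_zero] at this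
    rw [inner_smul_right, inner_sub_right, inner_smul_right]
    field_simp
    linear_combination this
  have hv : IsWeakDeriv (weakDeriv x.v) ((P.k₂ : 𝕜)⁻¹ • ((m₂ : 𝕜) • x.v - F₂)) := by
    refine isWeakDeriv_of_forall_inner hL fun w hw ⟨g, hg, hg0, hg1⟩ => ?_
    have := weak 0 w ⟨MemH1.zero, hw, fun _ => 0, g, IsContRep.zero, hg, rfl, hg1, hg0.symm⟩
    simp only [weakDeriv_zero, inner_zero_left, mul_zero, add_zero, zero_add] at this
    rw [inner_smul_right, inner_sub_right, inner_smul_right]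
    field_simp
    linear_combination this
  have hu2 : (P.k₁ : 𝕜) • weakDeriv (weakDeriv x.u) = (m₁ : 𝕜) • x.u - F₁ := by
    rw [hu.eq, smul_smul, mul_inv_cancel₀ hk₁, one_smul]
  have hv2 : (P.k₂ : 𝕜) • weakDeriv (weakDeriv x.v) = (m₂ : 𝕜) • x.v - F₂ := by
    rw [hv.eq, smul_smul, mul_inv_cancel₀ hk₂, one_smul]
  refine ⟨x.u, x.v, x.mem, ⟨x.memH1_u, _, hu⟩, ⟨x.memH1_v, _, hv⟩, ?_, hu2, hv2⟩
  obtain ⟨_, hf⟩ := MemH1.exists_contRep hL' ⟨_, hu⟩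
  obtain ⟨_, hg⟩ := MemH1.exists_contRep hL ⟨_, hv⟩
  refine ⟨_, _, hf, hg, ?_⟩
  -- The flux condition is the natural one: test with the hat function of slopes `1` and `-1`, whose
  -- value at the interface is `L ≠ 0`.
  obtain ⟨w, z, hwz, -, -, hwr⟩ := exists_mem_H10 P
    ((memLp_const (1 : 𝕜)).toLp (fun _ => 1)) ((memLp_const (-1 : 𝕜)).toLp (fun _ => -1)) (by
      rw [integral_toLp_const (right_mem_Icc.2 hL'.le),
        integral_toLp_const (right_mem_Icc.2 hL.le)]
      push_cast
      ring)
  have hweak := weak w z hwz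
  obtain ⟨hw, hz, r, s, hr, hs, hr0, hs0, hrs⟩ := hwz
  have hr1 : r 0 = (P.L : 𝕜) := by
    rw [hr.eqOn hL' hwr (right_mem_Icc.2 hL'.le)]
    refine (integral_toLp_const (right_mem_Icc.2 hL'.le)).trans ?_
    push_cast
    ring
  have b1 := inner_weakDeriv_add hL' ⟨_, hu⟩ hw hf hr
  have b2 := inner_weakDeriv_add hL ⟨_, hv⟩ hz hg hs
  simp only [hr0, map_zero, zero_mul, sub_zero] at b1
  simp only [hs0, map_zero, zero_mul, zero_sub] at b2
  have c1 : (P.k₁ : 𝕜) * inner 𝕜 w (weakDeriv (weakDeriv x.u)) =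
      (m₁ : 𝕜) * inner 𝕜 w x.u - inner 𝕜 w F₁ := by
    rw [← inner_smul_right, hu2, inner_sub_right, inner_smul_right]
  have c2 : (P.k₂ : 𝕜) * inner 𝕜 z (weakDeriv (weakDeriv x.v)) =
      (m₂ : 𝕜) * inner 𝕜 z x.v - inner 𝕜 z F₂ := by
    rw [← inner_smul_right, hv2, inner_sub_right, inner_smul_right]
  have hL0 : (P.L : 𝕜) ≠ 0 := RCLike.ofReal_ne_zero.2 hL.ne'
  rw [← hrs, hr1, RCLike.conj_ofReal] at b2
  rw [hr1, RCLike.conj_ofReal] at b1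
  refine mul_left_cancel₀ hL0 ?_
  linear_combination hweak + c1 + c2 - (P.k₁ : 𝕜) * b1 - (P.k₂ : 𝕜) * b2

end Elliptic

/-! ### The resolvent equation and maximality. -/

section Resolvent

theorem Params.measurable_μ (P : Params) : Measurable P.μ := by
  unfold Params.μ
  fun_prop

theorem Params.μ_nonneg (P : Params) (ξ : ℝ) : 0 ≤ P.μ ξ := Real.rpow_nonneg (abs_nonneg ξ) _

/-- One has `(1 + |ξ|)² ≤ 2 + 2 |ξ|²`, and `2 / l` times `l` pays for the constant `2`. This reduces
resolvent weights to the square integrable `μ / (1 + |ξ|)`. -/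
theorem Params.one_add_abs_sq_le (P : Params) {l : ℝ} (hl : 0 < l) (ξ : ℝ) :
    (1 + |ξ|) ^ 2 ≤ (2 + 2 / l) * (l + (|ξ| ^ 2 + P.η)) := by
  have h1 : (2 + 2 / l) * (l + (|ξ| ^ 2 + P.η)) =
      2 * l + 2 * |ξ| ^ 2 + 2 * P.η + 2 + 2 / l * (|ξ| ^ 2 + P.η) := by
    field_simp
    ring
  have h2 : 0 ≤ 2 / l * (|ξ| ^ 2 + P.η) := by
    have := P.η_nonneg
    positivity
  rw [h1]
  nlinarith [sq_nonneg (1 - |ξ|), P.η_nonneg]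

theorem Params.denom_pos (P : Params) {l : ℝ} (hl : 0 < l) (ξ : ℝ) :
    0 < l + (|ξ| ^ 2 + P.η) := by
  have := P.η_nonneg
  positivity

theorem memLp_weight (P : Params) :
    MemLp (fun ξ => P.μ ξ / (1 + |ξ|)) 2 (volume : Measure ℝ) :=
  (memLp_two_iff_integrable_sq (P.measurable_μ.div (by fun_prop)).aestronglyMeasurable).2
    (integrable_weight P)

variable {𝕜 : Type*} [RCLike 𝕜] {a b : ℝ}

/-- The extra factor `1 + |ξ|` in the numerator makes this one function dominate both `φ` and `|ξ|
φ` for the resolvent solution `φ`. -/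
theorem memLp_resolvent (P : Params) {l : ℝ} (hl : 0 < l) (U : L2 𝕜 a b) (f : Mem 𝕜 a b) :
    MemLp (fun ξ => ((1 + |ξ|) / (l + (|ξ| ^ 2 + P.η))) • (P.μ ξ • U + f ξ)) 2
      (volume : Measure ℝ) := by
  have hm : Measurable fun ξ : ℝ => (1 + |ξ|) / (l + (|ξ| ^ 2 + P.η)) := by fun_prop
  have h1 : MemLp (fun ξ => ((1 + |ξ|) / (l + (|ξ| ^ 2 + P.η))) • P.μ ξ • U) 2
      (volume : Measure ℝ) := by
    refine (memLp_weight P).of_le_mul (c := (2 + 2 / l) * ‖U‖)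
      (hm.aestronglyMeasurable.smul (P.measurable_μ.aestronglyMeasurable.smul_const U))
      (Eventually.of_forall fun ξ => ?_)
    have hd := P.denom_pos hl ξ
    have hμ := P.μ_nonneg ξ
    have ha : 0 < 1 + |ξ| := by positivity
    rw [norm_smul, norm_smul, Real.norm_of_nonneg (by positivity), Real.norm_of_nonneg hμ,
      Real.norm_of_nonneg (by positivity)]
    have h2 : (1 + |ξ|) / (l + (|ξ| ^ 2 + P.η)) ≤ (2 + 2 / l) * (1 / (1 + |ξ|)) := by
      rw [mul_one_div, div_le_div_iff₀ hd ha, ← sq]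
      exact P.one_add_abs_sq_le hl ξ
    calc (1 + |ξ|) / (l + (|ξ| ^ 2 + P.η)) * (P.μ ξ * ‖U‖)
        ≤ (2 + 2 / l) * (1 / (1 + |ξ|)) * (P.μ ξ * ‖U‖) :=
          mul_le_mul_of_nonneg_right h2 (by positivity)
      _ = (2 + 2 / l) * ‖U‖ * (P.μ ξ / (1 + |ξ|)) := by ring
  have h2 : MemLp (fun ξ => ((1 + |ξ|) / (l + (|ξ| ^ 2 + P.η))) • f ξ) 2
      (volume : Measure ℝ) := by
    refine (Lp.memLp f).of_le_mul (c := 2 + 2 / l)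
      (hm.aestronglyMeasurable.smul (Lp.aestronglyMeasurable f))
      (Eventually.of_forall fun ξ => ?_)
    have hd := P.denom_pos hl ξ
    rw [norm_smul, Real.norm_of_nonneg (by positivity)]
    refine mul_le_mul_of_nonneg_right ?_ (norm_nonneg _)
    rw [div_le_iff₀ hd]
    refine le_trans ?_ (P.one_add_abs_sq_le hl ξ)
    nlinarith [abs_nonneg ξ]
  refine (h1.add h2).congr_norm ?_ (Eventually.of_forall fun ξ => ?_)
  · exact hm.aestronglyMeasurable.smul
      ((P.measurable_μ.aestronglyMeasurable.smul_const U).add (Lp.aestronglyMeasurable f))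
  · simp only [Pi.add_apply, smul_add]

theorem integrable_memory_kernel (P : Params) {l : ℝ} (hl : 0 < l) :
    Integrable fun ξ : ℝ => P.μ ξ ^ 2 / (l + (|ξ| ^ 2 + P.η)) := by
  have hm := P.measurable_μ
  refine Integrable.mono' ((integrable_weight P).const_mul (2 + 2 / l))
    (by fun_prop : Measurable fun ξ : ℝ =>
      P.μ ξ ^ 2 / (l + (|ξ| ^ 2 + P.η))).aestronglyMeasurable
    (Eventually.of_forall fun ξ => ?_)
  have hd := P.denom_pos hl ξ
  have ha : 0 < 1 + |ξ| := by positivity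
  rw [Real.norm_of_nonneg (by positivity), div_pow, mul_div_assoc', div_le_div_iff₀ hd (by positivity)]
  have := mul_le_mul_of_nonneg_left (P.one_add_abs_sq_le hl ξ) (sq_nonneg (P.μ ξ))
  linarith

/-- Solution of the diffusion equation `(l + |ξ|² + η) φ = μ U + f` and the resulting damping
term. -/
theorem exists_memory (P : Params) {l : ℝ} (hl : 0 < l) (f : Mem 𝕜 a b) :
    ∃ g : L2 𝕜 a b, ∀ U : L2 𝕜 a b, ∃ φ : Mem 𝕜 a b,
      MemLp (fun ξ => |ξ| • φ ξ) 2 (volume : Measure ℝ) ∧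
      (∃ hR : MemLp (memRHS P φ U) 2 (volume : Measure ℝ),
        (l : 𝕜) • φ - hR.toLp (memRHS P φ U) = f) ∧
      memInt P φ = ((∫ ξ : ℝ, P.μ ξ ^ 2 / (l + (|ξ| ^ 2 + P.η)) : ℝ) : 𝕜) • U + g := by
  -- This part of the damping depends on `f` alone; it is fixed before `U` because it enters the
  -- data of the elliptic problem that determines `U`.
  refine ⟨∫ ξ, (P.μ ξ / (l + (|ξ| ^ 2 + P.η))) • f ξ, fun U => ?_⟩
  have hbig := memLp_resolvent P hl U f
  have hm : Measurable fun ξ : ℝ => (l + (|ξ| ^ 2 + P.η))⁻¹ := by fun_prop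
  have hsm : AEStronglyMeasurable (fun ξ => P.μ ξ • U + f ξ) volume :=
    (P.measurable_μ.aestronglyMeasurable.smul_const U).add (Lp.aestronglyMeasurable f)
  have hmem : MemLp (fun ξ => (l + (|ξ| ^ 2 + P.η))⁻¹ • (P.μ ξ • U + f ξ)) 2
      (volume : Measure ℝ) := by
    refine hbig.mono (hm.aestronglyMeasurable.smul hsm) (Eventually.of_forall fun ξ => ?_)
    have hd := P.denom_pos hl ξ
    rw [norm_smul, norm_smul, Real.norm_of_nonneg (by positivity),
      Real.norm_of_nonneg (by positivity), div_eq_mul_inv]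
    refine mul_le_mul_of_nonneg_right ?_ (norm_nonneg _)
    exact le_mul_of_one_le_left (inv_nonneg.2 hd.le) (by linarith [abs_nonneg ξ])
  set φ : Mem 𝕜 a b := hmem.toLp _ with hφ
  have hφe := hmem.coeFn_toLp
  rw [← hφ] at hφe
  have h1 : MemLp (fun ξ => |ξ| • φ ξ) 2 (volume : Measure ℝ) := by
    refine hbig.mono (measurable_id.abs.aestronglyMeasurable.smul (Lp.aestronglyMeasurable φ)) ?_
    filter_upwards [hφe] with ξ hξ
    have hd := P.denom_pos hl ξ
    rw [hξ, norm_smul, norm_smul, norm_smul, Real.norm_of_nonneg (by positivity),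
      Real.norm_of_nonneg (by positivity), Real.norm_of_nonneg (by positivity), ← mul_assoc,
      div_eq_mul_inv]
    refine mul_le_mul_of_nonneg_right ?_ (norm_nonneg _)
    exact mul_le_mul_of_nonneg_right (by linarith [abs_nonneg ξ]) (inv_nonneg.2 hd.le)
  have h2 : memRHS P φ U =ᵐ[volume] fun ξ => (l : ℝ) • φ ξ - f ξ := by
    filter_upwards [hφe] with ξ hξ
    have hd := P.denom_pos hl ξ
    have e : (l + (|ξ| ^ 2 + P.η)) • φ ξ = P.μ ξ • U + f ξ := by
      rw [hξ, smul_smul, mul_inv_cancel₀ hd.ne', one_smul]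
    rw [memRHS]
    rw [add_smul] at e
    rw [neg_add_eq_sub, sub_eq_sub_iff_add_eq_add, ← e]
  have hR : MemLp (memRHS P φ U) 2 (volume : Measure ℝ) :=
    (((Lp.memLp φ).const_smul l).sub (Lp.memLp f)).ae_eq h2.symm
  refine ⟨φ, h1, ⟨hR, ?_⟩, ?_⟩
  · refine Lp.ext ?_
    filter_upwards [Lp.coeFn_sub ((l : 𝕜) • φ) (hR.toLp (memRHS P φ U)),
      Lp.coeFn_smul (l : 𝕜) φ, hR.coeFn_toLp, h2] with ξ e1 e2 e3 e4
    rw [e1, Pi.sub_apply, e2, e3, e4, Pi.smul_apply, RCLike.real_smul_eq_coe_smul (K := 𝕜)]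
    abel
  · have i1 := integrable_memInt P h1
    have i2 := (integrable_memory_kernel P hl).smul_const U
    have e : (fun ξ => P.μ ξ • φ ξ) =ᵐ[volume] fun ξ =>
        (P.μ ξ ^ 2 / (l + (|ξ| ^ 2 + P.η))) • U + (P.μ ξ / (l + (|ξ| ^ 2 + P.η))) • f ξ := by
      filter_upwards [hφe] with ξ hξ
      rw [hξ, smul_add, smul_add, smul_smul, smul_smul, smul_smul]
      congr 2
      ring
    have i3 : Integrable fun ξ => (P.μ ξ / (l + (|ξ| ^ 2 + P.η))) • f ξ := by
      refine (i1.sub i2).congr ?_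
      filter_upwards [e] with ξ hξ
      rw [Pi.sub_apply, hξ, add_sub_cancel_left]
    rw [memInt, integral_congr_ae e, integral_add i2 i3, integral_smul_const,
      RCLike.real_smul_eq_coe_smul (K := 𝕜)]

theorem mem_graph_opA {P : Params} (x : domA 𝕜 P) : (x.1, applyA x) ∈ (opA 𝕜 P).graph :=
  LinearPMap.mem_graph (opA 𝕜 P) x

theorem exists_of_mem_graph_opA {P : Params} {x y : State 𝕜 P} (h : (x, y) ∈ (opA 𝕜 P).graph) :
    ∃ hx : x ∈ domA 𝕜 P, applyA ⟨x, hx⟩ = y := exists_apply_eq_of_mem_graph h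

/-- The operator `𝒜` is `m`-dissipative. -/
theorem isMaxDissipative_opA (P : Params) : IsMaxDissipative (opA 𝕜 P) where
  dissipative x y h := by
    obtain ⟨hx, rfl⟩ := exists_of_mem_graph_opA h
    rw [re_inner_applyA ⟨x, hx⟩]
    have hη := P.η_nonneg
    have hc := P.c_pos
    have h1 : 0 ≤ ∫ ξ : ℝ, (|ξ| ^ 2 + P.η) * ‖x.φ₁ ξ‖ ^ 2 :=
      integral_nonneg fun ξ => by positivity
    have h2 : 0 ≤ ∫ ξ : ℝ, (|ξ| ^ 2 + P.η) * ‖x.φ₂ ξ‖ ^ 2 :=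
      integral_nonneg fun ξ => by positivity
    nlinarith [mul_nonneg hc.le h1, mul_nonneg hc.le h2]
  surjective l hl y := by
    have hc := P.c_pos
    have hρ₁ : (P.ρ₁ : 𝕜) ≠ 0 := RCLike.ofReal_ne_zero.2 P.ρ₁_pos.ne'
    have hρ₂ : (P.ρ₂ : 𝕜) ≠ 0 := RCLike.ofReal_ne_zero.2 P.ρ₂_pos.ne'
    set κ : ℝ := ∫ ξ : ℝ, P.μ ξ ^ 2 / (l + (|ξ| ^ 2 + P.η)) with hκ
    have hκ0 : 0 ≤ κ := integral_nonneg fun ξ => div_nonneg (sq_nonneg _) (P.denom_pos hl ξ).le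
    obtain ⟨g₁, hg₁⟩ := exists_memory P hl y.φ₁
    obtain ⟨g₂, hg₂⟩ := exists_memory P hl y.φ₂
    have hn₁ : 0 ≤ P.ρ₁ * l + P.c * κ := by
      have := P.ρ₁_pos
      positivity
    have hn₂ : 0 ≤ P.ρ₂ * l + P.c * κ := by
      have := P.ρ₂_pos
      positivity
    -- Substituting `U = l u - y.u` and `∫ μ φ₁ = κ U + g₁` into the momentum equation, multiplied
    -- by `ρ₁`, produces the zeroth-order coefficient `(ρ₁ l + 𝔠 κ) l` and this right-hand side;
    -- likewise for `v`.
    obtain ⟨u, v, huv, hu, hv, hflux, eu, ev⟩ := exists_elliptic P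
      (mul_nonneg hn₁ hl.le) (mul_nonneg hn₂ hl.le)
      (((P.ρ₁ * l + P.c * κ : ℝ) : 𝕜) • y.u - (P.c : 𝕜) • g₁ + (P.ρ₁ : 𝕜) • y.U)
      (((P.ρ₂ * l + P.c * κ : ℝ) : 𝕜) • y.v - (P.c : 𝕜) • g₂ + (P.ρ₂ : 𝕜) • y.V)
    obtain ⟨φ, hφ1, ⟨hφ2, hφ3⟩, hφ4⟩ := hg₁ ((l : 𝕜) • u - y.u)
    obtain ⟨ψ, hψ1, ⟨hψ2, hψ3⟩, hψ4⟩ := hg₂ ((l : 𝕜) • v - y.v)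
    have hUV : ((l : 𝕜) • u - y.u, (l : 𝕜) • v - y.v) ∈ H10 𝕜 P :=
      (H10 𝕜 P).sub_mem ((H10 𝕜 P).smul_mem (l : 𝕜) huv) y.mem
    set x : State 𝕜 P := State.mk u v huv ((l : 𝕜) • u - y.u) ((l : 𝕜) • v - y.v) φ ψ with hx
    have hxd : x ∈ domA 𝕜 P := ⟨hUV, hu, hv, hflux, hφ1, hφ2, hψ1, hψ2⟩
    refine ⟨x, _, mem_graph_opA ⟨x, hxd⟩, sub_eq_iff_eq_add.2 (State.ext ?_ ?_ ?_ ?_ ?_ ?_)⟩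
    · rw [State.smul_u, State.add_u, applyA_u]
      exact (add_sub_cancel _ _).symm
    · rw [State.smul_v, State.add_v, applyA_v]
      exact (add_sub_cancel _ _).symm
    · rw [State.smul_U, State.add_U, applyA_U]
      change (l : 𝕜) • ((l : 𝕜) • u - y.u) = y.U + (P.ρ₁ : 𝕜)⁻¹ •
        ((P.k₁ : 𝕜) • weakDeriv (weakDeriv u) - (P.c : 𝕜) • memInt P φ)
      rw [eu, hφ4]
      push_cast
      match_scalars <;> field_simp <;> ring
    · rw [State.smul_V, State.add_V, applyA_V]
      change (l : 𝕜) • ((l : 𝕜) • v - y.v) = y.V + (P.ρ₂ : 𝕜)⁻¹ •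
        ((P.k₂ : 𝕜) • weakDeriv (weakDeriv v) - (P.c : 𝕜) • memInt P ψ)
      rw [ev, hψ4]
      push_cast
      match_scalars <;> field_simp <;> ring
    · exact sub_eq_iff_eq_add.1 hφ3
    · exact sub_eq_iff_eq_add.1 hψ3

end Resolvent

/-! ### Regularity of the memory variable with zero initial value. -/

section Memory

variable {𝕜 : Type*} [RCLike 𝕜] {a b : ℝ}

/-- Multiplication by a bounded function. -/
theorem exists_mul {r : ℝ → ℝ} (hr : Measurable r) {C : ℝ} (hC : ∀ ξ, |r ξ| ≤ C) :
    ∃ M : Mem 𝕜 a b →L[𝕜] Mem 𝕜 a b, ∀ φ : Mem 𝕜 a b, M φ =ᵐ[volume] fun ξ => r ξ • φ ξ := by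
  have hm : ∀ φ : Mem 𝕜 a b, MemLp (fun ξ => r ξ • φ ξ) 2 (volume : Measure ℝ) := fun φ =>
    (Lp.memLp φ).of_le_mul (hr.aestronglyMeasurable.smul (Lp.aestronglyMeasurable φ))
      (Eventually.of_forall fun ξ => by
        rw [norm_smul]
        exact mul_le_mul_of_nonneg_right (hC ξ) (norm_nonneg _))
  let M₀ : Mem 𝕜 a b →ₗ[𝕜] Mem 𝕜 a b :=
    { toFun := fun φ => (hm φ).toLp _
      map_add' := fun φ ψ => by
        refine Lp.ext ?_
        filter_upwards [(hm (φ + ψ)).coeFn_toLp, (hm φ).coeFn_toLp, (hm ψ).coeFn_toLp,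
          Lp.coeFn_add φ ψ, Lp.coeFn_add ((hm φ).toLp _) ((hm ψ).toLp _)] with ξ h1 h2 h3 h4 h5
        rw [h1, h5, Pi.add_apply, h2, h3, h4, Pi.add_apply, smul_add]
      map_smul' := fun c φ => by
        refine Lp.ext ?_
        filter_upwards [(hm (c • φ)).coeFn_toLp, (hm φ).coeFn_toLp,
          Lp.coeFn_smul c φ, Lp.coeFn_smul c ((hm φ).toLp _)] with ξ h1 h2 h4 h5
        rw [h1, RingHom.id_apply, h5, Pi.smul_apply, h2, h4, Pi.smul_apply, smul_comm] }
  refine ⟨M₀.mkContinuous C fun φ => Lp.norm_le_mul_norm_of_ae_le_mul ?_,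
    fun φ => (hm φ).coeFn_toLp⟩
  filter_upwards [(hm φ).coeFn_toLp] with ξ h
  change ‖((hm φ).toLp _ : Mem 𝕜 a b) ξ‖ ≤ _
  rw [h, norm_smul]
  exact mul_le_mul_of_nonneg_right (hC ξ) (norm_nonneg _)

theorem re_inner_of_ae {φ ψ₁ ψ₂ : Mem 𝕜 a b} {r₁ r₂ : ℝ → ℝ}
    (h₁ : ψ₁ =ᵐ[volume] fun ξ => r₁ ξ • φ ξ) (h₂ : ψ₂ =ᵐ[volume] fun ξ => r₂ ξ • φ ξ) :
    RCLike.re (inner 𝕜 ψ₁ ψ₂) = ∫ ξ, r₁ ξ * r₂ ξ * ‖φ ξ‖ ^ 2 := by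
  rw [L2.inner_def, ← integral_re (L2.integrable_inner (𝕜 := 𝕜) ψ₁ ψ₂)]
  refine integral_congr_ae ?_
  filter_upwards [h₁, h₂] with ξ e1 e2
  rw [e1, e2, RCLike.real_smul_eq_coe_smul (K := 𝕜), RCLike.real_smul_eq_coe_smul (K := 𝕜),
    inner_smul_left, inner_smul_right, RCLike.conj_ofReal, RCLike.re_ofReal_mul,
    RCLike.re_ofReal_mul, inner_self_eq_norm_sq, mul_assoc]

theorem norm_sq_of_ae {φ ψ : Mem 𝕜 a b} {r : ℝ → ℝ}
    (h : ψ =ᵐ[volume] fun ξ => r ξ • φ ξ) : ‖ψ‖ ^ 2 = ∫ ξ, r ξ ^ 2 * ‖φ ξ‖ ^ 2 := by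
  rw [← inner_self_eq_norm_sq (𝕜 := 𝕜), re_inner_of_ae h h]
  simp only [sq]

theorem norm_sq_eq_integral (ψ : Mem 𝕜 a b) : ‖ψ‖ ^ 2 = ∫ ξ, ‖ψ ξ‖ ^ 2 := by
  have := norm_sq_of_ae (φ := ψ) (ψ := ψ) (r := fun _ => 1)
    (Eventually.of_forall fun ξ => (one_smul ℝ _).symm)
  simpa using this

theorem norm_sq_tensor {h : ℝ → ℝ} {U : L2 𝕜 a b} {ψ : Mem 𝕜 a b}
    (e : ψ =ᵐ[volume] fun ξ => h ξ • U) : ‖ψ‖ ^ 2 = (∫ ξ, h ξ ^ 2) * ‖U‖ ^ 2 := by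
  rw [norm_sq_eq_integral, ← integral_mul_const]
  refine integral_congr_ae ?_
  filter_upwards [e] with ξ hξ
  rw [hξ, norm_smul, mul_pow, Real.norm_eq_abs, sq_abs]

theorem exists_tensor {h : ℝ → ℝ} (hh : MemLp h 2 (volume : Measure ℝ)) :
    ∃ N : L2 𝕜 a b →L[𝕜] Mem 𝕜 a b, ∀ U : L2 𝕜 a b, N U =ᵐ[volume] fun ξ => h ξ • U := by
  have hm : ∀ U : L2 𝕜 a b, MemLp (fun ξ => h ξ • U) 2 (volume : Measure ℝ) := fun U =>
    hh.of_le_mul (c := ‖U‖) (hh.aestronglyMeasurable.smul_const U)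
      (Eventually.of_forall fun ξ => by rw [norm_smul, mul_comm])
  let N₀ : L2 𝕜 a b →ₗ[𝕜] Mem 𝕜 a b :=
    { toFun := fun U => (hm U).toLp _
      map_add' := fun U V => by
        refine Lp.ext ?_
        filter_upwards [(hm (U + V)).coeFn_toLp, (hm U).coeFn_toLp, (hm V).coeFn_toLp,
          Lp.coeFn_add ((hm U).toLp _) ((hm V).toLp _)] with ξ h1 h2 h3 h5
        rw [h1, h5, Pi.add_apply, h2, h3, smul_add]
      map_smul' := fun c U => by
        refine Lp.ext ?_
        filter_upwards [(hm (c • U)).coeFn_toLp, (hm U).coeFn_toLp,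
          Lp.coeFn_smul c ((hm U).toLp _)] with ξ h1 h2 h5
        rw [h1, RingHom.id_apply, h5, Pi.smul_apply, h2, smul_comm] }
  refine ⟨N₀.mkContinuous (√(∫ ξ, h ξ ^ 2)) fun U => ?_, fun U => (hm U).coeFn_toLp⟩
  have h0 : 0 ≤ ∫ ξ, h ξ ^ 2 := integral_nonneg fun ξ => sq_nonneg _
  refine (sq_le_sq₀ (norm_nonneg _) (by positivity)).1 ?_
  rw [mul_pow, Real.sq_sqrt h0]
  exact (norm_sq_tensor (hm U).coeFn_toLp).le

/-- `φ` solves `φ' = -(|ξ|² + η) φ + μ U`, `φ(0) = 0`, in integrated form. -/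
structure IsMemorySolution (P : Params) (φ : ℝ → Mem 𝕜 a b) (U : ℝ → L2 𝕜 a b) : Prop where
  cont : ContinuousOn φ (Ici 0)
  cont' : ContinuousOn U (Ici 0)
  eq : ∀ t, 0 ≤ t → φ t =ᵐ[volume] memRHS P (∫ s in (0 : ℝ)..t, φ s) (∫ s in (0 : ℝ)..t, U s)

variable {P : Params} {φ : ℝ → Mem 𝕜 a b} {U : ℝ → L2 𝕜 a b}

/-- On `s` the damping rate is at least `c`, so the norm of `1_s φ` cannot exceed `m K / c`, where
`m` is the `L²` norm of `1_s μ`. The upper bound `Q` only makes the truncated operators bounded and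
does not enter the estimate. -/
theorem IsMemorySolution.setIntegral_norm_sq_le (hφ : IsMemorySolution P φ U) {s : Set ℝ}
    (hs : MeasurableSet s) {c Q : ℝ} (hc : 0 < c)
    (hsc : ∀ ξ ∈ s, c ≤ |ξ| ^ 2 + P.η ∧ |ξ| ^ 2 + P.η ≤ Q) {T K : ℝ} (hT : 0 ≤ T)
    (hK : ∀ t ∈ Icc 0 T, ‖U t‖ ≤ K) :
    ∫ ξ in s, ‖φ T ξ‖ ^ 2 ≤ K ^ 2 / c ^ 2 * ∫ ξ in s, P.μ ξ ^ 2 := by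
  have hη := P.η_nonneg
  have hK0 : 0 ≤ K := (norm_nonneg _).trans (hK 0 (left_mem_Icc.2 hT))
  have m0 : Measurable (s.indicator fun _ => (1 : ℝ)) := measurable_const.indicator hs
  have m1 : Measurable (s.indicator fun ξ : ℝ => |ξ| ^ 2 + P.η - c) :=
    (by fun_prop : Measurable fun ξ : ℝ => |ξ| ^ 2 + P.η - c).indicator hs
  have hμm := P.measurable_μ
  have m2 : Measurable (s.indicator P.μ) := hμm.indicator hs
  obtain ⟨M, hM⟩ := exists_mul (𝕜 := 𝕜) (a := a) (b := b) m0 (C := 1) (fun ξ => by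
    by_cases h : ξ ∈ s <;> simp [h])
  obtain ⟨B, hB⟩ := exists_mul (𝕜 := 𝕜) (a := a) (b := b) m1 (C := |Q|) (fun ξ => by
    by_cases h : ξ ∈ s
    · rw [indicator_of_mem h, abs_of_nonneg (sub_nonneg.2 (hsc ξ h).1)]
      exact le_trans (by linarith [(hsc ξ h).2]) (le_abs_self Q)
    · rw [indicator_of_notMem h, abs_zero]
      exact abs_nonneg Q)
  have hmem : MemLp (s.indicator P.μ) 2 (volume : Measure ℝ) := by
    refine (memLp_weight P).of_le_mul (c := 2 + |Q|) m2.aestronglyMeasurable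
      (Eventually.of_forall fun ξ => ?_)
    have hμ := P.μ_nonneg ξ
    by_cases h : ξ ∈ s
    · have h2 := (hsc ξ h).2.trans (le_abs_self Q)
      rw [indicator_of_mem h, Real.norm_of_nonneg hμ, Real.norm_of_nonneg (by positivity),
        mul_div_assoc', le_div_iff₀ (by positivity), mul_comm]
      refine mul_le_mul_of_nonneg_right ?_ hμ
      nlinarith [sq_nonneg (1 - |ξ|), abs_nonneg ξ]
    · rw [indicator_of_notMem h, norm_zero]
      positivity
  obtain ⟨N, hN⟩ := exists_tensor (𝕜 := 𝕜) (a := a) (b := b) hmem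
  set m : ℝ := √(∫ ξ in s, P.μ ξ ^ 2) with hm
  have hm0 : 0 ≤ ∫ ξ in s, P.μ ξ ^ 2 := integral_nonneg fun ξ => sq_nonneg _
  have hmsq : ∫ ξ, s.indicator P.μ ξ ^ 2 = m ^ 2 := by
    rw [hm, Real.sq_sqrt hm0, ← integral_indicator hs]
    refine integral_congr_ae (Eventually.of_forall fun ξ => ?_)
    by_cases h : ξ ∈ s <;> simp [h]
  have hNle : ∀ V : L2 𝕜 a b, ‖N V‖ ≤ m * ‖V‖ := by
    intro V
    refine (sq_le_sq₀ (norm_nonneg _) (by positivity)).1 ?_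
    rw [norm_sq_tensor (hN V), hmsq, mul_pow]
  -- With `B` the excess of `|ξ|² + η` over `c`, the truncated equation involves only bounded
  -- operators and can be differentiated in time.
  have hy : ∀ t, 0 ≤ t → M (φ t) = -(B (∫ r in (0 : ℝ)..t, φ r))
      - (c : ℝ) • M (∫ r in (0 : ℝ)..t, φ r) + N (∫ r in (0 : ℝ)..t, U r) := by
    intro t ht
    set Φ := ∫ r in (0 : ℝ)..t, φ r
    set Υ := ∫ r in (0 : ℝ)..t, U r
    refine Lp.ext ?_
    filter_upwards [hM (φ t), hφ.eq t ht, hM Φ, hB Φ, hN Υ,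
      Lp.coeFn_add (-(B Φ) - (c : ℝ) • M Φ) (N Υ), Lp.coeFn_sub (-(B Φ)) ((c : ℝ) • M Φ),
      Lp.coeFn_neg (B Φ), Lp.coeFn_smul (c : ℝ) (M Φ)] with ξ e1 e2 e3 e4 e5 e6 e7 e8 e9
    rw [e1, e2, e6, Pi.add_apply, e7, Pi.sub_apply, e8, Pi.neg_apply, e9, Pi.smul_apply, e3, e4,
      e5, memRHS]
    by_cases h : ξ ∈ s
    · simp only [indicator_of_mem h]
      module
    · simp only [indicator_of_notMem h]
      module
  have hyd : ∀ t, 0 ≤ t → HasDerivWithinAt (fun t => M (φ t))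
      (-(B (φ t)) - (c : ℝ) • M (φ t) + N (U t)) (Ici 0) t := by
    intro t ht
    have dΦ := hasDerivWithinAt_integral_Ici hφ.cont ht
    have dΥ := hasDerivWithinAt_integral_Ici hφ.cont' ht
    have d1 := ((B.restrictScalars ℝ).hasFDerivAt.comp_hasDerivWithinAt t dΦ).neg
    have d2 := ((M.restrictScalars ℝ).hasFDerivAt.comp_hasDerivWithinAt t dΦ).const_smul (c : ℝ)
    have d3 := (N.restrictScalars ℝ).hasFDerivAt.comp_hasDerivWithinAt t dΥ
    exact ((d1.sub d2).add d3).congr (fun r hr => hy r hr) (hy t ht)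
  have hfin : ∫ ξ in s, ‖φ T ξ‖ ^ 2 = ‖M (φ T)‖ ^ 2 := by
    rw [norm_sq_of_ae (hM (φ T)), ← integral_indicator hs]
    refine integral_congr_ae (Eventually.of_forall fun ξ => ?_)
    by_cases h : ξ ∈ s <;> simp [h]
  have hrhs : K ^ 2 / c ^ 2 * ∫ ξ in s, P.μ ξ ^ 2 = (m * K / c) ^ 2 := by
    rw [div_pow, mul_pow, hm, Real.sq_sqrt hm0]
    ring
  rw [hfin, hrhs]
  -- A strictly larger level `D` serves as barrier: wherever `‖M φ‖² = D`, its derivative is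
  -- negative.
  refine le_of_forall_gt_imp_ge_of_dense fun D hD => ?_
  have hD0 : 0 < D := (sq_nonneg _).trans_lt hD
  have hsqrt : m * K / c < √D := Real.lt_sqrt_of_sq_lt hD
  have hφ0 : M (φ 0) = 0 := by
    rw [hy 0 le_rfl, intervalIntegral.integral_same, intervalIntegral.integral_same, map_zero,
      map_zero, map_zero, smul_zero, neg_zero, sub_zero, add_zero]
  have hdn := fun t ht => hasDerivWithinAt_norm_sq 𝕜 (hyd t ht)
  refine image_le_of_deriv_right_lt_deriv_boundary (a := 0) (b := T) (B := fun _ => D)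
    (B' := fun _ => 0)
    (fun t ht => (hdn t ht.1).continuousWithinAt.mono Icc_subset_Ici_self)
    (fun t ht => (hdn t ht.1).mono (Ici_subset_Ici.2 ht.1)) ?_ (fun t => hasDerivAt_const t D)
    (fun t ht hft => ?_) (right_mem_Icc.2 hT)
  · simp only [hφ0, norm_zero]
    rw [zero_pow two_ne_zero]
    exact hD0.le
  · have hn : ‖M (φ t)‖ = √D := by
      rw [← hft, Real.sqrt_sq (norm_nonneg _)]
    have i1 : 0 ≤ RCLike.re (inner 𝕜 (B (φ t)) (M (φ t))) := by
      rw [re_inner_of_ae (hB (φ t)) (hM (φ t))]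
      refine integral_nonneg fun ξ => ?_
      by_cases h : ξ ∈ s
      · simp only [indicator_of_mem h]
        have := sub_nonneg.2 (hsc ξ h).1
        positivity
      · simp [h]
    have i2 : RCLike.re (inner 𝕜 (N (U t)) (M (φ t))) ≤ m * K * √D := by
      refine (re_inner_le_norm _ _).trans ?_
      rw [hn]
      refine mul_le_mul_of_nonneg_right ((hNle _).trans ?_) (Real.sqrt_nonneg _)
      exact mul_le_mul_of_nonneg_left (hK t ⟨ht.1, ht.2.le⟩) (Real.sqrt_nonneg _)
    rw [inner_add_left, inner_sub_left, inner_neg_left, RCLike.real_smul_eq_coe_smul (K := 𝕜),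
      inner_smul_left, RCLike.conj_ofReal, map_add, map_sub, map_neg, RCLike.re_ofReal_mul,
      inner_self_eq_norm_sq, hn]
    have i3 : m * K < c * √D := by
      rw [div_lt_iff₀ hc] at hsqrt
      linarith
    have i4 := mul_lt_mul_of_pos_right i3 (Real.sqrt_pos.2 hD0)
    nlinarith

/-- On an annulus `n + 1 ≤ |ξ| < n + 2` the weight is comparable to `c = (n + 1)² + η`, and the set
estimate over all measurable subsets gives a pointwise one. The constant is `36 = 4 · 9`, from `|ξ|²
+ η ≤ 4 c` and `(1 + |ξ|)² ≤ 9 c`. Staying away from `ξ = 0` keeps `c` positive even if `η = 0`. -/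
theorem IsMemorySolution.ae_bound (hφ : IsMemorySolution P φ U) {T K : ℝ} (hT : 0 ≤ T)
    (hK : ∀ t ∈ Icc 0 T, ‖U t‖ ≤ K) :
    ∀ᵐ ξ, 1 ≤ |ξ| →
      (|ξ| ^ 2 + P.η) * ‖φ T ξ‖ ^ 2 ≤ 36 * K ^ 2 * (P.μ ξ / (1 + |ξ|)) ^ 2 := by
  have hη := P.η_nonneg
  have main : ∀ n : ℕ, ∀ᵐ ξ, ξ ∈ {ξ : ℝ | (n : ℝ) + 1 ≤ |ξ| ∧ |ξ| < n + 2} →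
      (|ξ| ^ 2 + P.η) * ‖φ T ξ‖ ^ 2 ≤ 36 * K ^ 2 * (P.μ ξ / (1 + |ξ|)) ^ 2 := by
    intro n
    set S : Set ℝ := {ξ : ℝ | (n : ℝ) + 1 ≤ |ξ| ∧ |ξ| < n + 2} with hS
    have hSm : MeasurableSet S :=
      (measurableSet_le measurable_const measurable_abs).inter
        (measurableSet_lt measurable_abs measurable_const)
    set c : ℝ := ((n : ℝ) + 1) ^ 2 + P.η with hc
    have hc0 : 0 < c := by positivity
    have hn0 : (0 : ℝ) ≤ n := n.cast_nonneg
    have hSc : ∀ ξ ∈ S, c ≤ |ξ| ^ 2 + P.η ∧ |ξ| ^ 2 + P.η ≤ 4 * c := by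
      rintro ξ ⟨h1, h2⟩
      constructor
      · nlinarith
      · nlinarith
    rw [← ae_restrict_iff' hSm]
    have i1 : Integrable (fun ξ => 4 * c * ‖φ T ξ‖ ^ 2) (volume.restrict S) :=
      ((Lp.memLp (φ T)).norm.integrable_sq.const_mul (4 * c)).restrict
    have i2 : Integrable (fun ξ => 36 * K ^ 2 * (P.μ ξ / (1 + |ξ|)) ^ 2) (volume.restrict S) :=
      ((integrable_weight P).const_mul (36 * K ^ 2)).restrict
    have key := ae_le_of_forall_setIntegral_le i1 i2 fun s hs _ => ?_
    · filter_upwards [key, ae_restrict_mem hSm] with ξ h1 h2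
      exact (mul_le_mul_of_nonneg_right (hSc ξ h2).2 (sq_nonneg _)).trans h1
    · rw [Measure.restrict_restrict hs, integral_const_mul]
      have h1 := hφ.setIntegral_norm_sq_le (hs.inter hSm) hc0 (fun ξ h => hSc ξ h.2) hT hK
      have h2 := mul_le_mul_of_nonneg_left h1 (by positivity : 0 ≤ 4 * c)
      refine h2.trans ?_
      rw [← mul_assoc, ← integral_const_mul]
      refine integral_mono_of_nonneg (Eventually.of_forall fun ξ => by positivity)
        ((integrable_weight P).const_mul (36 * K ^ 2)).restrict ?_
      filter_upwards [ae_restrict_mem (hs.inter hSm)] with ξ hξ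
      obtain ⟨-, h3, h4⟩ := hξ
      have e : 4 * c * (K ^ 2 / c ^ 2) * P.μ ξ ^ 2 = 4 * K ^ 2 * P.μ ξ ^ 2 / c := by
        field_simp
      rw [e, div_pow, mul_div_assoc', div_le_div_iff₀ hc0 (by positivity)]
      have h5 : (1 + |ξ|) ^ 2 ≤ 9 * c := by nlinarith
      nlinarith [mul_le_mul_of_nonneg_left h5 (by positivity : 0 ≤ 4 * K ^ 2 * P.μ ξ ^ 2)]
  filter_upwards [ae_all_iff.2 main] with ξ h hξ
  have h1 : 1 ≤ ⌊|ξ|⌋₊ := (Nat.one_le_floor_iff _).2 hξ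
  have h2 := Nat.floor_le (abs_nonneg ξ)
  have h3 := Nat.lt_floor_add_one |ξ|
  -- Annuli are counted from `|ξ| = 1`, hence the shift; `|ξ| ≥ 1` makes the natural subtraction
  -- exact.
  refine h (⌊|ξ|⌋₊ - 1) ⟨?_, ?_⟩ <;> rw [Nat.cast_sub h1, Nat.cast_one] <;> linarith

theorem IsMemorySolution.memLp (hφ : IsMemorySolution P φ U) {t : ℝ} (ht : 0 ≤ t) :
    MemLp (fun ξ => √(|ξ| ^ 2 + P.η) • φ t ξ) 2 (volume : Measure ℝ) := by
  have hη := P.η_nonneg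
  obtain ⟨K, hK⟩ := isCompact_Icc.exists_bound_of_continuousOn
    (hφ.cont'.mono (Icc_subset_Ici_self : Icc 0 t ⊆ Ici 0))
  have hm : AEStronglyMeasurable (fun ξ => √(|ξ| ^ 2 + P.η) • φ t ξ) volume :=
    (by fun_prop : Measurable fun ξ : ℝ => √(|ξ| ^ 2 + P.η)).aestronglyMeasurable.smul
      (Lp.aestronglyMeasurable _)
  rw [memLp_two_iff_integrable_sq_norm hm]
  refine Integrable.mono' (((Lp.memLp (φ t)).norm.integrable_sq.const_mul (1 + P.η)).add
    ((integrable_weight P).const_mul (36 * K ^ 2))) (hm.norm.pow 2) ?_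
  filter_upwards [hφ.ae_bound ht hK] with ξ h
  rw [Real.norm_of_nonneg (sq_nonneg _), norm_smul, mul_pow, Real.norm_of_nonneg
    (Real.sqrt_nonneg _), Real.sq_sqrt (by positivity), Pi.add_apply]
  rcases le_or_gt 1 |ξ| with h1 | h1
  · have h2 : 0 ≤ (1 + P.η) * ‖φ t ξ‖ ^ 2 := by positivity
    linarith [h h1]
  · have h2 : 0 ≤ 36 * K ^ 2 * (P.μ ξ / (1 + |ξ|)) ^ 2 := by positivity
    have h3 : (|ξ| ^ 2 + P.η) * ‖φ t ξ‖ ^ 2 ≤ (1 + P.η) * ‖φ t ξ‖ ^ 2 := by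
      refine mul_le_mul_of_nonneg_right ?_ (sq_nonneg _)
      nlinarith [abs_nonneg ξ]
    linarith

/-- The weighted memory variable `√(|ξ|² + η) φ` is continuous in time. -/
theorem IsMemorySolution.exists_weighted (hφ : IsMemorySolution P φ U) :
    ∃ W : ℝ → Mem 𝕜 a b, ContinuousOn W (Ici 0) ∧
      ∀ t, 0 ≤ t → W t =ᵐ[volume] fun ξ => √(|ξ| ^ 2 + P.η) • φ t ξ := by
  have hη := P.η_nonneg
  have hex : ∀ t : ℝ, ∃ w : Mem 𝕜 a b, 0 ≤ t → w =ᵐ[volume] fun ξ => √(|ξ| ^ 2 + P.η) • φ t ξ := by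
    intro t
    by_cases ht : 0 ≤ t
    · exact ⟨(hφ.memLp ht).toLp _, fun _ => (hφ.memLp ht).coeFn_toLp⟩
    · exact ⟨0, fun h => absurd h ht⟩
  choose W hW using hex
  refine ⟨W, ?_, fun t ht => hW t ht⟩
  set S : ℕ → Set ℝ := fun N => {ξ : ℝ | (N : ℝ) + 1 ≤ |ξ|} with hS
  have hSm : ∀ N, MeasurableSet (S N) := fun N => measurableSet_le measurable_const measurable_abs
  have hwm : Measurable fun ξ : ℝ => √(|ξ| ^ 2 + P.η) := by fun_prop
  have hcut : ∀ N : ℕ, ∃ M : Mem 𝕜 a b →L[𝕜] Mem 𝕜 a b, ∀ φ : Mem 𝕜 a b,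
      M φ =ᵐ[volume] fun ξ => ((S N)ᶜ.indicator fun ξ : ℝ => √(|ξ| ^ 2 + P.η)) ξ • φ ξ := by
    intro N
    refine exists_mul (hwm.indicator (hSm N).compl) (C := √(((N : ℝ) + 1) ^ 2 + P.η))
      fun ξ => ?_
    by_cases h : ξ ∈ S N
    · rw [indicator_of_notMem (notMem_compl_iff.2 h), abs_zero]
      positivity
    · rw [indicator_of_mem (mem_compl h), abs_of_nonneg (Real.sqrt_nonneg _)]
      refine Real.sqrt_le_sqrt ?_
      have h1 : |ξ| < N + 1 := not_le.1 h
      nlinarith [abs_nonneg ξ]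
  choose M hM using hcut
  have htail : Tendsto (fun N => ∫ ξ in S N, (P.μ ξ / (1 + |ξ|)) ^ 2) atTop (𝓝 0) := by
    have h1 := tendsto_setIntegral_of_antitone (μ := volume) (s := S) hSm
      (fun i j hij ξ (hξ : (j : ℝ) + 1 ≤ |ξ|) => show (i : ℝ) + 1 ≤ |ξ| by
        have : (i : ℝ) ≤ j := Nat.cast_le.2 hij
        linarith) ⟨0, (integrable_weight P).integrableOn⟩
    have h2 : ⋂ N, S N = ∅ := by
      refine eq_empty_of_forall_notMem fun ξ hξ => ?_
      obtain ⟨N, hN⟩ := exists_nat_gt |ξ|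
      have := mem_iInter.1 hξ N
      simp only [hS, mem_ofPred_eq] at this
      linarith
    rwa [h2, Measure.restrict_empty, integral_zero_measure] at h1
  suffices H : ∀ T : ℝ, 0 ≤ T → ContinuousOn W (Icc 0 T) by
    intro t ht
    have h1 : Icc 0 (t + 1) ∈ 𝓝[Ici 0] t := by
      rw [← Ici_inter_Iic]
      exact inter_mem_nhdsWithin _ (Iic_mem_nhds (lt_add_one t))
    exact (H (t + 1) (by linarith [mem_Ici.1 ht]) t
      ⟨ht, (lt_add_one t).le⟩).mono_of_mem_nhdsWithin h1
  intro T hT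
  obtain ⟨K, hK⟩ := isCompact_Icc.exists_bound_of_continuousOn
    (hφ.cont'.mono (Icc_subset_Ici_self : Icc 0 T ⊆ Ici 0))
  -- The error of frequency truncation is bounded by a tail independent of `t ∈ [0, T]`, so `W` is a
  -- uniform limit of continuous functions.
  have hdist : ∀ N, ∀ t ∈ Icc 0 T, ‖W t - M N (φ t)‖ ^ 2 ≤
      36 * K ^ 2 * ∫ ξ in S N, (P.μ ξ / (1 + |ξ|)) ^ 2 := by
    intro N t ht
    have e : ((W t - M N (φ t) : Mem 𝕜 a b)) =ᵐ[volume] fun ξ =>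
        ((S N).indicator fun ξ : ℝ => √(|ξ| ^ 2 + P.η)) ξ • φ t ξ := by
      filter_upwards [Lp.coeFn_sub (W t) (M N (φ t)), hW t ht.1, hM N (φ t)] with ξ e1 e2 e3
      rw [e1, Pi.sub_apply, e2, e3]
      by_cases h : ξ ∈ S N <;> simp [h]
    rw [norm_sq_of_ae e, ← integral_const_mul, ← integral_indicator (hSm N)]
    refine integral_mono_of_nonneg (Eventually.of_forall fun ξ => by positivity)
      (((integrable_weight P).const_mul (36 * K ^ 2)).indicator (hSm N)) ?_
    filter_upwards [hφ.ae_bound ht.1 (fun r hr => hK r ⟨hr.1, hr.2.trans ht.2⟩)] with ξ hξ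
    by_cases h : ξ ∈ S N
    · simp only [indicator_of_mem h]
      rw [Real.sq_sqrt (by positivity)]
      refine hξ (le_trans ?_ h)
      have : (0 : ℝ) ≤ N := N.cast_nonneg
      linarith
    · simp [h]
  refine TendstoUniformlyOn.continuousOn (F := fun N t => M N (φ t)) (p := atTop) ?_
    (Eventually.of_forall fun N => (M N).continuous.comp_continuousOn
      (hφ.cont.mono Icc_subset_Ici_self)).frequently
  rw [Metric.tendstoUniformlyOn_iff]
  intro ε hε
  have h1 := htail.const_mul (36 * K ^ 2)
  rw [mul_zero] at h1
  filter_upwards [h1.eventually (gt_mem_nhds (show 0 < ε ^ 2 by positivity))] with N hN t ht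
  rw [dist_eq_norm]
  exact lt_of_pow_lt_pow_left₀ 2 hε.le ((hdist N t ht).trans_lt hN)

end Memory

/-! ### The energy identity for strong and mild solutions. -/

section EnergyIdentity

variable {𝕜 : Type*} [RCLike 𝕜] {P : Params}

theorem energyIdentityAt_of_strong {x₀ : State 𝕜 P} {x : ℝ → State 𝕜 P}
    (hx : IsStrongSolution (opA 𝕜 P) x₀ x) {t : ℝ} (ht : 0 ≤ t) : EnergyIdentityAt x t := by
  obtain ⟨-, y, hg, -, -, hd⟩ := hx
  obtain ⟨hxd, hy⟩ := exists_of_mem_graph_opA (hg t ht)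
  obtain ⟨-, -, -, -, h5, -, h7, -⟩ := id hxd
  refine ⟨integrable_weight_norm_sq P h5, integrable_weight_norm_sq P h7, ?_⟩
  have h := (hasDerivWithinAt_norm_sq 𝕜 (hd t ht)).const_mul (1 / 2 : ℝ)
  rw [← hy, re_inner_applyA ⟨x t, hxd⟩] at h
  refine (h.congr_deriv (by ring)).congr (fun s _ => ?_) ?_ <;>
  · rw [State.norm_sq_eq]
    ring

/-- Integrals of a mild solution over windows of fixed length are strong solutions. -/
theorem IsMildSolution.isStrongSolution_window {E : Type*} [NormedAddCommGroup E]
    [NormedSpace 𝕜 E] [NormedSpace ℝ E] [CompleteSpace E] {A : E →ₗ.[𝕜] E} {x₀ : E}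
    {x : ℝ → E} (hx : IsMildSolution A x₀ x)
    (hg : ∀ t, 0 ≤ t → (∫ s in (0 : ℝ)..t, x s, x t - x₀) ∈ A.graph) {h : ℝ} (hh : 0 ≤ h) :
    IsStrongSolution A (∫ s in (0 : ℝ)..h, x s) fun t => ∫ s in t..t + h, x s := by
  have hc := continuous_comp_max_of_continuousOn hx.1
  have hshift : ∀ t : ℝ, HasDerivAt (fun t : ℝ => t + h) 1 t := fun t => (hasDerivAt_id t).add_const h
  have heq : ∀ t, 0 ≤ t → ∫ s in t..t + h, x s =
      (∫ s in (0 : ℝ)..t + h, x (max s 0)) - ∫ s in (0 : ℝ)..t, x (max s 0) := by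
    intro t ht
    rw [intervalIntegral.integral_interval_sub_left (hc.intervalIntegrable _ _)
      (hc.intervalIntegrable _ _), integral_comp_max x ht (by linarith)]
  have hder : ∀ t, 0 ≤ t → HasDerivWithinAt (fun t => ∫ s in t..t + h, x s)
      (x (t + h) - x t) (Ici 0) t := by
    intro t ht
    have d1 := (hc.integral_hasStrictDerivAt 0 (t + h)).hasDerivAt.scomp t (hshift t)
    have d2 := (hc.integral_hasStrictDerivAt 0 t).hasDerivAt
    have d3 := (d1.sub d2).hasDerivWithinAt (s := Ici (0 : ℝ))
    rw [one_smul, max_eq_left ht, max_eq_left (by linarith)] at d3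
    exact d3.congr (fun s hs => heq s hs) (heq t ht)
  refine ⟨by simp only [zero_add], fun t => x (t + h) - x t, fun t ht => ?_,
    fun t ht => (hder t ht).continuousWithinAt, ?_, hder⟩
  · have h1 := A.graph.sub_mem (hg (t + h) (by linarith)) (hg t ht)
    rw [Prod.mk_sub_mk, sub_sub_sub_cancel_right, intervalIntegral.integral_interval_sub_left
      (intervalIntegrable_of_continuousOn_Ici hx.1 le_rfl (by linarith))
      (intervalIntegrable_of_continuousOn_Ici hx.1 le_rfl ht)] at h1
    exact h1
  · refine (hx.1.comp (by fun_prop) fun t ht => ?_).sub hx.1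
    have := mem_Ici.1 ht
    exact mem_Ici.2 (by linarith)

theorem norm_inv_smul_sq {F : Type*} [NormedAddCommGroup F] [NormedSpace ℝ F] (h : ℝ) (z : F) :
    ‖h⁻¹ • z‖ ^ 2 = h⁻¹ ^ 2 * ‖z‖ ^ 2 := by
  rw [norm_smul, mul_pow, Real.norm_eq_abs, sq_abs]

/-- The weight is unbounded and cannot be moved through the integral directly. Its bounded
substitute `(1 + √(|ξ|² + η))⁻¹` recovers `φ` from `φ + W`, commutes with the integral, and is then
inverted pointwise. -/
theorem integral_weighted {a b : ℝ} {φ W : ℝ → Mem 𝕜 a b} (hφ : ContinuousOn φ (Ici 0))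
    (hW : ContinuousOn W (Ici 0))
    (h : ∀ t, 0 ≤ t → W t =ᵐ[volume] fun ξ => √(|ξ| ^ 2 + P.η) • φ t ξ) {s t : ℝ} (hs : 0 ≤ s)
    (ht : 0 ≤ t) : (∫ r in s..t, W r : Mem 𝕜 a b) =ᵐ[volume]
      fun ξ => √(|ξ| ^ 2 + P.η) • (∫ r in s..t, φ r : Mem 𝕜 a b) ξ := by
  obtain ⟨M, hM⟩ := exists_mul (𝕜 := 𝕜) (a := a) (b := b)
    (by fun_prop : Measurable fun ξ : ℝ => (1 + √(|ξ| ^ 2 + P.η))⁻¹) (C := 1) (fun ξ => by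
      rw [abs_of_nonneg (by positivity)]
      exact inv_le_one_of_one_le₀ (by linarith [Real.sqrt_nonneg (|ξ| ^ 2 + P.η)]))
  have i1 := intervalIntegrable_of_continuousOn_Ici hφ hs ht
  have i2 := intervalIntegrable_of_continuousOn_Ici hW hs ht
  have e : ∀ r ∈ uIcc s t, φ r = M (φ r + W r) := by
    intro r hr
    have hr0 : 0 ≤ r := (le_min hs ht).trans hr.1
    refine Lp.ext ?_
    filter_upwards [hM (φ r + W r), Lp.coeFn_add (φ r) (W r), h r hr0] with ξ e1 e2 e3
    have hpos : 0 < 1 + √(|ξ| ^ 2 + P.η) := by positivity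
    have e4 : φ r ξ + √(|ξ| ^ 2 + P.η) • φ r ξ = (1 + √(|ξ| ^ 2 + P.η)) • φ r ξ := by
      rw [add_smul, one_smul]
    rw [e1, e2, Pi.add_apply, e3, e4, smul_smul, inv_mul_cancel₀ hpos.ne', one_smul]
  have e' : ∫ r in s..t, φ r = M ((∫ r in s..t, φ r) + ∫ r in s..t, W r) := by
    rw [← intervalIntegral.integral_add i1 i2,
      ← ContinuousLinearMap.intervalIntegral_comp_comm M (i1.add i2)]
    exact intervalIntegral.integral_congr e
  have h1 := hM ((∫ r in s..t, φ r) + ∫ r in s..t, W r)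
  rw [← e'] at h1
  filter_upwards [h1, Lp.coeFn_add (∫ r in s..t, φ r) (∫ r in s..t, W r)] with ξ e1 e2
  have hpos : 0 < 1 + √(|ξ| ^ 2 + P.η) := by positivity
  rw [e2, Pi.add_apply, eq_inv_smul_iff₀ hpos.ne', add_smul, one_smul] at e1
  exact (add_left_cancel e1).symm

theorem integral_weight_eq_norm_sq {a b : ℝ} {φ W : Mem 𝕜 a b}
    (h : W =ᵐ[volume] fun ξ => √(|ξ| ^ 2 + P.η) • φ ξ) :
    Integrable (fun ξ : ℝ => (|ξ| ^ 2 + P.η) * ‖φ ξ‖ ^ 2) ∧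
      ∫ ξ : ℝ, (|ξ| ^ 2 + P.η) * ‖φ ξ‖ ^ 2 = ‖W‖ ^ 2 := by
  have hη := P.η_nonneg
  have e : (fun ξ => ‖W ξ‖ ^ 2) =ᵐ[volume] fun ξ => (|ξ| ^ 2 + P.η) * ‖φ ξ‖ ^ 2 := by
    filter_upwards [h] with ξ hξ
    rw [hξ, norm_smul, mul_pow, Real.norm_of_nonneg (Real.sqrt_nonneg _),
      Real.sq_sqrt (by positivity)]
  exact ⟨(Lp.memLp W).norm.integrable_sq.congr e, by rw [norm_sq_eq_integral, integral_congr_ae e]⟩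

theorem tendsto_average {E : Type*} [NormedAddCommGroup E] [NormedSpace ℝ E] [CompleteSpace E]
    {x : ℝ → E} (hx : ContinuousOn x (Ici 0)) {t : ℝ} (ht : 0 ≤ t) :
    Tendsto (fun h : ℝ => h⁻¹ • ∫ s in t..t + h, x s) (𝓝[>] 0) (𝓝 (x t)) := by
  have hc := continuous_comp_max_of_continuousOn hx
  have h1 := hasDerivAt_iff_tendsto_slope_zero.1 (hc.integral_hasStrictDerivAt 0 t).hasDerivAt
  rw [max_eq_left ht] at h1
  refine (h1.mono_left (nhdsWithin_mono 0 fun r hr => (ne_of_gt hr : r ≠ 0))).congr' ?_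
  filter_upwards [self_mem_nhdsWithin] with h hh
  have hh0 : 0 < h := hh
  rw [intervalIntegral.integral_interval_sub_left (hc.intervalIntegrable _ _)
    (hc.intervalIntegrable _ _), integral_comp_max x ht (by linarith)]

theorem continuousOn_window {E : Type*} [NormedAddCommGroup E] [NormedSpace ℝ E]
    [CompleteSpace E] {x : ℝ → E} (hx : ContinuousOn x (Ici 0)) {h : ℝ} (hh : 0 ≤ h) :
    ContinuousOn (fun t => ∫ s in t..t + h, x s) (Ici 0) := by
  have hc := continuous_comp_max_of_continuousOn hx
  have hp : Continuous fun t => ∫ s in (0 : ℝ)..t, x (max s 0) :=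
    continuous_iff_continuousAt.2 fun t =>
      (hc.integral_hasStrictDerivAt 0 t).hasDerivAt.continuousAt
  have h1 : Continuous fun t => (∫ s in (0 : ℝ)..t + h, x (max s 0))
      - ∫ s in (0 : ℝ)..t, x (max s 0) := (hp.comp (by fun_prop)).sub hp
  refine h1.continuousOn.congr fun t ht => ?_
  have ht0 : 0 ≤ t := ht
  simp only
  rw [intervalIntegral.integral_interval_sub_left (hc.intervalIntegrable _ _)
    (hc.intervalIntegrable _ _), integral_comp_max x ht0 (by linarith)]

/-- Averages of the square of the norm of window averages converge. -/
theorem tendsto_integral_average_norm_sq {E : Type*} [NormedAddCommGroup E] [NormedSpace ℝ E]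
    [CompleteSpace E] {W : ℝ → E} (hW : ContinuousOn W (Ici 0)) {t : ℝ} (ht : 0 ≤ t) :
    Tendsto (fun h : ℝ => ∫ s in (0 : ℝ)..t, ‖h⁻¹ • ∫ r in s..s + h, W r‖ ^ 2) (𝓝[>] 0)
      (𝓝 (∫ s in (0 : ℝ)..t, ‖W s‖ ^ 2)) := by
  obtain ⟨C, hC⟩ := isCompact_Icc.exists_bound_of_continuousOn
    (hW.mono (Icc_subset_Ici_self : Icc 0 (t + 1) ⊆ Ici 0))
  refine intervalIntegral.tendsto_integral_filter_of_dominated_convergence (fun _ => C ^ 2)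
    ?_ ?_ intervalIntegrable_const (ae_of_all _ fun s hs => ?_)
  · filter_upwards [self_mem_nhdsWithin] with h hh
    refine (((continuousOn_window hW (le_of_lt hh)).const_smul h⁻¹).norm.pow 2).mono ?_
      |>.aestronglyMeasurable measurableSet_uIoc
    rw [uIoc_of_le ht]
    exact fun s hs => hs.1.le
  -- For `h ≤ 1` every window stays inside `[0, t + 1]`, where `C` bounds `W`.
  · filter_upwards [Ioc_mem_nhdsGT (zero_lt_one' ℝ)] with h hh
    refine ae_of_all _ fun s hs => ?_
    rw [uIoc_of_le ht] at hs
    rw [Real.norm_of_nonneg (sq_nonneg _)]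
    refine pow_le_pow_left₀ (norm_nonneg _) ?_ 2
    have h1 := intervalIntegral.norm_integral_le_of_norm_le_const (a := s) (b := s + h) (f := W)
      (C := C) fun r hr => hC r (by
        rw [uIoc_of_le (by linarith [hh.1])] at hr
        exact ⟨hs.1.le.trans hr.1.le, by linarith [hr.2, hs.2, hh.2]⟩)
    rw [norm_smul, Real.norm_of_nonneg (inv_nonneg.2 hh.1.le), inv_mul_le_iff₀ hh.1]
    rw [add_sub_cancel_left, abs_of_pos hh.1] at h1
    linarith
  · rw [uIoc_of_le ht] at hs
    exact (tendsto_average hW hs.1.le).norm.pow 2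

/-- This is the memory component of `x(t) - x₀ = A ∫₀ᵗ x`; bounded component maps commute with the
integral. -/
theorem isMemorySolution₁ {x₀ : State 𝕜 P} {x : ℝ → State 𝕜 P} (h0 : x₀.φ₁ = 0)
    (hx : IsMildSolution (opA 𝕜 P) x₀ x) :
    IsMemorySolution P (fun t => (x t).φ₁) fun t => (x t).U where
  cont := (State.mem₁ 𝕜 P).continuous.comp_continuousOn hx.1
  cont' := (State.velU 𝕜 P).continuous.comp_continuousOn hx.1
  eq t ht := by
    have hi := intervalIntegrable_of_continuousOn_Ici hx.1 le_rfl ht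
    obtain ⟨hd, e⟩ := exists_of_mem_graph_opA (hx.mem_graph ht)
    have e1 : (x t).φ₁ = (applyA ⟨_, hd⟩).φ₁ := by
      rw [e]
      change (x t).φ₁ = State.mem₁ 𝕜 P (x t - x₀)
      rw [map_sub, State.mem₁_apply, State.mem₁_apply, h0, sub_zero]
    have e2 := applyA_φ₁ ⟨_, hd⟩
    rw [← e1] at e2
    have e3 : (∫ s in (0 : ℝ)..t, x s).φ₁ = ∫ s in (0 : ℝ)..t, (x s).φ₁ :=
      (ContinuousLinearMap.intervalIntegral_comp_comm (State.mem₁ 𝕜 P) hi).symm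
    have e4 : (∫ s in (0 : ℝ)..t, x s).U = ∫ s in (0 : ℝ)..t, (x s).U :=
      (ContinuousLinearMap.intervalIntegral_comp_comm (State.velU 𝕜 P) hi).symm
    rwa [e3, e4] at e2

theorem isMemorySolution₂ {x₀ : State 𝕜 P} {x : ℝ → State 𝕜 P} (h0 : x₀.φ₂ = 0)
    (hx : IsMildSolution (opA 𝕜 P) x₀ x) :
    IsMemorySolution P (fun t => (x t).φ₂) fun t => (x t).V where
  cont := (State.mem₂ 𝕜 P).continuous.comp_continuousOn hx.1
  cont' := (State.velV 𝕜 P).continuous.comp_continuousOn hx.1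
  eq t ht := by
    have hi := intervalIntegrable_of_continuousOn_Ici hx.1 le_rfl ht
    obtain ⟨hd, e⟩ := exists_of_mem_graph_opA (hx.mem_graph ht)
    have e1 : (x t).φ₂ = (applyA ⟨_, hd⟩).φ₂ := by
      rw [e]
      change (x t).φ₂ = State.mem₂ 𝕜 P (x t - x₀)
      rw [map_sub, State.mem₂_apply, State.mem₂_apply, h0, sub_zero]
    have e2 := applyA_φ₂ ⟨_, hd⟩
    rw [← e1] at e2
    have e3 : (∫ s in (0 : ℝ)..t, x s).φ₂ = ∫ s in (0 : ℝ)..t, (x s).φ₂ :=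
      (ContinuousLinearMap.intervalIntegral_comp_comm (State.mem₂ 𝕜 P) hi).symm
    have e4 : (∫ s in (0 : ℝ)..t, x s).V = ∫ s in (0 : ℝ)..t, (x s).V :=
      (ContinuousLinearMap.intervalIntegral_comp_comm (State.velV 𝕜 P) hi).symm
    rwa [e3, e4] at e2

theorem energyIdentityAt_of_mild {x₀ : State 𝕜 P} {x : ℝ → State 𝕜 P} (h₁ : x₀.φ₁ = 0)
    (h₂ : x₀.φ₂ = 0) (hx : IsMildSolution (opA 𝕜 P) x₀ x) {t : ℝ} (ht : 0 ≤ t) :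
    EnergyIdentityAt x t := by
  have hm₁ := isMemorySolution₁ h₁ hx
  have hm₂ := isMemorySolution₂ h₂ hx
  obtain ⟨W₁, hW₁, hW₁e⟩ := hm₁.exists_weighted
  obtain ⟨W₂, hW₂, hW₂e⟩ := hm₂.exists_weighted
  have hn₁ : ContinuousOn (fun s => ‖W₁ s‖ ^ 2) (Ici 0) := hW₁.norm.pow 2
  have hn₂ : ContinuousOn (fun s => ‖W₂ s‖ ^ 2) (Ici 0) := hW₂.norm.pow 2
  -- The integrated energy identity of the strong solution obtained by averaging over `[t, t + h]`.
  have window : ∀ h : ℝ, 0 < h → ∀ t, 0 ≤ t →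
      ‖h⁻¹ • ∫ s in t..t + h, x s‖ ^ 2 = ‖h⁻¹ • ∫ s in (0 : ℝ)..0 + h, x s‖ ^ 2
        - 2 * P.c * (∫ s in (0 : ℝ)..t, ‖h⁻¹ • ∫ r in s..s + h, W₁ r‖ ^ 2)
        - 2 * P.c * ∫ s in (0 : ℝ)..t, ‖h⁻¹ • ∫ r in s..s + h, W₂ r‖ ^ 2 := by
    intro h hh t ht
    have hstrong := hx.isStrongSolution_window (fun t ht => hx.mem_graph ht) hh.le
    set V₁ : ℝ → Mem 𝕜 (-P.L) 0 := fun s => ∫ r in s..s + h, W₁ r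
    set V₂ : ℝ → Mem 𝕜 0 P.L := fun s => ∫ r in s..s + h, W₂ r
    have hV₁ : ContinuousOn (fun s => ‖V₁ s‖ ^ 2) (Ici 0) := (continuousOn_window hW₁ hh.le).norm.pow 2
    have hV₂ : ContinuousOn (fun s => ‖V₂ s‖ ^ 2) (Ici 0) := (continuousOn_window hW₂ hh.le).norm.pow 2
    have hder : ∀ s, 0 ≤ s → HasDerivWithinAt (fun s => (∫ r in s..s + h, x r).energy)
        (-(P.c * ‖V₁ s‖ ^ 2) - P.c * ‖V₂ s‖ ^ 2) (Ici 0) s := by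
      intro s hs
      have hi := intervalIntegrable_of_continuousOn_Ici hx.1 hs (by linarith : 0 ≤ s + h)
      obtain ⟨-, -, hd⟩ := energyIdentityAt_of_strong hstrong hs
      have e1 : (∫ r in s..s + h, x r).φ₁ = ∫ r in s..s + h, (x r).φ₁ :=
        (ContinuousLinearMap.intervalIntegral_comp_comm (State.mem₁ 𝕜 P) hi).symm
      have e2 : (∫ r in s..s + h, x r).φ₂ = ∫ r in s..s + h, (x r).φ₂ :=
        (ContinuousLinearMap.intervalIntegral_comp_comm (State.mem₂ 𝕜 P) hi).symm
      have w1 := integral_weighted hm₁.cont hW₁ hW₁e hs (by linarith : 0 ≤ s + h)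
      have w2 := integral_weighted hm₂.cont hW₂ hW₂e hs (by linarith : 0 ≤ s + h)
      rw [← e1] at w1
      rw [← e2] at w2
      rw [(integral_weight_eq_norm_sq w1).2, (integral_weight_eq_norm_sq w2).2] at hd
      exact hd
    -- Energy plus accumulated dissipation is conserved.
    have hfun : ∀ s, 0 ≤ s → HasDerivWithinAt (fun s => (∫ r in s..s + h, x r).energy
        + P.c * (∫ r in (0 : ℝ)..s, ‖V₁ r‖ ^ 2) + P.c * ∫ r in (0 : ℝ)..s, ‖V₂ r‖ ^ 2)
        0 (Ici 0) s := by
      intro s hs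
      refine (((hder s hs).add ((hasDerivWithinAt_integral_Ici hV₁ hs).const_mul P.c)).add
        ((hasDerivWithinAt_integral_Ici hV₂ hs).const_mul P.c)).congr_deriv ?_
      ring
    have hconst := constant_of_has_deriv_right_zero (a := 0) (b := t)
      (fun s hs => (hfun s hs.1).continuousWithinAt.mono Icc_subset_Ici_self)
      (fun s hs => (hfun s hs.1).mono (Ici_subset_Ici.2 hs.1)) t (right_mem_Icc.2 ht)
    simp only [intervalIntegral.integral_same, mul_zero, add_zero] at hconst
    simp only [norm_inv_smul_sq, intervalIntegral.integral_const_mul]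
    simp only [State.norm_sq_eq]
    linear_combination 2 * (h⁻¹) ^ 2 * hconst
  -- Let `h → 0+` in `window`; continuity of `W₁` and `W₂` lets the dissipation terms converge.
  have energy_eq : ∀ t, 0 ≤ t → (x t).energy = (x 0).energy
      - P.c * (∫ s in (0 : ℝ)..t, ‖W₁ s‖ ^ 2) - P.c * ∫ s in (0 : ℝ)..t, ‖W₂ s‖ ^ 2 := by
    intro t ht
    have l1 := (tendsto_average hx.1 ht).norm.pow 2
    have l2 := (((tendsto_average hx.1 le_rfl).norm.pow 2).sub
      ((tendsto_integral_average_norm_sq hW₁ ht).const_mul (2 * P.c))).sub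
      ((tendsto_integral_average_norm_sq hW₂ ht).const_mul (2 * P.c))
    have l3 := tendsto_nhds_unique_of_eventuallyEq l1 l2 (by
      filter_upwards [self_mem_nhdsWithin] with h hh
      exact window h hh t ht)
    rw [State.norm_sq_eq, State.norm_sq_eq] at l3
    linarith
  obtain ⟨i1, e1⟩ := integral_weight_eq_norm_sq (hW₁e t ht)
  obtain ⟨i2, e2⟩ := integral_weight_eq_norm_sq (hW₂e t ht)
  refine ⟨i1, i2, ?_⟩
  rw [e1, e2]
  have hd := (((hasDerivWithinAt_integral_Ici hn₁ ht).const_mul P.c).const_sub (x 0).energy).sub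
    ((hasDerivWithinAt_integral_Ici hn₂ ht).const_mul P.c)
  exact hd.congr (fun s hs => energy_eq s hs) (energy_eq t ht)

end EnergyIdentity

end FracWave

end

/-! ### Well-posedness and energy balance of the augmented system. -/

theorem mainTheorem4 {𝕜 : Type*} [RCLike 𝕜] (P : FracWave.Params) :
    CompleteSpace (FracWave.State 𝕜 P) ∧
    (∃ S : ℝ≥0 → FracWave.State 𝕜 P →L[𝕜] FracWave.State 𝕜 P,
      FracWave.IsContractionSemigroup S ∧ FracWave.IsGenerator (FracWave.opA 𝕜 P) S) ∧
    (∀ x₀ : FracWave.State 𝕜 P,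
      ∃ x : ℝ → FracWave.State 𝕜 P, FracWave.IsMildSolution (FracWave.opA 𝕜 P) x₀ x ∧
        ∀ y : ℝ → FracWave.State 𝕜 P, FracWave.IsMildSolution (FracWave.opA 𝕜 P) x₀ y →
          EqOn y x (Ici 0)) ∧
    (∀ x₀ ∈ (FracWave.opA 𝕜 P).domain,
      ∃ x : ℝ → FracWave.State 𝕜 P, FracWave.IsStrongSolution (FracWave.opA 𝕜 P) x₀ x ∧
        ∀ y : ℝ → FracWave.State 𝕜 P, FracWave.IsStrongSolution (FracWave.opA 𝕜 P) x₀ y →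
          EqOn y x (Ici 0)) ∧
    (∀ (x₀ : FracWave.State 𝕜 P) (x : ℝ → FracWave.State 𝕜 P),
      FracWave.IsStrongSolution (FracWave.opA 𝕜 P) x₀ x →
        ∀ t, 0 ≤ t → FracWave.EnergyIdentityAt x t) ∧
    (∀ (x₀ : FracWave.State 𝕜 P) (x : ℝ → FracWave.State 𝕜 P), x₀.φ₁ = 0 → x₀.φ₂ = 0 →
      FracWave.IsMildSolution (FracWave.opA 𝕜 P) x₀ x →
        ∀ t, 0 ≤ t → FracWave.EnergyIdentityAt x t) := by
  have hA := FracWave.isMaxDissipative_opA (𝕜 := 𝕜) P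
  refine ⟨inferInstance, ?_, fun x₀ => ?_, fun x₀ hx₀ => ?_, fun x₀ x hx t ht => ?_,
    fun x₀ x h₁ h₂ hx t ht => ?_⟩
  · obtain ⟨S, hS, hgen, -⟩ := hA.exists_generated
    exact ⟨S, hS, hgen⟩
  · obtain ⟨x, hx⟩ := hA.exists_mild x₀
    exact ⟨x, hx, fun y hy => hA.mild_unique hx hy⟩
  · obtain ⟨x, hx⟩ := hA.exists_strong hx₀
    exact ⟨x, hx, fun y hy => hA.strong_unique hx hy⟩
  · exact FracWave.energyIdentityAt_of_strong hx ht
  · exact FracWave.energyIdentityAt_of_mild h₁ h₂ hx ht
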